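/- For $n\in\mathbb N$ and real $m\in[0,n^3]$ let $\boldsymbol H\sim\mathcal H_3(m,n)$ be the random 3-uniform hypergraph on $[n]$ in which each of the $n^3$ ordered triples $U\in[n]^3$ is a hyperedge independently with probability $m/n^3$. A 3XOR instance on a hypergraph $H$ assigns a sign $b_U\in\{\pm1\}$ to each hyperedge $U\in H$; an assignment $x\in\{\pm1\}^n$ satisfies the constraint $U$ if $x_{U_1}x_{U_2}x_{U_3}=b_U$, and is $(1-\eta)$-satisfying if it satisfies at least $(1-\eta)|H|$ of the constraints. A diameter-$d$ cluster is a Hamming ball $\{x\in\{\pm1\}^n : \mathrm{dist}(c,x)\le d/2\}$ with centre $c\in\{\pm1\}^n$. **Theorem.** There are universal constants $\eta_0>0$ and $C>0$ such that for every constant $\delta\in(0,2)$ there is a deterministic polynomial-time algorithm $\mathcal A$ with the following properties. Its input is a hypergraph $H\subseteq[n]^3$ together with the number $\lfloor\eta|H|\rfloor$ of constraints that may be violated and the cluster radius $\lfloor d/2\rfloor$, and its output is a natural number. Polynomial time is measured on a random access machine with logarithmic cost, and means polynomial in $n$ and the bit lengths of the two integers. 1. (Certification.) For every $n$, every $H\subseteq[n]^3$,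 all real $\eta,d\ge0$ and every 3XOR instance on $H$, the $(1-\eta)$-satisfying assignments are covered by at most $\mathcal A(H,\lfloor\eta|H|\rfloor,\lfloor d/2\rfloor)$ diameter-$d$ clusters. 2. (Bound.) Let $\Delta=n^\delta$, $m=\Delta n$ and $\theta=\max(2\eta,\ \Delta^{-1/2}\log n)$. For every $K\in\mathbb N$ there is $n_0$ such that for all $n\ge n_0$ and all $\eta\in[0,\eta_0]$, with probability at least $1-n^{-K}$ over $\boldsymbol H\sim\mathcal H_3(m,n)$, $$\mathcal A\big(\boldsymbol H,\lfloor\eta|\boldsymbol H|\rfloor,\lfloor\theta n/2\rfloor\big)\ \le\ \exp\!\big(C\,\theta^2\log(1/\theta)\,n\big).$$ In particular, with probability at least $1-1/\mathrm{poly}(n)$ the algorithm certifies, simultaneously for all 3XOR instances on $\boldsymbol H$, that the $(1-\eta)$-satisfying assignments are covered by $\exp(O(\theta^2\log(1/\theta))n)$ clusters of diameter $\theta n$. -/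

import Mathlib

open ProbabilityTheory MeasureTheory

/-! ### 3-uniform hypergraphs, 3XOR instances, clusters -/

/-- A 3-uniform hypergraph on the vertex set `[n]`: a set of ordered triples in `[n]³`
(triples with repeated vertices are allowed). -/
abbrev Hypergraph3 (n : ℕ) : Type := Set (Fin 3 → Fin n)

/-- The random 3-uniform hypergraph on `[n]` with expected number of hyperedges `m`: each of the
`n³` triples is included independently with probability `m / n³`.  (The projection to `[0, 1]` does
nothing when `0 ≤ m ≤ n³`.) -/
noncomputable def randomHypergraph3 (n : ℕ) (m : ℝ) : Measure (Hypergraph3 n) :=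
  setBernoulli Set.univ (Set.projIcc (0 : ℝ) 1 zero_le_one (m / (n : ℝ) ^ 3))

/-- A 3XOR instance on the hypergraph `H`: a sign in `{±1}` for every hyperedge of `H`. -/
abbrev XORInstance {n : ℕ} (H : Hypergraph3 n) : Type := H → ℤˣ

/-- An assignment `x ∈ {±1}ⁿ`. -/
abbrev Assignment (n : ℕ) : Type := Fin n → ℤˣ

/-- The number of constraints `x_{U 0} · x_{U 1} · x_{U 2} = b U`, `U ∈ H`, satisfied by `x`. -/
noncomputable def XORInstance.numSat {n : ℕ} {H : Hypergraph3 n} (b : XORInstance H)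
    (x : Assignment n) : ℕ :=
  {U : H | ∏ i, x (U.1 i) = b U}.ncard

/-- The set of `(1 - η)`-satisfying assignments: those that satisfy at least a `1 - η` fraction of
the constraints. -/
def XORInstance.approxSolutions {n : ℕ} {H : Hypergraph3 n} (b : XORInstance H) (η : ℝ) :
    Set (Assignment n) :=
  {x | (1 - η) * (H.ncard : ℝ) ≤ (b.numSat x : ℝ)}

/-- The diameter-`d` cluster around `c`: the Hamming ball of radius `d / 2`. -/
def cluster {n : ℕ} (c : Assignment n) (d : ℝ) : Set (Assignment n) :=
  {x | (hammingDist c x : ℝ) ≤ d / 2}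

/-- `S` is covered by at most `N` diameter-`d` clusters. -/
def CoveredByClusters {n : ℕ} (S : Set (Assignment n)) (d : ℝ) (N : ℕ) : Prop :=
  ∃ centers : Finset (Assignment n), centers.card ≤ N ∧ S ⊆ ⋃ c ∈ centers, cluster c d

/-- `θ = max (2η, Δ^{-1/2} log n)`. -/
noncomputable def clusterScale (n : ℕ) (Δ η : ℝ) : ℝ :=
  max (2 * η) (Δ ^ (-(1 / 2) : ℝ) * Real.log n)

/-! ### Random access machines with logarithmic cost

Deterministic structured programs over a random access memory whose cells hold natural numbers.
Every operation is charged the bit lengths of its operands (the logarithmic cost criterion), so that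
polynomial time here agrees with polynomial time on Turing machines. -/

namespace RAM

/-- A memory: `M a i` is the content of the cell with address `i` in bank `a`. A program mentions
only finitely many banks. -/
abbrev Memory : Type := ℕ → ℕ → ℕ

/-- Arithmetic expressions; `read a i` is indirect addressing. -/
inductive Expr : Type
  | const (k : ℕ) : Expr
  | read (a : ℕ) (i : Expr) : Expr
  | add (e f : Expr) : Expr
  | sub (e f : Expr) : Expr
  | mul (e f : Expr) : Expr
  | div (e f : Expr) : Expr

/-- The value of an expression; subtraction is truncated, division is integer division. -/
def Expr.eval (M : Memory) : Expr → ℕ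
  | .const k => k
  | .read a i => M a (i.eval M)
  | .add e f => e.eval M + f.eval M
  | .sub e f => e.eval M - f.eval M
  | .mul e f => e.eval M * f.eval M
  | .div e f => e.eval M / f.eval M

/-- The logarithmic cost of evaluating an expression. -/
def Expr.cost (M : Memory) : Expr → ℕ
  | .const k => Nat.size k + 1
  | .read a i => i.cost M + Nat.size (i.eval M) + Nat.size (M a (i.eval M)) + 1
  | .add e f => e.cost M + f.cost M + Nat.size (e.eval M) + Nat.size (f.eval M) + 1
  | .sub e f => e.cost M + f.cost M + Nat.size (e.eval M) + Nat.size (f.eval M) + 1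
  | .mul e f => e.cost M + f.cost M + Nat.size (e.eval M) + Nat.size (f.eval M) + 1
  | .div e f => e.cost M + f.cost M + Nat.size (e.eval M) + Nat.size (f.eval M) + 1

/-- Programs; a guard counts as true when its value is not `0`. -/
inductive Prog : Type
  | skip : Prog
  | write (a : ℕ) (i e : Expr) : Prog
  | seq (p q : Prog) : Prog
  | ite (g : Expr) (p q : Prog) : Prog
  | loop (g : Expr) (p : Prog) : Prog

/-- `Run p M M' t`: started in memory `M`, the program `p` halts in memory `M'` at total
cost `t`. -/
inductive Run : Prog → Memory → Memory → ℕ → Prop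
  | skip (M : Memory) : Run .skip M M 1
  | write (M : Memory) (a : ℕ) (i e : Expr) :
      Run (.write a i e) M
        (Function.update M a (Function.update (M a) (i.eval M) (e.eval M)))
        (i.cost M + e.cost M + Nat.size (i.eval M) + Nat.size (e.eval M) + 1)
  | seq {p q : Prog} {M M' M'' : Memory} {s t : ℕ} :
      Run p M M' s → Run q M' M'' t → Run (.seq p q) M M'' (s + t)
  | ite_true {g : Expr} {p q : Prog} {M M' : Memory} {t : ℕ} :
      g.eval M ≠ 0 → Run p M M' t → Run (.ite g p q) M M' (g.cost M + t + 1)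
  | ite_false {g : Expr} {p q : Prog} {M M' : Memory} {t : ℕ} :
      g.eval M = 0 → Run q M M' t → Run (.ite g p q) M M' (g.cost M + t + 1)
  | loop_done {g : Expr} {p : Prog} {M : Memory} :
      g.eval M = 0 → Run (.loop g p) M M (g.cost M + 1)
  | loop_step {g : Expr} {p : Prog} {M M' M'' : Memory} {s t : ℕ} :
      g.eval M ≠ 0 → Run p M M' s → Run (.loop g p) M' M'' t →
        Run (.loop g p) M M'' (g.cost M + s + t + 1)

end RAM

/-! ### Certification algorithms -/

/-- What a certification algorithm computes: from a hypergraph `H` on `[n]`, a number `t` (how many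
constraints an assignment may violate) and a radius `r`, a natural number. -/
abbrev Certifier : Type := (n : ℕ) → Hypergraph3 n → ℕ → ℕ → ℕ

open Classical in
/-- The input memory: bank `0` holds `n, t, r`, bank `1` holds the `0/1` adjacency tensor of `H`, and
all other cells are `0`. -/
noncomputable def inputMemory (n : ℕ) (H : Hypergraph3 n) (t r : ℕ) : RAM.Memory
  | 0, 0 => n
  | 0, 1 => t
  | 0, 2 => r
  | 1, i => if ∃ U ∈ H, i = ((U 0 : ℕ) * n + (U 1 : ℕ)) * n + (U 2 : ℕ) then 1 else 0
  | _, _ => 0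

/-- `𝒜` is computed by a program that halts on every input, with the output in cell `0` of bank
`2`, at a cost polynomial in `n` and the bit lengths of `t` and `r`. -/
def Certifier.IsPolyTime (𝒜 : Certifier) : Prop :=
  ∃ (p : RAM.Prog) (P : Polynomial ℕ), ∀ (n : ℕ) (H : Hypergraph3 n) (t r : ℕ),
    ∃ (M : RAM.Memory) (T : ℕ), RAM.Run p (inputMemory n H t r) M T ∧
      M 2 0 = 𝒜 n H t r ∧ T ≤ P.eval (n + Nat.size t + Nat.size r)

/-- Soundness of the certificates: on *every* hypergraph `H` and for *every* 3XOR instance on `H`,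
the output bounds the number of diameter-`d` clusters needed to cover the `(1 - η)`-satisfying
assignments.  The integer inputs `⌊η |H|⌋` and `⌊d / 2⌋` carry all the information in `η` and `d` that
matters, as numbers of violated constraints and Hamming distances are integers. -/
def Certifier.IsSound (𝒜 : Certifier) : Prop :=
  ∀ (n : ℕ) (H : Hypergraph3 n) (η d : ℝ), 0 ≤ η → 0 ≤ d → ∀ b : XORInstance H,
    CoveredByClusters (b.approxSolutions η) d (𝒜 n H ⌊η * (H.ncard : ℝ)⌋₊ ⌊d / 2⌋₊)

/-!
For a position `c`, a vertex `a` and a window length `s`, let `B` be the matrix that counts, for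
`j` and `k`, the hyperedges with `j` and `k` at the positions other than `c` and with an element of
the cyclic window `a, …, a + s - 1` at position `c`. A hypergraph is window regular when no vertex
has small degree and every `B` is close in spectral norm to its average. The spectral norm is
certified by a trace moment of order `log n` of the Gram matrix, which is exact integer arithmetic.

Let `x` and `y` be approximate solutions that satisfy nearly all constraints whose first vertex lies
in a window on which they agree. These constraints say that `x j * x k = y j * y k` for nearly all
pairs `j`, `k` counted by `B`, so regularity makes the set where `x` and `y` differ nearly empty or
nearly everything. The latter would violate most constraints, as the product of three changed signs
changes, and in the former case the degrees improve the bound on the distance to `t n / |H|`, where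
`t` is the number of violated constraints. By averaging, every approximate solution violates at most
its share of constraints on some window, so `n * 2 ^ s` clusters suffice. The window length
`s ≈ θ ^ 2 n` makes `B` dense enough for regularity when `δ ≤ 1`. For `δ > 1` windows of length `1`
are already regular, and averaging over the windows on which `x` and `y` agree, without guessing the
restriction, shows that a single cluster suffices.

For a random hypergraph the degrees concentrate by Chernoff bounds, and the trace moments of the
centered matrices are bounded by the method of moments, exploring walks one label at a time. The
program works modulo `2 ^ (50 n ^ 2 + 1)`. This keeps the cells that it writes polynomially short,
and it exceeds every number that the tests compare, so reduction does not change their outcomes.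
-/

namespace ThreeXOR

/-! ### Spectral norms and high moments of real matrices -/

section MatrixNorm

open scoped Matrix Matrix.Norms.L2Operator

lemma norm_pow_of_isSelfAdjoint {E : Type*} [NormedRing E] [StarRing E] [CStarRing E]
    {x : E} (hx : IsSelfAdjoint x) {k : ℕ} (hk : k ≠ 0) : ‖x ^ k‖ = ‖x‖ ^ k := by
  refine le_antisymm (norm_pow_le' x (Nat.pos_of_ne_zero hk)) ?_
  rcases eq_or_ne ‖x‖ 0 with hx0 | hx0
  · rw [hx0, zero_pow hk]
    exact norm_nonneg _
  have hlt : k < 2 ^ k := Nat.lt_two_pow_self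
  have hsplit : k + (2 ^ k - k) = 2 ^ k := by omega
  have key : ‖x‖ ^ k * ‖x‖ ^ (2 ^ k - k) ≤ ‖x ^ k‖ * ‖x‖ ^ (2 ^ k - k) :=
    calc ‖x‖ ^ k * ‖x‖ ^ (2 ^ k - k) = ‖x ^ 2 ^ k‖ := by
          rw [← pow_add, hsplit, hx.norm_pow_two_pow]
      _ = ‖x ^ k * x ^ (2 ^ k - k)‖ := by rw [← pow_add, hsplit]
      _ ≤ ‖x ^ k‖ * ‖x ^ (2 ^ k - k)‖ := norm_mul_le _ _
      _ ≤ ‖x ^ k‖ * ‖x‖ ^ (2 ^ k - k) := by gcongr; exact norm_pow_le' x (by omega)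
  exact le_of_mul_le_mul_right key (by positivity)

section Frobenius

variable {𝕜 m n : Type*} [RCLike 𝕜] [Fintype m] [Fintype n] [DecidableEq n]

lemma l2_opNorm_sq_le_sum_norm_sq (A : Matrix m n 𝕜) : ‖A‖ ^ 2 ≤ ∑ i, ∑ j, ‖A i j‖ ^ 2 := by
  have hF : 0 ≤ ∑ i, ∑ j, ‖A i j‖ ^ 2 := by positivity
  rw [← Real.le_sqrt (norm_nonneg _) hF, Matrix.l2_opNorm_def]
  refine ContinuousLinearMap.opNorm_le_bound _ (Real.sqrt_nonneg _) fun x => ?_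
  rw [EuclideanSpace.norm_eq, EuclideanSpace.norm_eq, ← Real.sqrt_mul hF, Finset.sum_mul]
  refine Real.sqrt_le_sqrt (Finset.sum_le_sum fun i _ => ?_)
  calc ‖∑ j, A i j * x j‖ ^ 2 ≤ (∑ j, ‖A i j‖ * ‖x j‖) ^ 2 := by
        gcongr
        exact (norm_sum_le _ _).trans_eq (by simp only [norm_mul])
    _ ≤ (∑ j, ‖A i j‖ ^ 2) * ∑ j, ‖x j‖ ^ 2 := Finset.sum_mul_sq_le_sq_mul_sq _ _ _

lemma sum_norm_sq_le_card_mul_l2_opNorm_sq (A : Matrix m n 𝕜) :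
    ∑ i, ∑ j, ‖A i j‖ ^ 2 ≤ Fintype.card n * ‖A‖ ^ 2 := by
  have hcol : ∀ j, ∑ i, ‖A i j‖ ^ 2 ≤ ‖A‖ ^ 2 := fun j => by
    have h := A.l2_opNorm_mulVec (EuclideanSpace.single j 1)
    rw [PiLp.norm_single, norm_one, mul_one, EuclideanSpace.norm_eq] at h
    rw [← Real.sqrt_le_left (norm_nonneg _)]
    simpa using h
  rw [Finset.sum_comm]
  exact (Finset.sum_le_sum fun j _ => hcol j).trans_eq (by simp)

end Frobenius

variable {m n : Type*} [Fintype m] [Fintype n]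

lemma norm_toLp_two (u : n → ℝ) : ‖WithLp.toLp 2 u‖ = √(∑ i, u i ^ 2) := by
  simp [EuclideanSpace.norm_eq]

lemma abs_dotProduct_mulVec_le [DecidableEq n] (A : Matrix m n ℝ) (u : m → ℝ) (v : n → ℝ) :
    |u ⬝ᵥ A *ᵥ v| ≤ ‖A‖ * (√(∑ i, u i ^ 2) * √(∑ j, v j ^ 2)) := by
  calc |u ⬝ᵥ A *ᵥ v| = |inner ℝ (WithLp.toLp 2 (A *ᵥ v)) (WithLp.toLp 2 u)| := by
        rw [EuclideanSpace.inner_toLp_toLp, star_trivial]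
    _ ≤ ‖WithLp.toLp 2 (A *ᵥ v)‖ * ‖WithLp.toLp 2 u‖ := abs_real_inner_le_norm _ _
    _ ≤ ‖A‖ * ‖WithLp.toLp 2 v‖ * ‖WithLp.toLp 2 u‖ := by
        gcongr
        exact A.l2_opNorm_mulVec (WithLp.toLp 2 v)
    _ = ‖A‖ * (√(∑ i, u i ^ 2) * √(∑ j, v j ^ 2)) := by rw [norm_toLp_two, norm_toLp_two]; ring

lemma l2_opNorm_const_le (c : ℝ) [DecidableEq n] :
    ‖(Matrix.of fun _ _ => c : Matrix n n ℝ)‖ ≤ Fintype.card n * |c| := by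
  refine le_of_pow_le_pow_left₀ two_ne_zero (by positivity)
    ((l2_opNorm_sq_le_sum_norm_sq _).trans_eq ?_)
  simp only [Matrix.of_apply, Real.norm_eq_abs, sq_abs, Finset.sum_const, Finset.card_univ,
    nsmul_eq_mul, mul_pow]
  ring

/-- The squared Frobenius norm of `(A Aᵀ) ^ k`, which is the trace of `(A Aᵀ) ^ (2 k)`. For `k` of
the order of the logarithm of the dimension its `4 k`-th root is within a constant factor of the
spectral norm, so it certifies a spectral norm bound by exact arithmetic on the entries. -/
def gramMoment {R : Type*} [CommSemiring R] [DecidableEq m] (A : Matrix m n R) (k : ℕ) : R :=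
  ∑ i, ∑ j, ((A * Aᵀ) ^ k) i j ^ 2

section GramMoment

variable [DecidableEq m]

lemma gramMoment_eq_trace {R : Type*} [CommSemiring R] (A : Matrix m n R) (k : ℕ) :
    gramMoment A k = ((A * Aᵀ) ^ (2 * k)).trace := by
  have hsymm : ((A * Aᵀ) ^ k)ᵀ = (A * Aᵀ) ^ k := by
    rw [Matrix.transpose_pow, Matrix.transpose_mul, Matrix.transpose_transpose]
  have hentry (i j : m) : ((A * Aᵀ) ^ k) j i = ((A * Aᵀ) ^ k) i j :=
    congrFun (congrFun hsymm i) j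
  simp_rw [two_mul, pow_add, Matrix.trace, Matrix.diag, Matrix.mul_apply, hentry, ← sq, gramMoment]

lemma map_gramMoment {R S : Type*} [CommSemiring R] [CommSemiring S] (f : R →+* S)
    (A : Matrix m n R) (k : ℕ) : f (gramMoment A k) = gramMoment (A.map f) k := by
  have hpow : ((A * Aᵀ) ^ k).map f = (A.map f * (A.map f)ᵀ) ^ k := by
    rw [← Matrix.transpose_map, ← Matrix.map_mul]
    exact map_pow f.mapMatrix (A * Aᵀ) k
  simp only [gramMoment, map_sum, map_pow, ← hpow, Matrix.map_apply]

variable [DecidableEq n]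

lemma l2_opNorm_mul_transpose_pow (A : Matrix m n ℝ) {k : ℕ} (hk : k ≠ 0) :
    ‖(A * Aᵀ) ^ k‖ = ‖A‖ ^ (2 * k) := by
  have hsa : IsSelfAdjoint (A * Aᵀ) := by
    rw [← Matrix.conjTranspose_eq_transpose_of_trivial]
    exact Matrix.isHermitian_mul_conjTranspose_self A
  have hsq : ‖A * Aᵀ‖ = ‖A‖ ^ 2 := by
    have h := Matrix.l2_opNorm_conjTranspose_mul_self Aᴴ
    rwa [Matrix.conjTranspose_conjTranspose, Matrix.l2_opNorm_conjTranspose, ← sq,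
      Matrix.conjTranspose_eq_transpose_of_trivial] at h
  rw [norm_pow_of_isSelfAdjoint hsa hk, hsq, pow_mul]

lemma l2_opNorm_pow_le_gramMoment (A : Matrix m n ℝ) {k : ℕ} (hk : k ≠ 0) :
    ‖A‖ ^ (4 * k) ≤ gramMoment A k := by
  have h := l2_opNorm_sq_le_sum_norm_sq ((A * Aᵀ) ^ k)
  simp only [Real.norm_eq_abs, sq_abs] at h
  rwa [l2_opNorm_mul_transpose_pow A hk, ← pow_mul, show 2 * k * 2 = 4 * k by ring] at h

lemma gramMoment_le_card_mul_l2_opNorm_pow (A : Matrix m n ℝ) {k : ℕ} (hk : k ≠ 0) :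
    gramMoment A k ≤ Fintype.card m * ‖A‖ ^ (4 * k) := by
  have h := sum_norm_sq_le_card_mul_l2_opNorm_sq ((A * Aᵀ) ^ k)
  simp only [Real.norm_eq_abs, sq_abs] at h
  rwa [l2_opNorm_mul_transpose_pow A hk, ← pow_mul, show 2 * k * 2 = 4 * k by ring] at h

end GramMoment

end MatrixNorm

/-! ### Window regularity of a hypergraph -/

section Place

variable {n : ℕ}

/-- The triple with `i` at position `c` and `j`, `k`, in this order, at the other two positions. -/
def place (c : Fin 3) (i j k : Fin n) : Fin 3 → Fin n := c.insertNth i ![j, k]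

@[simp]
lemma place_self (c : Fin 3) (i j k : Fin n) : place c i j k c = i :=
  Fin.insertNth_apply_same (α := fun _ => Fin n) c i ![j, k]

@[simp]
lemma place_succAbove_zero (c : Fin 3) (i j k : Fin n) : place c i j k (c.succAbove 0) = j :=
  Fin.insertNth_apply_succAbove (α := fun _ => Fin n) c i ![j, k] 0

@[simp]
lemma place_succAbove_one (c : Fin 3) (i j k : Fin n) : place c i j k (c.succAbove 1) = k :=
  Fin.insertNth_apply_succAbove (α := fun _ => Fin n) c i ![j, k] 1

lemma sum_eq_sum_place {M : Type*} [AddCommMonoid M] (c : Fin 3) (F : (Fin 3 → Fin n) → M) :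
    ∑ U, F U = ∑ i, ∑ j, ∑ k, F (place c i j k) :=
  calc ∑ U, F U = ∑ q : Fin n × (Fin 2 → Fin n), F (c.insertNth q.1 q.2) :=
        ((Fin.insertNthEquiv (fun _ => Fin n) c).sum_comp F).symm
    _ = ∑ i, ∑ w : Fin 2 → Fin n, F (c.insertNth i w) := Fintype.sum_prod_type _
    _ = ∑ i, ∑ j, ∑ k, F (place c i j k) := Finset.sum_congr rfl fun i _ => by
        rw [← (finTwoArrowEquiv (Fin n)).symm.sum_comp, Fintype.sum_prod_type]
        rfl

/-- The cyclic shift of `a` by `l` steps. -/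
def shift (a : Fin n) (l : ℕ) : Fin n := ⟨(a + l) % n, Nat.mod_lt _ (Fin.pos a)⟩

@[simp]
lemma shift_zero (a : Fin n) : shift a 0 = a := Fin.ext (Nat.mod_eq_of_lt a.2)

lemma shift_left_injective (l : ℕ) : Function.Injective fun a : Fin n => shift a l := by
  intro a b h
  have hmod : (a : ℕ) ≡ b [MOD n] := Nat.ModEq.add_right_cancel' l (congrArg Fin.val h)
  exact Fin.ext (hmod.eq_of_lt_of_lt a.2 b.2)

lemma sum_sum_range_shift {R : Type*} [Semiring R] (f : Fin n → R) (s : ℕ) :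
    ∑ a, ∑ l ∈ Finset.range s, f (shift a l) = s * ∑ i, f i := by
  have hshift (l : ℕ) : ∑ a, f (shift a l) = ∑ i, f i :=
    (Finite.injective_iff_bijective.mp (shift_left_injective l)).sum_comp f
  rw [Finset.sum_comm]
  simp only [hshift, Finset.sum_const, Finset.card_range, nsmul_eq_mul]

end Place

section Counts

variable {n : ℕ} (H : Hypergraph3 n) (c : Fin 3)

open Classical in
/-- The indicator of the hyperedges. -/
noncomputable def edge (U : Fin 3 → Fin n) : ℕ := if U ∈ H then 1 else 0

lemma sum_edge : ∑ U, edge H U = H.ncard := by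
  classical
  rw [Set.ncard_eq_toFinset_card']
  simp [edge]

/-- The number of hyperedges with vertex `v` at position `c`. -/
noncomputable def degree (v : Fin n) : ℕ := ∑ j, ∑ k, edge H (place c v j k)

/-- The number of hyperedges with `j` and `k`, in this order, at the positions other than `c`. -/
noncomputable def codegree (j k : Fin n) : ℕ := ∑ i, edge H (place c i j k)

/-- The number of hyperedges with `j` and `k` at the positions other than `c` and with an element of
the cyclic window `a, a + 1, …, a + s - 1` at position `c`. -/
noncomputable def windowCount (s : ℕ) (a j k : Fin n) : ℕ :=
  ∑ l ∈ Finset.range s, edge H (place c (shift a l) j k)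

lemma sum_windowCount (s : ℕ) (j k : Fin n) :
    ∑ a, windowCount H c s a j k = s * codegree H c j k :=
  sum_sum_range_shift (fun i => edge H (place c i j k)) s

lemma sum_edge_mul_apply (f : Fin n → ℝ) :
    ∑ U, (edge H U : ℝ) * f (U c) = ∑ v, (degree H c v : ℝ) * f v := by
  rw [sum_eq_sum_place c]
  simp only [place_self, degree, Nat.cast_sum, Finset.sum_mul]

lemma sum_edge_mul_apply_pair (f : Fin n → Fin n → ℝ) :
    ∑ U, (edge H U : ℝ) * f (U (c.succAbove 0)) (U (c.succAbove 1)) =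
      ∑ j, ∑ k, (codegree H c j k : ℝ) * f j k := by
  rw [sum_eq_sum_place c, Finset.sum_comm]
  refine Finset.sum_congr rfl fun j _ => ?_
  rw [Finset.sum_comm]
  simp only [place_succAbove_zero, place_succAbove_one, codegree, Nat.cast_sum, Finset.sum_mul]

/-- The deviation of the window counts from their average `s |H| / n ^ 3`, multiplied by `100 n ^ 3`
so that its entries are integers. -/
noncomputable def centeredMatrix (s : ℕ) (a : Fin n) : Matrix (Fin n) (Fin n) ℤ :=
  Matrix.of fun j k => 100 * ((n : ℤ) ^ 3 * windowCount H c s a j k - s * H.ncard)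

/-- Regularity of the position `c` at window length `s`: no vertex has a degree much below the
average, and the moment bound forces the spectral norm of every centered window matrix to be at most
a hundredth of the trivial eigenvalue `s |H| / n ^ 2`. -/
structure IsWindowRegularAt (s : ℕ) : Prop where
  degree_ge (v : Fin n) : 99 * H.ncard ≤ 100 * n * degree H c v
  moment_le (a : Fin n) :
    gramMoment (centeredMatrix H c s a) n.size ≤ ((s * H.ncard * n : ℕ) : ℤ) ^ (4 * n.size)

/-- The property of hypergraphs that the algorithm checks. -/
structure IsWindowRegular (s : ℕ) : Prop where
  window_pos : 0 < s
  ncard_pos : 0 < H.ncard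
  regularAt (c : Fin 3) : IsWindowRegularAt H c s

end Counts

section Discrepancy

variable {n : ℕ} {H : Hypergraph3 n} {s : ℕ}

lemma pos_of_ncard_pos (h : 0 < H.ncard) : 0 < n := by
  obtain ⟨U, _⟩ := Set.nonempty_of_ncard_ne_zero h.ne'
  exact Fin.pos (U 0)

lemma IsWindowRegular.pos (h : IsWindowRegular H s) : 0 < n := pos_of_ncard_pos h.ncard_pos

open scoped Matrix Matrix.Norms.L2Operator

lemma IsWindowRegular.l2_opNorm_le (h : IsWindowRegular H s) (c : Fin 3) (a : Fin n) :
    ‖(centeredMatrix H c s a).map (Int.castRingHom ℝ)‖ ≤ s * H.ncard * n := by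
  have hsize : n.size ≠ 0 := (Nat.size_pos.2 h.pos).ne'
  refine le_of_pow_le_pow_left₀ (n := 4 * n.size) (by omega) (by positivity)
    ((l2_opNorm_pow_le_gramMoment _ hsize).trans ?_)
  rw [← map_gramMoment, eq_intCast]
  exact_mod_cast (h.regularAt c).moment_le a

lemma dotProduct_centeredMatrix_mulVec (hn : 0 < n) (H : Hypergraph3 n) (c : Fin 3) (s : ℕ)
    (a : Fin n) (u v : Fin n → ℝ) :
    u ⬝ᵥ (centeredMatrix H c s a).map (Int.castRingHom ℝ) *ᵥ v =
      100 * n ^ 3 * (∑ j, ∑ k, (windowCount H c s a j k : ℝ) * (u j * v k) -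
        s * H.ncard / n ^ 3 * ((∑ j, u j) * ∑ k, v k)) := by
  have hn' : (n : ℝ) ≠ 0 := Nat.cast_ne_zero.2 hn.ne'
  rw [Finset.sum_mul_sum]
  simp only [dotProduct, Matrix.mulVec, centeredMatrix, Matrix.map_apply, Matrix.of_apply,
    Finset.mul_sum, ← Finset.sum_sub_distrib, eq_intCast]
  refine Finset.sum_congr rfl fun j _ => Finset.sum_congr rfl fun k _ => ?_
  push_cast
  field_simp

lemma IsWindowRegular.window_discrepancy (h : IsWindowRegular H s) (c : Fin 3) (a : Fin n)
    (u v : Fin n → ℝ) :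
    |∑ j, ∑ k, (windowCount H c s a j k : ℝ) * (u j * v k) -
        s * H.ncard / n ^ 3 * ((∑ j, u j) * ∑ k, v k)| ≤
      s * H.ncard / (100 * n ^ 2) * (√(∑ j, u j ^ 2) * √(∑ k, v k ^ 2)) := by
  have hn : (0 : ℝ) < n := Nat.cast_pos.2 h.pos
  have hscale : (0 : ℝ) < 100 * n ^ 3 := by positivity
  have hbilin := (abs_dotProduct_mulVec_le
    ((centeredMatrix H c s a).map (Int.castRingHom ℝ)) u v).trans
      (mul_le_mul_of_nonneg_right (h.l2_opNorm_le c a) (by positivity))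
  rw [dotProduct_centeredMatrix_mulVec h.pos, abs_mul, abs_of_pos hscale] at hbilin
  rw [← mul_le_mul_iff_right₀ hscale]
  refine hbilin.trans_eq ?_
  field_simp

lemma IsWindowRegular.codegree_discrepancy (h : IsWindowRegular H s) (c : Fin 3)
    (u v : Fin n → ℝ) :
    |∑ j, ∑ k, (codegree H c j k : ℝ) * (u j * v k) -
        H.ncard / n ^ 2 * ((∑ j, u j) * ∑ k, v k)| ≤
      H.ncard / (100 * n) * (√(∑ j, u j ^ 2) * √(∑ k, v k ^ 2)) := by
  have hn : (0 : ℝ) < n := Nat.cast_pos.2 h.pos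
  have hs : (0 : ℝ) < s := Nat.cast_pos.2 h.window_pos
  have hcount : ∑ a, ∑ j, ∑ k, (windowCount H c s a j k : ℝ) * (u j * v k) =
      s * ∑ j, ∑ k, (codegree H c j k : ℝ) * (u j * v k) := by
    rw [Finset.sum_comm, Finset.mul_sum]
    refine Finset.sum_congr rfl fun j _ => ?_
    rw [Finset.sum_comm, Finset.mul_sum]
    refine Finset.sum_congr rfl fun k _ => ?_
    rw [← Finset.sum_mul, ← Nat.cast_sum, sum_windowCount, Nat.cast_mul, mul_assoc]
  have haverage : s * (∑ j, ∑ k, (codegree H c j k : ℝ) * (u j * v k) -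
        H.ncard / n ^ 2 * ((∑ j, u j) * ∑ k, v k)) =
      ∑ a, (∑ j, ∑ k, (windowCount H c s a j k : ℝ) * (u j * v k) -
        s * H.ncard / n ^ 3 * ((∑ j, u j) * ∑ k, v k)) := by
    rw [Finset.sum_sub_distrib, hcount, Finset.sum_const, Finset.card_univ, Fintype.card_fin,
      nsmul_eq_mul]
    field_simp
  rw [← mul_le_mul_iff_right₀ hs, ← abs_of_pos hs, ← abs_mul, abs_of_pos hs, haverage]
  refine (Finset.abs_sum_le_sum_abs _ _).trans
    ((Finset.sum_le_sum fun a _ => h.window_discrepancy c a u v).trans_eq ?_)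
  rw [Finset.sum_const, Finset.card_univ, Fintype.card_fin, nsmul_eq_mul]
  field_simp

end Discrepancy

/-! ### Pairs of assignments on a window-regular hypergraph -/

section OddTriples

variable {n : ℕ}

/-- The indicator of the coordinates where `x` and `y` differ. -/
def diff (x y : Assignment n) (i : Fin n) : ℝ := if x i = y i then 0 else 1

/-- The indicator of the triples on which the products of `x` and `y` differ. -/
def oddTriple (x y : Assignment n) (U : Fin 3 → Fin n) : ℝ :=
  if ∏ i, x (U i) = ∏ i, y (U i) then 0 else 1

lemma diff_eq_zero_or_one (x y : Assignment n) (i : Fin n) : diff x y i = 0 ∨ diff x y i = 1 :=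
  (ite_eq_or_eq _ _ _)

lemma diff_nonneg (x y : Assignment n) (i : Fin n) : 0 ≤ diff x y i := by
  rcases diff_eq_zero_or_one x y i with h | h <;> simp [h]

lemma diff_le_one (x y : Assignment n) (i : Fin n) : diff x y i ≤ 1 := by
  rcases diff_eq_zero_or_one x y i with h | h <;> simp [h]

lemma diff_sq (x y : Assignment n) (i : Fin n) : diff x y i ^ 2 = diff x y i := by
  rcases diff_eq_zero_or_one x y i with h | h <;> simp [h]

lemma one_sub_diff_sq (x y : Assignment n) (i : Fin n) : (1 - diff x y i) ^ 2 = 1 - diff x y i := by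
  rcases diff_eq_zero_or_one x y i with h | h <;> simp [h]

lemma sum_diff (x y : Assignment n) : ∑ i, diff x y i = hammingDist x y := by
  simp [diff, hammingDist, Finset.sum_ite]

lemma sum_one_sub_diff (x y : Assignment n) : ∑ i, (1 - diff x y i) = n - hammingDist x y := by
  simp [sum_diff]

lemma one_sub_two_mul_ite_units_eq (a b : ℤˣ) :
    (1 - 2 * if a = b then 0 else 1 : ℝ) = ((a * b : ℤˣ) : ℤ) := by
  rcases Int.units_eq_one_or a with rfl | rfl <;> rcases Int.units_eq_one_or b with rfl | rfl <;>
    norm_num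

lemma one_sub_two_mul_oddTriple (x y : Assignment n) (U : Fin 3 → Fin n) :
    1 - 2 * oddTriple x y U = ∏ c, (1 - 2 * diff x y (U c)) := by
  simp only [oddTriple, diff, one_sub_two_mul_ite_units_eq, ← Finset.prod_mul_distrib]
  push_cast
  rfl

lemma sum_diff_sub_pairs_le_oddTriple (x y : Assignment n) (U : Fin 3 → Fin n) :
    ∑ c, diff x y (U c) -
      2 * ∑ c : Fin 3, diff x y (U (c.succAbove 0)) * diff x y (U (c.succAbove 1)) ≤
      oddTriple x y U := by
  have hodd := one_sub_two_mul_oddTriple x y U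
  rw [Fin.prod_univ_three] at hodd
  rw [Fin.sum_univ_three, Fin.sum_univ_three]
  change _ - 2 * (diff x y (U 1) * diff x y (U 2) + diff x y (U 0) * diff x y (U 2) +
    diff x y (U 0) * diff x y (U 1)) ≤ _
  have hprod := mul_nonneg (mul_nonneg (diff_nonneg x y (U 0)) (diff_nonneg x y (U 1)))
    (diff_nonneg x y (U 2))
  linarith

lemma sum_diff_sub_two_le_oddTriple (x y : Assignment n) (U : Fin 3 → Fin n) :
    ∑ c, diff x y (U c) - 2 ≤ oddTriple x y U := by
  have hodd := one_sub_two_mul_oddTriple x y U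
  rw [Fin.prod_univ_three] at hodd
  rw [Fin.sum_univ_three]
  rcases diff_eq_zero_or_one x y (U 0) with h₀ | h₀ <;>
    rcases diff_eq_zero_or_one x y (U 1) with h₁ | h₁ <;>
    rcases diff_eq_zero_or_one x y (U 2) with h₂ | h₂ <;>
    rw [h₀, h₁, h₂] at hodd ⊢ <;> linarith

lemma cut_le_oddTriple (x y : Assignment n) (U : Fin 3 → Fin n) :
    (1 - diff x y (U 0)) * (diff x y (U 1) * (1 - diff x y (U 2)) +
      (1 - diff x y (U 1)) * diff x y (U 2)) ≤ oddTriple x y U := by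
  have hodd := one_sub_two_mul_oddTriple x y U
  rw [Fin.prod_univ_three] at hodd
  rcases diff_eq_zero_or_one x y (U 0) with h₀ | h₀ <;>
    rcases diff_eq_zero_or_one x y (U 1) with h₁ | h₁ <;>
    rcases diff_eq_zero_or_one x y (U 2) with h₂ | h₂ <;>
    rw [h₀, h₁, h₂] at hodd ⊢ <;> linarith

end OddTriples

section OddCount

variable {n : ℕ} {H : Hypergraph3 n} {s : ℕ}

/-- The number of hyperedges on which the products of `x` and `y` differ. -/
noncomputable def oddCount (H : Hypergraph3 n) (x y : Assignment n) : ℝ :=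
  ∑ U, (edge H U : ℝ) * oddTriple x y U

/-- The number of hyperedges whose first vertex lies in the window of length `s` at `a` and whose
other two vertices are separated by the set of coordinates where `x` and `y` differ. -/
noncomputable def windowCut (H : Hypergraph3 n) (s : ℕ) (a : Fin n) (x y : Assignment n) : ℝ :=
  ∑ j, ∑ k, (windowCount H 0 s a j k : ℝ) *
    (diff x y j * (1 - diff x y k) + (1 - diff x y j) * diff x y k)

lemma IsWindowRegular.sum_edge_mul_diff_ge (h : IsWindowRegular H s) (x y : Assignment n)
    (c : Fin 3) :
    99 / 100 * (H.ncard / n) * hammingDist x y ≤ ∑ U, (edge H U : ℝ) * diff x y (U c) := by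
  have hn : (0 : ℝ) < n := Nat.cast_pos.2 h.pos
  rw [sum_edge_mul_apply, ← sum_diff, Finset.mul_sum]
  refine Finset.sum_le_sum fun v _ => mul_le_mul_of_nonneg_right ?_ (diff_nonneg _ _ _)
  have hdegree : (99 : ℝ) * H.ncard ≤ 100 * n * degree H c v :=
    mod_cast (h.regularAt c).degree_ge v
  rw [← mul_div_assoc, div_le_iff₀ hn]
  linarith

lemma IsWindowRegular.sum_edge_mul_diff_mul_diff_le (h : IsWindowRegular H s) (x y : Assignment n)
    (c : Fin 3) :
    ∑ U, (edge H U : ℝ) * (diff x y (U (c.succAbove 0)) * diff x y (U (c.succAbove 1))) ≤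
      H.ncard / n ^ 2 * (hammingDist x y : ℝ) ^ 2 + H.ncard / (100 * n) * hammingDist x y := by
  have hdiscrepancy := le_of_abs_le (h.codegree_discrepancy c (diff x y) (diff x y))
  simp only [diff_sq, sum_diff] at hdiscrepancy
  rw [Real.mul_self_sqrt (by positivity)] at hdiscrepancy
  rw [sum_edge_mul_apply_pair H c (fun j k => diff x y j * diff x y k)]
  linarith

lemma IsWindowRegular.oddCount_ge_of_small (h : IsWindowRegular H s) (x y : Assignment n) :
    (H.ncard : ℝ) / n * hammingDist x y * (291 / 100 - 6 * hammingDist x y / n) ≤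
      oddCount H x y := by
  have hn : (0 : ℝ) < n := Nat.cast_pos.2 h.pos
  calc (H.ncard : ℝ) / n * hammingDist x y * (291 / 100 - 6 * hammingDist x y / n)
      = ∑ _c : Fin 3, 99 / 100 * (H.ncard / n : ℝ) * hammingDist x y -
          2 * ∑ _c : Fin 3, (H.ncard / n ^ 2 * (hammingDist x y : ℝ) ^ 2 +
            H.ncard / (100 * n) * hammingDist x y) := by
        simp only [Fin.sum_univ_three]
        field_simp
        ring
    _ ≤ ∑ c, ∑ U, (edge H U : ℝ) * diff x y (U c) - 2 * ∑ c : Fin 3, ∑ U,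
          (edge H U : ℝ) * (diff x y (U (c.succAbove 0)) * diff x y (U (c.succAbove 1))) := by
        gcongr
        · exact h.sum_edge_mul_diff_ge x y _
        · exact h.sum_edge_mul_diff_mul_diff_le x y _
    _ = ∑ U, (edge H U : ℝ) * (∑ c, diff x y (U c) -
          2 * ∑ c : Fin 3, diff x y (U (c.succAbove 0)) * diff x y (U (c.succAbove 1))) := by
        rw [Finset.sum_comm, Finset.sum_comm (γ := Fin 3), Finset.mul_sum, ← Finset.sum_sub_distrib]
        simp only [← Finset.mul_sum]
        exact Finset.sum_congr rfl fun U _ => by ring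
    _ ≤ oddCount H x y := Finset.sum_le_sum fun U _ =>
        mul_le_mul_of_nonneg_left (sum_diff_sub_pairs_le_oddTriple x y U) (Nat.cast_nonneg _)

lemma IsWindowRegular.oddCount_ge_of_large (h : IsWindowRegular H s) (x y : Assignment n) :
    (H.ncard : ℝ) * (297 / 100 * hammingDist x y / n - 2) ≤ oddCount H x y := by
  have hn : (0 : ℝ) < n := Nat.cast_pos.2 h.pos
  calc (H.ncard : ℝ) * (297 / 100 * hammingDist x y / n - 2)
      = ∑ _c : Fin 3, 99 / 100 * (H.ncard / n : ℝ) * hammingDist x y - 2 * H.ncard := by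
        simp only [Fin.sum_univ_three]
        field_simp
        ring
    _ ≤ ∑ c, ∑ U, (edge H U : ℝ) * diff x y (U c) - 2 * H.ncard := by
        gcongr
        exact h.sum_edge_mul_diff_ge x y _
    _ = ∑ U, (edge H U : ℝ) * (∑ c, diff x y (U c) - 2) := by
        rw [Finset.sum_comm, ← sum_edge, Nat.cast_sum, Finset.mul_sum, ← Finset.sum_sub_distrib]
        simp only [← Finset.mul_sum]
        exact Finset.sum_congr rfl fun U _ => by ring
    _ ≤ oddCount H x y := Finset.sum_le_sum fun U _ =>
        mul_le_mul_of_nonneg_left (sum_diff_sub_two_le_oddTriple x y U) (Nat.cast_nonneg _)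

lemma sqrt_mul_sqrt_sub_le {a b : ℝ} (ha : 0 ≤ a) (hb : 0 ≤ b) : √a * √(b - a) ≤ b / 2 := by
  rw [← Real.sqrt_mul ha]
  exact Real.sqrt_le_iff.2 ⟨by positivity, by nlinarith [sq_nonneg (2 * a - b)]⟩

lemma IsWindowRegular.windowCut_ge (h : IsWindowRegular H s) (a : Fin n) (x y : Assignment n) :
    (s * H.ncard : ℝ) / n *
      (2 * (hammingDist x y / n * (1 - hammingDist x y / n)) - 1 / 100) ≤ windowCut H s a x y := by
  have hn : (0 : ℝ) < n := Nat.cast_pos.2 h.pos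
  set τ : ℝ := ((hammingDist x y : ℕ) : ℝ) with hτ
  have hcut₁ := neg_le_of_abs_le (h.window_discrepancy 0 a (diff x y) (fun i => 1 - diff x y i))
  have hcut₂ := neg_le_of_abs_le (h.window_discrepancy 0 a (fun i => 1 - diff x y i) (diff x y))
  simp only [diff_sq, sum_diff, one_sub_diff_sq, sum_one_sub_diff, ← hτ] at hcut₁ hcut₂
  rw [mul_comm (√(n - τ))] at hcut₂
  have hbound : (s * H.ncard : ℝ) / (100 * n ^ 2) * (√τ * √(n - τ)) ≤
      (s * H.ncard : ℝ) / (100 * n ^ 2) * (n / 2) := by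
    gcongr
    exact sqrt_mul_sqrt_sub_le (by positivity) hn.le
  have hmain : (s * H.ncard : ℝ) / n * (2 * (τ / n * (1 - τ / n)) - 1 / 100) =
      2 * (s * H.ncard / n ^ 3 * (τ * (n - τ))) -
        2 * ((s * H.ncard : ℝ) / (100 * n ^ 2) * (n / 2)) := by
    field_simp
  simp only [windowCut, mul_add, Finset.sum_add_distrib]
  linarith

end OddCount

/-! ### Covering the approximate solutions -/

section Violations

variable {n : ℕ} {H : Hypergraph3 n} {s t : ℕ}

open Classical in
/-- The indicator of the constraints violated by `x`. -/
noncomputable def violated (b : XORInstance H) (x : Assignment n) (U : Fin 3 → Fin n) : ℕ :=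
  if h : U ∈ H then (if ∏ i, x (U i) = b ⟨U, h⟩ then 0 else 1) else 0

/-- The number of constraints violated by `x` whose first vertex lies in the window of length `s` at
`a`. -/
noncomputable def windowViolated (b : XORInstance H) (s : ℕ) (a : Fin n) (x : Assignment n) : ℕ :=
  ∑ l ∈ Finset.range s, ∑ j, ∑ k, violated b x (place 0 (shift a l) j k)

lemma sum_violated_add_numSat (b : XORInstance H) (x : Assignment n) :
    ∑ U, violated b x U + b.numSat x = H.ncard := by
  classical
  have hsat : b.numSat x = ∑ U : H, if ∏ i, x (U.1 i) = b U then 1 else 0 := by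
    rw [XORInstance.numSat, Set.ncard_eq_toFinset_card']
    simp
  have hviolated : ∑ U, violated b x U = ∑ U : H, if ∏ i, x (U.1 i) = b U then 0 else 1 := by
    have hsupport (U : Fin 3 → Fin n) (hU : violated b x U ≠ 0) : U ∈ H := by
      by_contra hmem
      exact hU (by simp [violated, hmem])
    rw [← Finset.sum_filter_of_ne fun U _ => hsupport U,
      Finset.sum_subtype (Finset.univ.filter (· ∈ H)) (p := (· ∈ H)) (by simp)]
    exact Finset.sum_congr rfl fun U _ => by rw [violated, dif_pos U.2]
  have hone (U : H) : ((if ∏ i, x (U.1 i) = b U then 0 else 1) +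
      if ∏ i, x (U.1 i) = b U then 1 else 0) = 1 := by split_ifs <;> rfl
  rw [hsat, hviolated, ← Finset.sum_add_distrib, Finset.sum_congr rfl fun U _ => hone U,
    Finset.sum_const, Finset.card_univ, smul_eq_mul, mul_one, ← Nat.card_eq_fintype_card]
  rfl

lemma sum_violated_le {b : XORInstance H} {η : ℝ} {x : Assignment n}
    (hx : x ∈ b.approxSolutions η) : ∑ U, violated b x U ≤ ⌊η * (H.ncard : ℝ)⌋₊ := by
  refine Nat.le_floor ?_
  have htotal : ((∑ U, violated b x U : ℕ) : ℝ) + b.numSat x = H.ncard :=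
    mod_cast sum_violated_add_numSat b x
  have hsat : (1 - η) * (H.ncard : ℝ) ≤ (b.numSat x : ℝ) := hx
  linarith

lemma edge_mul_oddTriple_le (b : XORInstance H) (x y : Assignment n) (U : Fin 3 → Fin n) :
    (edge H U : ℝ) * oddTriple x y U ≤ violated b x U + violated b y U := by
  unfold edge oddTriple violated
  by_cases hU : U ∈ H
  · simp only [hU, if_true, dif_pos]
    split_ifs with hxy hx hy hy hx hy <;> norm_num
    exact hxy (hx.trans hy.symm)
  · simp [hU]

lemma oddCount_le {b : XORInstance H} {x y : Assignment n} (hx : ∑ U, violated b x U ≤ t)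
    (hy : ∑ U, violated b y U ≤ t) : oddCount H x y ≤ 2 * t :=
  calc oddCount H x y ≤ ∑ U, ((violated b x U : ℝ) + violated b y U) :=
        Finset.sum_le_sum fun U _ => edge_mul_oddTriple_le b x y U
    _ = ((∑ U, violated b x U + ∑ U, violated b y U : ℕ) : ℝ) := by
        rw [Finset.sum_add_distrib]
        push_cast
        rfl
    _ ≤ (2 * t : ℕ) := Nat.cast_le.2 (by omega)
    _ = 2 * t := by push_cast; rfl

lemma exists_windowViolated_le (hn : 0 < n) (b : XORInstance H) (s : ℕ) {x : Assignment n}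
    (hx : ∑ U, violated b x U ≤ t) : ∃ a, n * windowViolated b s a x ≤ s * t := by
  have htotal : ∑ a, windowViolated b s a x = s * ∑ U, violated b x U := by
    rw [sum_eq_sum_place 0]
    exact sum_sum_range_shift (fun i => ∑ j, ∑ k, violated b x (place 0 i j k)) s
  have hsum : ∑ a, n * windowViolated b s a x ≤ ∑ _a : Fin n, s * t := by
    rw [← Finset.mul_sum, htotal, Finset.sum_const, Finset.card_univ, Fintype.card_fin, smul_eq_mul]
    gcongr
  obtain ⟨a, _, ha⟩ := Finset.exists_le_of_sum_le ⟨⟨0, hn⟩, Finset.mem_univ _⟩ hsum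
  exact ⟨a, ha⟩

lemma edge_mul_cut_le (b : XORInstance H) (x y : Assignment n) (i j k : Fin n) :
    (edge H (place 0 i j k) : ℝ) * ((1 - diff x y i) *
      (diff x y j * (1 - diff x y k) + (1 - diff x y j) * diff x y k)) ≤
      violated b x (place 0 i j k) + violated b y (place 0 i j k) :=
  (mul_le_mul_of_nonneg_left (cut_le_oddTriple x y (place 0 i j k)) (Nat.cast_nonneg _)).trans
    (edge_mul_oddTriple_le b x y _)

lemma windowCut_eq_sum_edge (H : Hypergraph3 n) (s : ℕ) (a : Fin n) (x y : Assignment n) :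
    windowCut H s a x y = ∑ l ∈ Finset.range s, ∑ j, ∑ k, (edge H (place 0 (shift a l) j k) : ℝ) *
      (diff x y j * (1 - diff x y k) + (1 - diff x y j) * diff x y k) := by
  simp only [windowCut, windowCount, Nat.cast_sum, Finset.sum_mul]
  rw [Finset.sum_comm (s := Finset.range s)]
  exact Finset.sum_congr rfl fun j _ => Finset.sum_comm

lemma windowCut_le_of_eqOn (b : XORInstance H) (s : ℕ) (a : Fin n) {x y : Assignment n}
    (hxy : ∀ l < s, x (shift a l) = y (shift a l)) :
    windowCut H s a x y ≤ windowViolated b s a x + windowViolated b s a y := by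
  simp only [windowCut_eq_sum_edge, windowViolated, Nat.cast_sum, ← Finset.sum_add_distrib]
  refine Finset.sum_le_sum fun l hl => Finset.sum_le_sum fun j _ => Finset.sum_le_sum fun k _ => ?_
  have hdiff : diff x y (shift a l) = 0 := if_pos (hxy l (Finset.mem_range.1 hl))
  simpa only [hdiff, sub_zero, one_mul] using edge_mul_cut_le b x y (shift a l) j k

lemma sum_one_sub_diff_mul_windowCut_le {b : XORInstance H} {x y : Assignment n}
    (hx : ∑ U, violated b x U ≤ t) (hy : ∑ U, violated b y U ≤ t) :
    ∑ a, (1 - diff x y a) * windowCut H 1 a x y ≤ 2 * t := by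
  refine le_trans ?_ (oddCount_le hx hy)
  rw [oddCount, sum_eq_sum_place 0]
  simp only [windowCut_eq_sum_edge, Finset.sum_range_one, shift_zero, Finset.mul_sum]
  refine Finset.sum_le_sum fun a _ => Finset.sum_le_sum fun j _ => Finset.sum_le_sum fun k _ => ?_
  rw [mul_left_comm]
  exact mul_le_mul_of_nonneg_left (cut_le_oddTriple x y (place 0 a j k)) (Nat.cast_nonneg _)

end Violations

section Distance

variable {n : ℕ} {H : Hypergraph3 n} {s t r : ℕ}

lemma IsWindowRegular.hammingDist_div_lt_of_oddCount_le (h : IsWindowRegular H s)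
    (ht : 1000 * t ≤ H.ncard) {x y : Assignment n} (hodd : oddCount H x y ≤ 2 * t) :
    (hammingDist x y : ℝ) / n < 19 / 20 := by
  by_contra! hlarge
  have hm : (0 : ℝ) < H.ncard := Nat.cast_pos.2 h.ncard_pos
  have ht' : (1000 : ℝ) * t ≤ H.ncard := mod_cast ht
  have hcount := (h.oddCount_ge_of_large x y).trans hodd
  rw [mul_div_assoc] at hcount
  nlinarith

lemma IsWindowRegular.ncard_mul_hammingDist_le (h : IsWindowRegular H s) {x y : Assignment n}
    (hodd : oddCount H x y ≤ 2 * t) (hsmall : (hammingDist x y : ℝ) / n ≤ 1 / 20) :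
    H.ncard * hammingDist x y ≤ t * n := by
  have hn : (0 : ℝ) < n := Nat.cast_pos.2 h.pos
  have hcount := (h.oddCount_ge_of_small x y).trans hodd
  have hfactor : (2 : ℝ) ≤ 291 / 100 - 6 * hammingDist x y / n := by
    rw [mul_div_assoc]
    linarith
  have hdist : (H.ncard : ℝ) / n * hammingDist x y * 2 ≤ 2 * t :=
    (mul_le_mul_of_nonneg_left hfactor (by positivity)).trans hcount
  have hdiv : (H.ncard : ℝ) * hammingDist x y / n ≤ t := by
    rw [mul_div_right_comm]
    linarith
  exact_mod_cast (div_le_iff₀ hn).1 hdiv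

lemma IsWindowRegular.hammingDist_le (h : IsWindowRegular H s) (ht : 1000 * t ≤ H.ncard)
    (hr : t * n < (r + 1) * H.ncard) {x y : Assignment n} (hodd : oddCount H x y ≤ 2 * t)
    (hmid : (hammingDist x y : ℝ) / n ≤ 1 / 20 ∨ 19 / 20 ≤ (hammingDist x y : ℝ) / n) :
    hammingDist x y ≤ r := by
  have hsmall := hmid.resolve_right (h.hammingDist_div_lt_of_oddCount_le ht hodd).not_ge
  have hlt : H.ncard * hammingDist x y < H.ncard * (r + 1) :=
    (h.ncard_mul_hammingDist_le hodd hsmall).trans_lt (by rwa [mul_comm H.ncard])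
  exact Nat.lt_succ_iff.1 (Nat.lt_of_mul_lt_mul_left hlt)

lemma le_or_ge_of_mul_one_sub_le {α : ℝ} (h : α * (1 - α) ≤ 6 / 1000) :
    α ≤ 1 / 20 ∨ 19 / 20 ≤ α := by
  by_contra! hmid
  nlinarith [mul_pos (sub_pos.2 hmid.1) (sub_pos.2 hmid.2)]

lemma le_or_ge_of_one_sub_mul_le {α : ℝ}
    (h : (1 - α) * (2 * (α * (1 - α)) - 1 / 100) ≤ 2 / 1000) : α ≤ 1 / 20 ∨ 19 / 20 ≤ α := by
  by_contra! hmid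
  have hfactor : 0 < 2 * (α * (1 - α)) - 95 / 1000 := by
    nlinarith [mul_pos (sub_pos.2 hmid.1) (sub_pos.2 hmid.2)]
  nlinarith [mul_pos (sub_pos.2 hmid.2) hfactor]

lemma IsWindowRegular.hammingDist_le_of_eqOn_window (h : IsWindowRegular H s)
    (ht : 1000 * t ≤ H.ncard) (hr : t * n < (r + 1) * H.ncard) {b : XORInstance H}
    {x y : Assignment n} (hx : ∑ U, violated b x U ≤ t) (hy : ∑ U, violated b y U ≤ t) {a : Fin n}
    (hxa : n * windowViolated b s a x ≤ s * t) (hya : n * windowViolated b s a y ≤ s * t)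
    (hxy : ∀ l < s, x (shift a l) = y (shift a l)) : hammingDist x y ≤ r := by
  have hn : (0 : ℝ) < n := Nat.cast_pos.2 h.pos
  have hsm : (0 : ℝ) < s * H.ncard := by
    exact_mod_cast Nat.mul_pos h.window_pos h.ncard_pos
  refine h.hammingDist_le ht hr (oddCount_le hx hy) (le_or_ge_of_mul_one_sub_le ?_)
  set α : ℝ := (hammingDist x y : ℝ) / n
  have hwindow : (n : ℝ) * (windowViolated b s a x + windowViolated b s a y) ≤
      s * H.ncard * (2 / 1000) := by
    have hnat : 1000 * (n * (windowViolated b s a x + windowViolated b s a y)) ≤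
        2 * (s * H.ncard) := by
      nlinarith [Nat.mul_le_mul_left s ht]
    have hreal : (1000 : ℝ) * (n * (windowViolated b s a x + windowViolated b s a y)) ≤
        2 * (s * H.ncard) := mod_cast hnat
    linarith
  have hcut : (s * H.ncard : ℝ) * (2 * (α * (1 - α)) - 1 / 100) ≤ s * H.ncard * (2 / 1000) :=
    calc (s * H.ncard : ℝ) * (2 * (α * (1 - α)) - 1 / 100)
        = n * ((s * H.ncard : ℝ) / n * (2 * (α * (1 - α)) - 1 / 100)) := by field_simp
      _ ≤ n * (windowViolated b s a x + windowViolated b s a y) := mul_le_mul_of_nonneg_left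
          ((h.windowCut_ge a x y).trans (windowCut_le_of_eqOn b s a hxy)) hn.le
      _ ≤ _ := hwindow
  rw [mul_le_mul_iff_right₀ hsm] at hcut
  linarith

lemma IsWindowRegular.hammingDist_le_of_one (h : IsWindowRegular H 1) (ht : 1000 * t ≤ H.ncard)
    (hr : t * n < (r + 1) * H.ncard) {b : XORInstance H} {x y : Assignment n}
    (hx : ∑ U, violated b x U ≤ t) (hy : ∑ U, violated b y U ≤ t) : hammingDist x y ≤ r := by
  have hn : (0 : ℝ) < n := Nat.cast_pos.2 h.pos
  have hm : (0 : ℝ) < H.ncard := Nat.cast_pos.2 h.ncard_pos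
  have ht' : (1000 : ℝ) * t ≤ H.ncard := mod_cast ht
  refine h.hammingDist_le ht hr (oddCount_le hx hy) (le_or_ge_of_one_sub_mul_le ?_)
  set α : ℝ := (hammingDist x y : ℝ) / n with hα
  have hcut : (H.ncard : ℝ) * ((1 - α) * (2 * (α * (1 - α)) - 1 / 100)) ≤
      H.ncard * (2 / 1000) :=
    calc (H.ncard : ℝ) * ((1 - α) * (2 * (α * (1 - α)) - 1 / 100))
        = ∑ a, (1 - diff x y a) * ((H.ncard : ℝ) / n * (2 * (α * (1 - α)) - 1 / 100)) := by
          rw [← Finset.sum_mul, sum_one_sub_diff, hα]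
          field_simp
      _ ≤ ∑ a, (1 - diff x y a) * windowCut H 1 a x y := by
          refine Finset.sum_le_sum fun a _ =>
            mul_le_mul_of_nonneg_left ?_ (sub_nonneg.2 (diff_le_one _ _ _))
          simpa only [Nat.cast_one, one_mul] using h.windowCut_ge a x y
      _ ≤ 2 * t := sum_one_sub_diff_mul_windowCut_le hx hy
      _ ≤ H.ncard * (2 / 1000) := by linarith
  exact (mul_le_mul_iff_right₀ hm).1 hcut

end Distance

section Clusters

variable {n : ℕ} {H : Hypergraph3 n} {s t r : ℕ} {S : Set (Assignment n)} {d : ℝ}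

lemma coveredByClusters_of_fibers {κ : Type*} [Fintype κ] (f : S → κ)
    (h : ∀ x y : S, f x = f y → (hammingDist x.1 y.1 : ℝ) ≤ d / 2) :
    CoveredByClusters S d (Fintype.card κ) := by
  classical
  rcases S.eq_empty_or_nonempty with rfl | ⟨x₀, _⟩
  · exact ⟨∅, by simp, by simp⟩
  let center (q : κ) : Assignment n := if hq : ∃ x : S, f x = q then hq.choose.1 else x₀
  refine ⟨Finset.univ.image center, Finset.card_image_le, fun x hx => ?_⟩
  have hfiber : ∃ y : S, f y = f ⟨x, hx⟩ := ⟨⟨x, hx⟩, rfl⟩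
  refine Set.mem_biUnion (Finset.mem_coe.2 (Finset.mem_image_of_mem center
    (Finset.mem_univ (f ⟨x, hx⟩)))) ?_
  have hcenter : center (f ⟨x, hx⟩) = hfiber.choose.1 := dif_pos hfiber
  rw [hcenter]
  exact h _ ⟨x, hx⟩ hfiber.choose_spec

/-- Each solution is sent to a window on which it violates no more than its share of constraints,
together with its restriction to that window. -/
lemma IsWindowRegular.coveredByClusters (h : IsWindowRegular H s) (ht : 1000 * t ≤ H.ncard)
    (hr : t * n < (r + 1) * H.ncard) {b : XORInstance H}
    (hS : ∀ x ∈ S, ∑ U, violated b x U ≤ t) (hd : (r : ℝ) ≤ d / 2) :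
    CoveredByClusters S d (n * 2 ^ s) := by
  choose a ha using fun x : S => exists_windowViolated_le h.pos b s (hS x.1 x.2)
  have hcover := coveredByClusters_of_fibers (S := S) (d := d) (κ := Fin n × (Fin s → ℤˣ))
    (fun x => (a x, fun l => x.1 (shift (a x) l))) fun x y hxy => ?_
  · simpa using hcover
  · obtain ⟨hwindow, hvalues⟩ := Prod.mk.inj hxy
    refine le_trans (Nat.cast_le.2 ?_) hd
    refine h.hammingDist_le_of_eqOn_window ht hr (hS x.1 x.2) (hS y.1 y.2) (ha x)
      (hwindow ▸ ha y) fun l hl => ?_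
    have hvalue := congrFun hvalues ⟨l, hl⟩
    rwa [← hwindow] at hvalue

lemma IsWindowRegular.coveredByClusters_of_one (h : IsWindowRegular H 1)
    (ht : 1000 * t ≤ H.ncard) (hr : t * n < (r + 1) * H.ncard) {b : XORInstance H}
    (hS : ∀ x ∈ S, ∑ U, violated b x U ≤ t) (hd : (r : ℝ) ≤ d / 2) : CoveredByClusters S d 1 := by
  rw [← Fintype.card_unit]
  exact coveredByClusters_of_fibers (fun _ => ()) fun x y _ =>
    (Nat.cast_le.2 (h.hammingDist_le_of_one ht hr (hS x.1 x.2) (hS y.1 y.2))).trans hd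

lemma coveredByClusters_two_pow (S : Set (Assignment n)) (hd : 0 ≤ d) :
    CoveredByClusters S d (2 ^ n) := by
  have hcover := coveredByClusters_of_fibers (S := S) (d := d) Subtype.val fun x y hxy => by
    rw [hxy, hammingDist_self, Nat.cast_zero]
    positivity
  simpa using hcover

end Clusters

/-! ### Moments of a matrix of independent centered indicators -/

section CenteredIndicators

variable {ι : Type*}

lemma integral_setBernoulli_prod [Fintype ι] (p : unitInterval) (g : ι → Prop → ℝ) :
    ∫ S, ∏ i, g i (i ∈ S) ∂(setBernoulli (Set.univ : Set ι) p) =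
      ∏ i, ((p : ℝ) * g i True + (1 - p) * g i False) := by
  classical
  rw [integral_fintype Integrable.of_finite, Finset.prod_add,
    ← Fintype.finsetEquivSet.sum_comp, ← Finset.powerset_univ]
  refine Finset.sum_congr rfl fun S _ => ?_
  change (setBernoulli Set.univ p).real {(S : Set ι)} • ∏ i, g i (i ∈ (S : Set ι)) = _
  have hcompl : (Set.univ \ (S : Set ι)).ncard = (Finset.univ \ S).card := by
    rw [← Set.ncard_coe_finset]
    simp
  have hmem : ∏ i ∈ S, g i (i ∈ (S : Set ι)) = ∏ i ∈ S, g i True :=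
    Finset.prod_congr rfl fun i hi => by simp [hi]
  have hnotMem : ∏ i ∈ Finset.univ \ S, g i (i ∈ (S : Set ι)) =
      ∏ i ∈ Finset.univ \ S, g i False :=
    Finset.prod_congr rfl fun i hi => by simp [(Finset.mem_sdiff.1 hi).2]
  rw [setBernoulli_real_singleton p (Set.subset_univ _) Set.finite_univ, hcompl,
    Set.ncard_coe_finset, Finset.prod_mul_distrib, Finset.prod_mul_distrib, Finset.prod_const,
    Finset.prod_const, smul_eq_mul, ← Finset.prod_sdiff (Finset.subset_univ S), hmem, hnotMem]
  ring

open Classical in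
/-- The indicator of `i ∈ S`, centered at the probability `p`. -/
noncomputable def centeredInd (p : ℝ) (S : Set ι) (i : ι) : ℝ := (if i ∈ S then 1 else 0) - p

lemma abs_centered_moment_le {p : ℝ} (hp : 0 ≤ p) (hp1 : p ≤ 1) {r : ℕ} (hr : 2 ≤ r) :
    |p * (1 - p) ^ r + (1 - p) * (0 - p) ^ r| ≤ p := by
  have hp' : 0 ≤ 1 - p := sub_nonneg.2 hp1
  calc |p * (1 - p) ^ r + (1 - p) * (0 - p) ^ r|
      ≤ |p * (1 - p) ^ r| + |(1 - p) * (0 - p) ^ r| := abs_add_le _ _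
    _ = p * (1 - p) ^ r + (1 - p) * p ^ r := by
        rw [abs_mul, abs_mul, abs_pow, abs_pow, abs_of_nonneg hp, abs_of_nonneg hp', zero_sub,
          abs_neg, abs_of_nonneg hp]
    _ ≤ p * (1 - p) ^ 2 + (1 - p) * p ^ 2 := by
        gcongr ?_ * ?_ + ?_ * ?_
        · exact pow_le_pow_of_le_one hp' (by linarith) hr
        · exact pow_le_pow_of_le_one hp hp1 hr
    _ ≤ p := by nlinarith [mul_nonneg hp hp']

lemma integral_prod_map_centeredInd [Finite ι] [DecidableEq ι] (p : unitInterval) (L : List ι) :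
    ∫ S, (L.map (centeredInd (p : ℝ) S)).prod ∂(setBernoulli (Set.univ : Set ι) p) =
      ∏ i ∈ L.toFinset, ((p : ℝ) * (1 - p) ^ L.count i + (1 - p) * (0 - p) ^ L.count i) := by
  classical
  have := Fintype.ofFinite ι
  have hcount (i : ι) (hi : i ∉ L.toFinset) : L.count i = 0 :=
    List.count_eq_zero_of_not_mem (by simpa using hi)
  have hprod (S : Set ι) : (L.map (centeredInd (p : ℝ) S)).prod = ∏ i,
      (fun (i : ι) (P : Prop) => ((if P then 1 else 0) - (p : ℝ)) ^ L.count i) i (i ∈ S) := by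
    rw [Finset.prod_list_map_count]
    exact Finset.prod_subset (Finset.subset_univ _) fun i _ hi => by rw [hcount i hi, pow_zero]
  simp only [hprod]
  rw [integral_setBernoulli_prod p
    (fun (i : ι) (P : Prop) => ((if P then 1 else 0) - (p : ℝ)) ^ L.count i)]
  simp only [if_true, if_false]
  exact (Finset.prod_subset (Finset.subset_univ _) fun i _ hi => by simp [hcount i hi]).symm

lemma abs_integral_prod_map_centeredInd_le [Finite ι] [DecidableEq ι] (p : unitInterval)
    (L : List ι) :
    |∫ S, (L.map (centeredInd (p : ℝ) S)).prod ∂(setBernoulli (Set.univ : Set ι) p)| ≤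
      if 2 * L.toFinset.card ≤ L.length then (p : ℝ) ^ L.toFinset.card else 0 := by
  rw [integral_prod_map_centeredInd]
  by_cases hone : ∃ i ∈ L.toFinset, L.count i = 1
  · obtain ⟨i, hi, hcount⟩ := hone
    rw [Finset.prod_eq_zero hi (by rw [hcount]; ring), abs_zero]
    split_ifs
    · exact pow_nonneg p.2.1 _
    · exact le_rfl
  · have htwo (i : ι) (hi : i ∈ L.toFinset) : 2 ≤ L.count i := by
      have hpos : 0 < L.count i := List.count_pos_iff.2 (List.mem_toFinset.1 hi)
      have hne : L.count i ≠ 1 := fun h => hone ⟨i, hi, h⟩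
      omega
    have hlength : 2 * L.toFinset.card ≤ L.length := by
      rw [← List.sum_toFinset_count_eq_length L, mul_comm, ← smul_eq_mul, ← Finset.sum_const]
      exact Finset.sum_le_sum htwo
    rw [if_pos hlength, Finset.abs_prod, ← Finset.prod_const]
    exact Finset.prod_le_prod (fun _ _ => abs_nonneg _)
      fun i hi => abs_centered_moment_le p.2.1 p.2.2 (htwo i hi)

end CenteredIndicators

section Walks

variable {ι κ α : Type*} [Fintype κ] [Fintype α]

/-- The matrix whose `(v, b)` entry is the sum of the weights `w` over the labels `e l v b`. -/
def labelMatrix (e : κ → α → α → ι) (w : ι → ℝ) : Matrix α α ℝ :=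
  Matrix.of fun v b => ∑ l, w (e l v b)

/-- The label read in a step from `v` to `x.2` with choice `x.1` when `T` more steps follow; the
directions of the steps alternate. -/
def stepLabel (e : κ → α → α → ι) (T : ℕ) (v : α) (x : κ × α) : ι :=
  if Even T then e x.1 x.2 v else e x.1 v x.2

/-- The sum over the alternating walks of `T` steps from `v` to `a` of the products of the weights
of the labels read. -/
def walkSum [DecidableEq α] (e : κ → α → α → ι) (w : ι → ℝ) (a : α) : ℕ → α → ℝ
  | 0, v => if v = a then 1 else 0
  | T + 1, v => ∑ x, w (stepLabel e T v x) * walkSum e w a T x.2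

omit [Fintype κ] [Fintype α] in
lemma stepLabel_injective {e : κ → α → α → ι}
    (he : Function.Injective fun x : κ × α × α => e x.1 x.2.1 x.2.2) (T : ℕ) (v : α) :
    Function.Injective (stepLabel e T v) := by
  rintro ⟨l, b⟩ ⟨l', b'⟩ h
  simp only [stepLabel] at h
  split_ifs at h
  · have := @he (l, b, v) (l', b', v) h
    simp_all
  · have := @he (l, v, b) (l', v, b') h
    simp_all

variable [DecidableEq α]

open scoped Matrix in
lemma walkSum_two_mul (e : κ → α → α → ι) (w : ι → ℝ) (a : α) (k : ℕ) (v : α) :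
    walkSum e w a (2 * k) v = ((labelMatrix e w * (labelMatrix e w)ᵀ) ^ k) v a := by
  induction k generalizing v with
  | zero => simp [walkSum, Matrix.one_apply]
  | succ k ih =>
    have hodd (b : α) : walkSum e w a (2 * k + 1) b =
        ((labelMatrix e w)ᵀ * (labelMatrix e w * (labelMatrix e w)ᵀ) ^ k) b a := by
      rw [walkSum, Fintype.sum_prod_type_right, Matrix.mul_apply]
      refine Finset.sum_congr rfl fun c _ => ?_
      dsimp only
      rw [← Finset.sum_mul, ih]
      simp [stepLabel, labelMatrix]
    rw [mul_add_one, walkSum, Fintype.sum_prod_type_right, pow_succ', Matrix.mul_assoc,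
      Matrix.mul_apply]
    refine Finset.sum_congr rfl fun c _ => ?_
    dsimp only
    rw [← Finset.sum_mul, hodd]
    simp [stepLabel, labelMatrix]

end Walks

section WalkBound

/-- The bound for the expected weight of the walks with `T` steps to go that have read `m` distinct
labels so far, where `2 * K` is the total number of steps and there are `N` choices in each step. A
step reads one of at most `K` old labels, or a new one at the price `q`. -/
noncomputable def walkBound (c q : ℝ) (K N T m : ℕ) : ℝ :=
  if m ≤ K then c ^ K * q ^ m * (K + N * q) ^ T else 0

variable {c q : ℝ} {K N T m : ℕ}

lemma walkBound_nonneg (hc : 0 ≤ c) (hq : 0 ≤ q) : 0 ≤ walkBound c q K N T m := by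
  unfold walkBound
  split_ifs <;> positivity

lemma pow_le_walkBound_zero (hc : 1 ≤ c) (hq : 0 ≤ q) :
    (if m ≤ K then (q * c) ^ m else 0) ≤ walkBound c q K N 0 m := by
  unfold walkBound
  split_ifs with hm
  · rw [mul_pow, pow_zero, mul_one, mul_comm]
    gcongr
  · exact le_rfl

lemma walkBound_succ_right_le (hc : 0 ≤ c) (hq : 0 ≤ q) :
    walkBound c q K N T (m + 1) ≤ walkBound c q K N T m * q := by
  unfold walkBound
  split_ifs with hsucc hm hm
  · exact le_of_eq (by ring)
  · omega
  · positivity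
  · rw [zero_mul]

lemma walkBound_succ_steps : walkBound c q K N (T + 1) m = walkBound c q K N T m * (K + N * q) := by
  unfold walkBound
  split_ifs <;> ring

lemma sum_walkBound_insert_le {β ι : Type*} [Fintype β] [DecidableEq ι] (hc : 0 ≤ c) (hq : 0 ≤ q)
    {f : β → ι} (hf : Function.Injective f) (D : Finset ι) :
    ∑ x, walkBound c q K (Fintype.card β) T (insert (f x) D).card ≤
      walkBound c q K (Fintype.card β) (T + 1) D.card := by
  set W := walkBound c q K (Fintype.card β) T D.card with hW
  have hWnonneg : 0 ≤ W := walkBound_nonneg hc hq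
  have hterm (x : β) : walkBound c q K (Fintype.card β) T (insert (f x) D).card ≤
      W * ((if f x ∈ D then 1 else 0) + q) := by
    by_cases hx : f x ∈ D
    · rw [Finset.insert_eq_of_mem hx, if_pos hx, ← hW]
      nlinarith
    · rw [Finset.card_insert_of_notMem hx, if_neg hx, zero_add]
      exact walkBound_succ_right_le hc hq
  have hold : (Finset.univ.filter fun x => f x ∈ D).card ≤ D.card :=
    Finset.card_le_card_of_injOn f (fun x hx => (Finset.mem_filter.1 hx).2) hf.injOn
  refine (Finset.sum_le_sum fun x _ => hterm x).trans ?_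
  rw [walkBound_succ_steps, ← hW, ← Finset.mul_sum, Finset.sum_add_distrib, Finset.sum_boole,
    Finset.sum_const, Finset.card_univ, nsmul_eq_mul]
  rcases le_or_gt D.card K with hD | hD
  · gcongr
    exact hold.trans hD
  · rw [hW, walkBound, if_neg hD.not_ge, zero_mul, zero_mul]

end WalkBound

section GramMoment

variable {ι κ α : Type*} [Finite ι] [Fintype κ] [Fintype α] [DecidableEq α]

lemma abs_integral_walkSum_le [DecidableEq ι] (p : unitInterval) {e : κ → α → α → ι}
    (he : Function.Injective fun x : κ × α × α => e x.1 x.2.1 x.2.2) (a : α) (K : ℕ)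
    {c : ℝ} (hc : 1 ≤ c) (T : ℕ) (v : α) (L : List ι) (hT : T + L.length = 2 * K) :
    |∫ S, (L.map (centeredInd (p : ℝ) S)).prod * walkSum e (centeredInd (p : ℝ) S) a T v
        ∂(setBernoulli (Set.univ : Set ι) p)| ≤
      walkBound c (p / c) K (Fintype.card (κ × α)) T L.toFinset.card := by
  have hc0 : 0 < c := one_pos.trans_le hc
  have hq : (0 : ℝ) ≤ p / c := div_nonneg p.2.1 hc0.le
  induction T generalizing v L with
  | zero =>
    have hend : |∫ S, (L.map (centeredInd (p : ℝ) S)).prod *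
        walkSum e (centeredInd (p : ℝ) S) a 0 v ∂(setBernoulli (Set.univ : Set ι) p)| ≤
        |∫ S, (L.map (centeredInd (p : ℝ) S)).prod ∂(setBernoulli (Set.univ : Set ι) p)| := by
      by_cases hv : v = a <;> simp [walkSum, hv]
    have hlength : 2 * L.toFinset.card ≤ L.length ↔ L.toFinset.card ≤ K := by omega
    have hlist := abs_integral_prod_map_centeredInd_le p L
    have hprice := pow_le_walkBound_zero (K := K) (N := Fintype.card (κ × α))
      (m := L.toFinset.card) hc hq
    simp only [hlength] at hlist
    rw [div_mul_cancel₀ _ hc0.ne'] at hprice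
    exact hend.trans (hlist.trans hprice)
  | succ T ih =>
    have hstep (S : Set ι) : (L.map (centeredInd (p : ℝ) S)).prod *
        walkSum e (centeredInd (p : ℝ) S) a (T + 1) v =
        ∑ x, ((stepLabel e T v x :: L).map (centeredInd (p : ℝ) S)).prod *
          walkSum e (centeredInd (p : ℝ) S) a T x.2 := by
      rw [walkSum, Finset.mul_sum]
      refine Finset.sum_congr rfl fun x _ => ?_
      rw [List.map_cons, List.prod_cons]
      ring
    simp only [hstep]
    rw [integral_finsetSum _ fun _ _ => Integrable.of_finite]
    refine (Finset.abs_sum_le_sum_abs _ _).trans (le_trans (Finset.sum_le_sum fun x _ =>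
      ih x.2 (stepLabel e T v x :: L) (by rw [List.length_cons]; omega)) ?_)
    simp only [List.toFinset_cons]
    exact sum_walkBound_insert_le hc0.le hq (stepLabel_injective he T v) _

lemma integral_gramMoment_labelMatrix_le (p : unitInterval) {e : κ → α → α → ι}
    (he : Function.Injective fun x : κ × α × α => e x.1 x.2.1 x.2.2) {k : ℕ} (hk : k ≠ 0)
    {d : ℝ} (hd : d = Fintype.card κ * Fintype.card α * p) (hdk : 2 * k ≤ d) :
    ∫ S, gramMoment (labelMatrix e (centeredInd (p : ℝ) S)) k
      ∂(setBernoulli (Set.univ : Set ι) p) ≤ Fintype.card α * (8 * k * d) ^ (2 * k) := by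
  classical
  have hk0 : (0 : ℝ) < 2 * k := by positivity
  have hd0 : 0 < d := hk0.trans_le hdk
  have hbound : walkBound (d / (2 * k)) (p / (d / (2 * k))) (2 * k) (Fintype.card (κ × α))
      (2 * (2 * k)) 0 = (8 * k * d) ^ (2 * k) := by
    have hbase : ((2 * k : ℕ) : ℝ) + Fintype.card (κ × α) * (p / (d / (2 * k))) = 4 * k :=
      calc ((2 * k : ℕ) : ℝ) + Fintype.card (κ × α) * (p / (d / (2 * k)))
          = 2 * k + (Fintype.card κ * Fintype.card α * p) / d * (2 * k) := by
            rw [Fintype.card_prod]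
            push_cast
            field_simp
        _ = 4 * k := by
            rw [← hd, div_self hd0.ne']
            ring
    rw [walkBound, if_pos (Nat.zero_le _), hbase, pow_zero, mul_one, pow_mul _ 2 (2 * k), ← mul_pow]
    congr 1
    field_simp
    ring
  have hwalk (i : α) := le_of_abs_le (abs_integral_walkSum_le p he i (2 * k)
    ((one_le_div hk0).2 hdk) (2 * (2 * k)) i [] (by simp))
  simp only [List.map_nil, List.prod_nil, one_mul, List.toFinset_nil, Finset.card_empty,
    walkSum_two_mul, hbound] at hwalk
  simp only [gramMoment_eq_trace, Matrix.trace, Matrix.diag_apply]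
  rw [integral_finsetSum _ fun _ _ => Integrable.of_finite]
  refine (Finset.sum_le_sum fun i _ => hwalk i).trans_eq ?_
  rw [Finset.sum_const, Finset.card_univ, nsmul_eq_mul]

end GramMoment

/-! ### Random hypergraphs are window regular -/

section Chernoff

variable {ι : Type*} [Finite ι]

lemma integral_exp_mul_ncard_inter_le (p : unitInterval) (F : Set ι) (c : ℝ) :
    ∫ S, Real.exp (c * (F ∩ S).ncard) ∂(setBernoulli (Set.univ : Set ι) p) ≤
      Real.exp (p * F.ncard * (Real.exp c - 1)) := by
  classical
  have := Fintype.ofFinite ι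
  have hprod (S : Set ι) : Real.exp (c * (F ∩ S).ncard) =
      ∏ i, (fun (i : ι) (P : Prop) => if i ∈ F ∧ P then Real.exp c else 1) i (i ∈ S) := by
    rw [Set.ncard_eq_toFinset_card', mul_comm, Real.exp_nat_mul, Finset.prod_ite,
      Finset.prod_const, Finset.prod_const_one, mul_one]
    congr 2
    ext i
    simp
  have hexp : Real.exp (p * F.ncard * (Real.exp c - 1)) =
      ∏ i, Real.exp (if i ∈ F then p * (Real.exp c - 1) else 0) := by
    rw [← Real.exp_sum, ← Finset.sum_filter, Finset.sum_const, Set.ncard_eq_toFinset_card',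
      nsmul_eq_mul, Set.filter_mem_univ_eq_toFinset]
    ring_nf
  simp only [hprod]
  rw [integral_setBernoulli_prod p
    (fun (i : ι) (P : Prop) => if i ∈ F ∧ P then Real.exp c else 1), hexp]
  have hp := sub_nonneg.2 p.2.2
  refine Finset.prod_le_prod (fun i _ => ?_) fun i _ => ?_
  · have := p.2.1
    split_ifs <;> positivity
  · by_cases hi : i ∈ F
    · simp only [hi, and_true, and_false, if_true, if_false]
      exact le_of_eq_of_le (by ring) (Real.add_one_le_exp _)
    · simp [hi]

lemma measureReal_ncard_inter_deviation_le (p : unitInterval) (F : Set ι) {c : ℝ} (hc : |c| ≤ 1) :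
    (setBernoulli (Set.univ : Set ι) p).real
      {S | c * (p * F.ncard) + 2 * c ^ 2 * (p * F.ncard) ≤ c * (F ∩ S).ncard} ≤
      Real.exp (-(p * F.ncard * c ^ 2)) := by
  have hmarkov := (mul_meas_ge_le_integral_of_nonneg (μ := setBernoulli (Set.univ : Set ι) p)
    (f := fun S => Real.exp (c * (F ∩ S).ncard)) (ae_of_all _ fun _ => (Real.exp_pos _).le)
    Integrable.of_finite (Real.exp (c * (p * F.ncard) + 2 * c ^ 2 * (p * F.ncard)))).trans
    (integral_exp_mul_ncard_inter_le p F c)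
  simp only [Real.exp_le_exp] at hmarkov
  rw [← le_div_iff₀' (Real.exp_pos _), ← Real.exp_sub] at hmarkov
  refine hmarkov.trans (Real.exp_le_exp.2 ?_)
  have hexp : Real.exp c - 1 - c ≤ c ^ 2 := le_of_abs_le (Real.abs_exp_sub_one_sub_id_le hc)
  have hmean : (0 : ℝ) ≤ p * F.ncard := mul_nonneg p.2.1 (Nat.cast_nonneg _)
  nlinarith

end Chernoff

section EdgeCounts

variable {n : ℕ}

lemma ncard_apply_eq_inter (H : Hypergraph3 n) (c : Fin 3) (v : Fin n) :
    ({U : Fin 3 → Fin n | U c = v} ∩ H).ncard = degree H c v := by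
  classical
  have hcard : ({U : Fin 3 → Fin n | U c = v} ∩ H).ncard =
      ∑ U : Fin 3 → Fin n, if U c = v then edge H U else 0 := by
    rw [Set.ncard_eq_toFinset_card', Finset.card_eq_sum_ones, ← Finset.sum_filter]
    simp only [edge, ← Finset.sum_filter, Finset.filter_filter]
    congr 1
    ext U
    simp
  rw [hcard, sum_eq_sum_place c, Finset.sum_eq_single v]
  · simp [degree]
  · intro i _ hi
    simp [hi]
  · simp

lemma degree_univ (c : Fin 3) (v : Fin n) : degree Set.univ c v = n ^ 2 := by
  simp [degree, edge, sq]

lemma sum_degree (H : Hypergraph3 n) (c : Fin 3) : ∑ v, degree H c v = H.ncard := by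
  rw [← sum_edge, sum_eq_sum_place c]
  rfl

lemma measureReal_degree_lt_le (p : unitInterval) (c : Fin 3) (v : Fin n) :
    (setBernoulli (Set.univ : Set (Fin 3 → Fin n)) p).real
      {H | (degree H c v : ℝ) < 999 / 1000 * (p * n ^ 2)} ≤
      Real.exp (-(p * n ^ 2 / 2000 ^ 2)) := by
  have hcard : {U : Fin 3 → Fin n | U c = v}.ncard = n ^ 2 := by
    rw [← Set.inter_univ {U : Fin 3 → Fin n | U c = v}, ncard_apply_eq_inter, degree_univ]
  have hdeviation := measureReal_ncard_inter_deviation_le p {U : Fin 3 → Fin n | U c = v}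
    (c := -(1 / 2000)) (by norm_num [abs_le])
  simp only [ncard_apply_eq_inter, hcard, Nat.cast_pow] at hdeviation
  refine (measureReal_mono fun H hH => ?_).trans (hdeviation.trans_eq (by ring_nf))
  simp only [Set.mem_ofPred_eq] at hH ⊢
  linarith

lemma measureReal_ncard_gt_le (p : unitInterval) :
    (setBernoulli (Set.univ : Set (Fin 3 → Fin n)) p).real
      {H | 1001 / 1000 * ((p : ℝ) * n ^ 3) < H.ncard} ≤
      Real.exp (-(p * n ^ 3 / 2000 ^ 2)) := by
  have hdeviation := measureReal_ncard_inter_deviation_le p (Set.univ : Set (Fin 3 → Fin n))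
    (c := 1 / 2000) (by norm_num [abs_le])
  simp only [Set.univ_inter, Set.ncard_univ, Nat.card_eq_fintype_card, Fintype.card_pi,
    Fintype.card_fin, Finset.prod_const, Finset.card_univ, Nat.cast_pow] at hdeviation
  refine (measureReal_mono fun H hH => ?_).trans (hdeviation.trans_eq (by ring_nf))
  simp only [Set.mem_ofPred_eq] at hH ⊢
  linarith

end EdgeCounts

section WindowMatrices

variable {n : ℕ}

/-- The labelling of the entries of a window matrix by triples: the `(j, k)` entry collects the
triples whose element at position `c` is in the window of length `s` that starts at `a`. -/
def windowLabel (c : Fin 3) (s : ℕ) (a : Fin n) (l : Fin s) (j k : Fin n) : Fin 3 → Fin n :=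
  place c (shift a l) j k

lemma windowLabel_injective {s : ℕ} (hs : s ≤ n) (c : Fin 3) (a : Fin n) :
    Function.Injective fun x : Fin s × Fin n × Fin n => windowLabel c s a x.1 x.2.1 x.2.2 := by
  rintro ⟨l, j, k⟩ ⟨l', j', k'⟩ h
  have hshift : shift a l = shift a l' := by simpa [windowLabel] using congrFun h c
  have hj : j = j' := by simpa [windowLabel] using congrFun h (c.succAbove 0)
  have hk : k = k' := by simpa [windowLabel] using congrFun h (c.succAbove 1)
  have hmod : (l : ℕ) ≡ l' [MOD n] :=
    Nat.ModEq.add_left_cancel' (a : ℕ) (congrArg Fin.val hshift)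
  have hl : l = l' := Fin.ext (hmod.eq_of_lt_of_lt (l.2.trans_le hs) (l'.2.trans_le hs))
  rw [hl, hj, hk]

lemma labelMatrix_windowLabel (H : Hypergraph3 n) (c : Fin 3) (s : ℕ) (a : Fin n) (p : ℝ)
    (j k : Fin n) : labelMatrix (windowLabel c s a) (centeredInd p H) j k =
      windowCount H c s a j k - s * p := by
  simp only [labelMatrix, windowLabel, centeredInd, Matrix.of_apply, windowCount,
    Finset.sum_sub_distrib, Finset.sum_const, Finset.card_univ, Fintype.card_fin, nsmul_eq_mul]
  rw [← Fin.sum_univ_eq_sum_range (fun l => edge H (place c (shift a l) j k))]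
  push_cast [edge]
  rfl

lemma map_centeredMatrix_eq (H : Hypergraph3 n) (c : Fin 3) (s : ℕ) (a : Fin n) (p : ℝ) :
    (centeredMatrix H c s a).map (Int.castRingHom ℝ) =
      (100 * (n : ℝ) ^ 3) • labelMatrix (windowLabel c s a) (centeredInd p H) +
        Matrix.of fun _ _ => 100 * s * (p * n ^ 3 - H.ncard) := by
  ext j k
  simp only [centeredMatrix, eq_intCast, Matrix.map_apply, Matrix.of_apply, Matrix.add_apply,
    Matrix.smul_apply, smul_eq_mul, labelMatrix_windowLabel]
  push_cast
  ring

open scoped Matrix.Norms.L2Operator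

lemma l2_opNorm_map_centeredMatrix_le {H : Hypergraph3 n} {c : Fin 3} {s : ℕ} {a : Fin n} {p : ℝ}
    (hlabel : ‖labelMatrix (windowLabel c s a) (centeredInd p H)‖ ≤ s * n * p / 300)
    (hncard : |p * n ^ 3 - H.ncard| ≤ p * n ^ 3 / 1000) :
    ‖(centeredMatrix H c s a).map (Int.castRingHom ℝ)‖ ≤ 13 / 30 * (s * n * (p * n ^ 3)) := by
  have hconst := l2_opNorm_const_le (n := Fin n) (100 * s * (p * n ^ 3 - H.ncard))
  rw [Fintype.card_fin, abs_mul, abs_of_nonneg (by positivity : (0 : ℝ) ≤ 100 * s)] at hconst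
  rw [map_centeredMatrix_eq H c s a p]
  calc _ ≤ ‖(100 * (n : ℝ) ^ 3) • labelMatrix (windowLabel c s a) (centeredInd p H)‖ +
        n * (100 * s * |p * n ^ 3 - H.ncard|) := (norm_add_le _ _).trans (by gcongr)
    _ = 100 * (n : ℝ) ^ 3 * ‖labelMatrix (windowLabel c s a) (centeredInd p H)‖ +
        n * (100 * s * |p * n ^ 3 - H.ncard|) := by
        rw [norm_smul, Real.norm_of_nonneg (by positivity)]
    _ ≤ 100 * (n : ℝ) ^ 3 * (s * n * p / 300) + n * (100 * s * (p * n ^ 3 / 1000)) := by gcongr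
    _ = 13 / 30 * (s * n * (p * n ^ 3)) := by ring

lemma isWindowRegular_of_bounds {H : Hypergraph3 n} {s : ℕ} {p : ℝ} (hn : 0 < n) (hs : 0 < s)
    (hp : 0 < p) (hdegree : ∀ c v, 999 / 1000 * (p * n ^ 2) ≤ degree H c v)
    (hncard : (H.ncard : ℝ) ≤ 1001 / 1000 * (p * n ^ 3))
    (hlabel : ∀ c a, ‖labelMatrix (windowLabel c s a) (centeredInd p H)‖ ≤ s * n * p / 300) :
    IsWindowRegular H s := by
  have hmean : 0 < p * n ^ 3 := by positivity
  have hncard_ge : 999 / 1000 * (p * n ^ 3) ≤ (H.ncard : ℝ) :=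
    calc 999 / 1000 * (p * n ^ 3) = ∑ _v : Fin n, 999 / 1000 * (p * (n : ℝ) ^ 2) := by
          rw [Finset.sum_const, Finset.card_univ, Fintype.card_fin, nsmul_eq_mul]
          ring
      _ ≤ ∑ v, (degree H 0 v : ℝ) := Finset.sum_le_sum fun v _ => hdegree 0 v
      _ = H.ncard := by exact_mod_cast sum_degree H 0
  have hncard_dev : |p * n ^ 3 - H.ncard| ≤ p * n ^ 3 / 1000 :=
    abs_le.2 ⟨by linarith, by linarith⟩
  have hncard_pos : (0 : ℝ) < H.ncard := by linarith
  refine ⟨hs, by exact_mod_cast hncard_pos, fun c => ⟨fun v => ?_, fun a => ?_⟩⟩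
  · have hscaled : 100 * (n : ℝ) * (999 / 1000 * (p * n ^ 2)) ≤ 100 * n * degree H c v := by
      gcongr
      exact hdegree c v
    have : (99 : ℝ) * H.ncard ≤ 100 * n * degree H c v := by nlinarith
    exact_mod_cast this
  · set B := (centeredMatrix H c s a).map (Int.castRingHom ℝ) with hB
    have hnorm : 2 * ‖B‖ ≤ s * H.ncard * n := by
      have hle := l2_opNorm_map_centeredMatrix_le (hlabel c a) hncard_dev
      have hmono : (s : ℝ) * n * (999 / 1000 * (p * n ^ 3)) ≤ s * n * H.ncard := by gcongr
      have hpos : (0 : ℝ) < s * n * (p * n ^ 3) := by positivity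
      linarith
    have hn_le : (n : ℝ) ≤ 2 ^ (4 * n.size) :=
      calc (n : ℝ) ≤ 2 ^ n.size := by exact_mod_cast (Nat.lt_size_self n).le
        _ ≤ 2 ^ (4 * n.size) := pow_le_pow_right₀ one_le_two (by omega)
    have hmoment : gramMoment B n.size ≤ (s * H.ncard * n : ℝ) ^ (4 * n.size) :=
      calc gramMoment B n.size ≤ n * ‖B‖ ^ (4 * n.size) := by
            simpa using gramMoment_le_card_mul_l2_opNorm_pow B (Nat.size_pos.2 hn).ne'
        _ ≤ 2 ^ (4 * n.size) * ‖B‖ ^ (4 * n.size) := by gcongr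
        _ = (2 * ‖B‖) ^ (4 * n.size) := (mul_pow _ _ _).symm
        _ ≤ (s * H.ncard * n : ℝ) ^ (4 * n.size) := by gcongr
    rw [hB, ← map_gramMoment, eq_intCast] at hmoment
    exact_mod_cast hmoment

end WindowMatrices

section RandomHypergraph

variable {n : ℕ} {p : unitInterval} {s : ℕ} {d : ℝ}

open scoped Matrix.Norms.L2Operator

lemma measureReal_l2_opNorm_labelMatrix_gt_le (hn : 0 < n) (hsn : s ≤ n) (hd : d = s * n * p)
    (hdk : 2 * n.size ≤ d) (c : Fin 3) (a : Fin n) :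
    (setBernoulli (Set.univ : Set (Fin 3 → Fin n)) p).real
      {H | d / 300 < ‖labelMatrix (windowLabel c s a) (centeredInd (p : ℝ) H)‖} ≤
      n * (720000 * n.size / d) ^ (2 * n.size) := by
  have hsize : 0 < n.size := Nat.size_pos.2 hn
  have hd0 : 0 < d := lt_of_lt_of_le (by positivity) hdk
  have hmoment := integral_gramMoment_labelMatrix_le p (windowLabel_injective hsn c a)
    hsize.ne' (by simpa only [Fintype.card_fin] using hd) hdk
  have hnonneg (H : Set (Fin 3 → Fin n)) :
      0 ≤ gramMoment (labelMatrix (windowLabel c s a) (centeredInd (p : ℝ) H)) n.size :=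
    (by positivity : (0 : ℝ) ≤ _).trans (l2_opNorm_pow_le_gramMoment _ hsize.ne')
  have hmarkov := (mul_meas_ge_le_integral_of_nonneg (ae_of_all _ hnonneg) Integrable.of_finite
    ((d / 300) ^ (4 * n.size))).trans hmoment
  rw [← le_div_iff₀' (by positivity)] at hmarkov
  refine (measureReal_mono fun H hH => ?_).trans (hmarkov.trans_eq ?_)
  · exact (pow_le_pow_left₀ (by positivity) (le_of_lt hH) _).trans
      (l2_opNorm_pow_le_gramMoment _ hsize.ne')
  · rw [Fintype.card_fin, mul_div_assoc, show 4 * n.size = 2 * (2 * n.size) by ring,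
      pow_mul (d / 300) 2 (2 * n.size), ← div_pow]
    congr 2
    field_simp
    norm_num

lemma measureReal_iUnion_iUnion_le {Ω : Type*} [MeasurableSpace Ω] (μ : Measure Ω)
    [IsFiniteMeasure μ] {A : Fin 3 → Fin n → Set Ω} {x : ℝ} (hA : ∀ c v, μ.real (A c v) ≤ x) :
    μ.real (⋃ c, ⋃ v, A c v) ≤ 3 * n * x :=
  calc μ.real (⋃ c, ⋃ v, A c v) ≤ ∑ c, μ.real (⋃ v, A c v) := measureReal_iUnion_fintype_le _
    _ ≤ ∑ _c : Fin 3, ∑ _v : Fin n, x := Finset.sum_le_sum fun c _ =>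
        (measureReal_iUnion_fintype_le _).trans (Finset.sum_le_sum fun v _ => hA c v)
    _ = 3 * n * x := by simp [mul_assoc]

lemma measureReal_not_isWindowRegular_le (hn : 0 < n) (hs : 0 < s) (hsn : s ≤ n)
    (hd : d = s * n * p) (hdk : 2 * n.size ≤ d) :
    (setBernoulli (Set.univ : Set (Fin 3 → Fin n)) p).real {H | ¬ IsWindowRegular H s} ≤
      (3 * n + 1) * Real.exp (-(p * n ^ 2 / 2000 ^ 2)) +
        3 * n * (n * (720000 * n.size / d) ^ (2 * n.size)) := by
  have hd0 : 0 < d := lt_of_lt_of_le (by have := Nat.size_pos.2 hn; positivity) hdk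
  have hp : (0 : ℝ) < p := p.2.1.lt_of_ne fun h => by simp [hd, ← h] at hd0
  set μ := setBernoulli (Set.univ : Set (Fin 3 → Fin n)) p
  set lowDegree : Fin 3 → Fin n → Set (Hypergraph3 n) := fun c v =>
    {H | (degree H c v : ℝ) < 999 / 1000 * (p * n ^ 2)}
  set manyEdges : Set (Hypergraph3 n) := {H | 1001 / 1000 * ((p : ℝ) * n ^ 3) < H.ncard}
  set largeNorm : Fin 3 → Fin n → Set (Hypergraph3 n) := fun c a =>
    {H | d / 300 < ‖labelMatrix (windowLabel c s a) (centeredInd (p : ℝ) H)‖}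
  have hsubset : {H : Hypergraph3 n | ¬ IsWindowRegular H s} ⊆
      ((⋃ c, ⋃ v, lowDegree c v) ∪ manyEdges) ∪ ⋃ c, ⋃ a, largeNorm c a := by
    intro H hH
    by_contra hcon
    simp only [Set.mem_union, Set.mem_iUnion, not_or, not_exists] at hcon
    obtain ⟨⟨hdegree, hncard⟩, hnorm⟩ := hcon
    exact hH (isWindowRegular_of_bounds hn hs hp (fun c v => not_lt.1 (hdegree c v))
      (not_lt.1 hncard) fun c a => hd ▸ not_lt.1 (hnorm c a))
  have hmany : μ.real manyEdges ≤ Real.exp (-(p * n ^ 2 / 2000 ^ 2)) := by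
    refine (measureReal_ncard_gt_le p).trans (Real.exp_le_exp.2 ?_)
    gcongr
    · exact_mod_cast hn
    · norm_num
  calc μ.real {H | ¬ IsWindowRegular H s}
      ≤ μ.real (((⋃ c, ⋃ v, lowDegree c v) ∪ manyEdges) ∪ ⋃ c, ⋃ a, largeNorm c a) :=
        measureReal_mono hsubset
    _ ≤ (μ.real (⋃ c, ⋃ v, lowDegree c v) + μ.real manyEdges) +
        μ.real (⋃ c, ⋃ a, largeNorm c a) :=
        (measureReal_union_le _ _).trans (by gcongr; exact measureReal_union_le _ _)
    _ ≤ (3 * n * Real.exp (-(p * n ^ 2 / 2000 ^ 2)) + Real.exp (-(p * n ^ 2 / 2000 ^ 2))) +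
        3 * n * (n * (720000 * n.size / d) ^ (2 * n.size)) := by
        gcongr
        · exact measureReal_iUnion_iUnion_le μ fun c v => measureReal_degree_lt_le p c v
        · exact measureReal_iUnion_iUnion_le μ fun c a =>
            measureReal_l2_opNorm_labelMatrix_gt_le hn hsn hd hdk c a
    _ = _ := by ring

end RandomHypergraph

/-! ### The certifiers and their output on random hypergraphs -/

section Certifiers

variable {n : ℕ}

open Classical in
/-- The certifier that examines windows of length `s = σ n r` and outputs `N n s` if the hypergraph
is window regular and the number `t` of violated constraints is small, and the trivial bound
otherwise. -/
noncomputable def windowCertifier (σ N : ℕ → ℕ → ℕ) : Certifier := fun n H t r =>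
  if IsWindowRegular H (σ n r) ∧ 1000 * t ≤ H.ncard ∧ t * n < (r + 1) * H.ncard then N n (σ n r)
  else 2 ^ n

lemma windowCertifier_eq_of_isWindowRegular {σ N : ℕ → ℕ → ℕ} {H : Hypergraph3 n} {η θ : ℝ}
    (hη0 : 0 ≤ η) (hη : η ≤ 1 / 1000) (hηθ : 2 * η ≤ θ)
    (hH : IsWindowRegular H (σ n ⌊θ * n / 2⌋₊)) :
    windowCertifier σ N n H ⌊η * (H.ncard : ℝ)⌋₊ ⌊θ * n / 2⌋₊ = N n (σ n ⌊θ * n / 2⌋₊) := by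
  have hncard : (0 : ℝ) < H.ncard := by exact_mod_cast hH.ncard_pos
  have hfloor : (⌊η * (H.ncard : ℝ)⌋₊ : ℝ) ≤ η * H.ncard := Nat.floor_le (by positivity)
  have hfew : (1000 : ℝ) * ⌊η * (H.ncard : ℝ)⌋₊ ≤ H.ncard := by nlinarith
  have hradius : (⌊η * (H.ncard : ℝ)⌋₊ : ℝ) * n < (⌊θ * n / 2⌋₊ + 1) * H.ncard :=
    calc (⌊η * (H.ncard : ℝ)⌋₊ : ℝ) * n ≤ (η * H.ncard) * n := by gcongr
      _ = (2 * η * n / 2) * H.ncard := by ring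
      _ ≤ (θ * n / 2) * H.ncard := by gcongr
      _ < (⌊θ * n / 2⌋₊ + 1) * H.ncard := by
        gcongr
        exact Nat.lt_floor_add_one _
  exact if_pos ⟨hH, by exact_mod_cast hfew, by exact_mod_cast hradius⟩

lemma isSound_windowCertifier_sparse (σ : ℕ → ℕ → ℕ) :
    (windowCertifier σ fun n s => n * 2 ^ s).IsSound := by
  intro n H η d _ hd b
  unfold windowCertifier
  split_ifs with h
  · exact h.1.coveredByClusters h.2.1 h.2.2 (fun x hx => sum_violated_le hx)
      (Nat.floor_le (by positivity))
  · exact coveredByClusters_two_pow _ hd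

lemma isSound_windowCertifier_dense : (windowCertifier (fun _ _ => 1) fun _ _ => 1).IsSound := by
  intro n H η d _ hd b
  unfold windowCertifier
  split_ifs with h
  · exact h.1.coveredByClusters_of_one h.2.1 h.2.2 (fun x hx => sum_violated_le hx)
      (Nat.floor_le (by positivity))
  · exact coveredByClusters_two_pow _ hd

lemma one_sub_le_measureReal_windowCertifier {σ N : ℕ → ℕ → ℕ} {m η θ ε x : ℝ} (hη0 : 0 ≤ η)
    (hη : η ≤ 1 / 1000) (hηθ : 2 * η ≤ θ)
    (hregular :
      (randomHypergraph3 n m).real {H | ¬ IsWindowRegular H (σ n ⌊θ * n / 2⌋₊)} ≤ ε)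
    (hN : (N n (σ n ⌊θ * n / 2⌋₊) : ℝ) ≤ x) :
    1 - ε ≤ (randomHypergraph3 n m).real
      {H | (windowCertifier σ N n H ⌊η * (H.ncard : ℝ)⌋₊ ⌊θ * n / 2⌋₊ : ℝ) ≤ x} := by
  have : IsProbabilityMeasure (randomHypergraph3 n m) := by
    unfold randomHypergraph3
    infer_instance
  have hsubset : {H : Hypergraph3 n | ¬ IsWindowRegular H (σ n ⌊θ * n / 2⌋₊)}ᶜ ⊆
      {H | (windowCertifier σ N n H ⌊η * (H.ncard : ℝ)⌋₊ ⌊θ * n / 2⌋₊ : ℝ) ≤ x} := by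
    intro H hH
    have hH : IsWindowRegular H (σ n ⌊θ * n / 2⌋₊) := not_not.1 hH
    simpa only [Set.mem_ofPred_eq,
      windowCertifier_eq_of_isWindowRegular hη0 hη hηθ hH] using hN
  refine le_trans ?_ (measureReal_mono hsubset)
  rw [probReal_compl_eq_one_sub (Set.toFinite _).measurableSet]
  linarith

end Certifiers

section Logarithms

open Filter

lemma eventually_le_log_natCast (c : ℝ) : ∀ᶠ n : ℕ in atTop, c ≤ Real.log n :=
  (Real.tendsto_log_atTop.comp tendsto_natCast_atTop_atTop).eventually_ge_atTop c

lemma eventually_mul_log_pow_le_rpow {δ : ℝ} (hδ : 0 < δ) (c : ℝ) (k : ℕ) :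
    ∀ᶠ n : ℕ in atTop, c * Real.log n ^ k ≤ (n : ℝ) ^ δ := by
  have hlittle : (fun x : ℝ => Real.log x ^ k) =o[atTop] fun x => x ^ δ := by
    simpa only [Real.rpow_natCast] using isLittleO_log_rpow_rpow_atTop (k : ℝ) hδ
  have hbound := ((hlittle.const_mul_left c).comp_tendsto tendsto_natCast_atTop_atTop).bound
    one_pos
  filter_upwards [hbound] with n hn
  rw [one_mul] at hn
  exact (le_abs_self _).trans (hn.trans_eq (Real.norm_of_nonneg (Real.rpow_nonneg n.cast_nonneg δ)))

lemma log_natCast_le_size (n : ℕ) : Real.log n ≤ n.size := by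
  rcases n.eq_zero_or_pos with rfl | hn
  · simp
  calc Real.log n ≤ Real.log (2 ^ n.size) :=
        Real.log_le_log (by exact_mod_cast hn) (by exact_mod_cast (Nat.lt_size_self n).le)
    _ = n.size * Real.log 2 := Real.log_pow _ _
    _ ≤ n.size := mul_le_of_le_one_right (Nat.cast_nonneg _) (by linarith [Real.log_two_lt_d9])

lemma size_le_two_mul_log_add_one (n : ℕ) : (n.size : ℝ) ≤ 2 * Real.log n + 1 := by
  rcases n.eq_zero_or_pos with rfl | hn
  · simp
  obtain ⟨k, hk⟩ := Nat.exists_eq_add_one_of_ne_zero (Nat.size_pos.2 hn).ne'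
  have hpow : 2 ^ k ≤ n := Nat.lt_size.1 (by omega)
  have hlog : k * Real.log 2 ≤ Real.log n := by
    rw [← Real.log_pow]
    exact Real.log_le_log (by positivity) (by exact_mod_cast hpow)
  rw [hk]
  push_cast
  nlinarith [Real.log_two_gt_d9, (Nat.cast_nonneg k : (0 : ℝ) ≤ k)]

lemma exp_neg_mul_log {n : ℕ} (hn : 0 < n) (j : ℕ) :
    Real.exp (-(j * Real.log n)) = 1 / (n : ℝ) ^ j := by
  rw [Real.exp_neg, Real.exp_nat_mul, Real.exp_log (by exact_mod_cast hn), one_div]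

lemma eventually_exp_neg_rpow_div_le {δ c : ℝ} (hδ : 0 < δ) (hc : 0 < c) (j : ℕ) :
    ∀ᶠ n : ℕ in atTop, Real.exp (-((n : ℝ) ^ δ / c)) ≤ 1 / (n : ℝ) ^ j := by
  filter_upwards [eventually_mul_log_pow_le_rpow hδ (c * j) 1, eventually_gt_atTop 0]
    with n hpow hn
  rw [← exp_neg_mul_log hn, Real.exp_le_exp, neg_le_neg_iff, le_div_iff₀ hc]
  linarith

lemma eventually_size_le_mul (c : ℝ) {ε : ℝ} (hε : 0 < ε) : ∀ᶠ n : ℕ in atTop, ∀ d : ℝ,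
    Real.log n ^ 2 / 4 ≤ d → c * n.size ≤ ε * d := by
  filter_upwards [eventually_le_log_natCast 1, eventually_le_log_natCast (12 * |c| / ε)]
    with n hone hlog d hd
  rw [div_le_iff₀ hε] at hlog
  calc c * n.size ≤ |c| * (2 * Real.log n + 1) := by
        gcongr
        · exact le_abs_self c
        · exact size_le_two_mul_log_add_one n
    _ ≤ |c| * (3 * Real.log n) := by gcongr; linarith
    _ ≤ Real.log n * ε / 4 * Real.log n := by nlinarith
    _ = ε * (Real.log n ^ 2 / 4) := by ring
    _ ≤ ε * d := by gcongr

lemma eventually_size_div_pow_le {c : ℝ} (hc : 0 ≤ c) (j : ℕ) : ∀ᶠ n : ℕ in atTop, ∀ d : ℝ,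
    0 < d → Real.log n ^ 2 / 4 ≤ d → (c * n.size / d) ^ (2 * n.size) ≤ 1 / (n : ℝ) ^ j := by
  filter_upwards [eventually_size_le_mul c (Real.exp_pos (-j)), eventually_gt_atTop 0]
    with n hsize hn d hd0 hd
  have hbase : c * n.size / d ≤ Real.exp (-j) := (div_le_iff₀ hd0).2 (hsize d hd)
  refine (pow_le_pow_left₀ (by positivity) hbase _).trans ?_
  rw [← Real.exp_nat_mul, ← exp_neg_mul_log hn, Real.exp_le_exp]
  have hlog : (j : ℝ) * Real.log n ≤ j * n.size := by
    gcongr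
    exact log_natCast_le_size n
  have hnonneg : (0 : ℝ) ≤ j * n.size := by positivity
  push_cast
  linarith

end Logarithms

section Asymptotics

open Filter

lemma coe_projIcc_edge_probability {n : ℕ} (hn : 0 < n) {δ : ℝ} (hδ2 : δ < 2) :
    ((Set.projIcc (0 : ℝ) 1 zero_le_one ((n : ℝ) ^ δ * n / (n : ℝ) ^ 3) : unitInterval) : ℝ) =
      (n : ℝ) ^ δ / n ^ 2 := by
  have hcancel : (n : ℝ) ^ δ * n / (n : ℝ) ^ 3 = (n : ℝ) ^ δ / n ^ 2 := by field_simp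
  rw [hcancel, Set.projIcc_of_mem _ ⟨by positivity, ?_⟩]
  rw [div_le_one (by positivity), ← Real.rpow_natCast]
  exact Real.rpow_le_rpow_of_exponent_le (by exact_mod_cast hn) (by push_cast; linarith)

lemma eventually_measureReal_not_isWindowRegular_le {δ : ℝ} (hδ : 0 < δ) (hδ2 : δ < 2) (K : ℕ) :
    ∀ᶠ n : ℕ in atTop, ∀ s : ℕ, 0 < s → s ≤ n → Real.log n ^ 2 / 4 ≤ s * (n : ℝ) ^ δ / n →
      (randomHypergraph3 n ((n : ℝ) ^ δ * n)).real {H | ¬ IsWindowRegular H s} ≤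
        1 / (n : ℝ) ^ K := by
  filter_upwards [eventually_exp_neg_rpow_div_le hδ (by norm_num : (0 : ℝ) < 2000 ^ 2) (K + 3),
    eventually_size_div_pow_le (by norm_num : (0 : ℝ) ≤ 720000) (K + 5),
    eventually_size_le_mul 2 one_pos, eventually_ge_atTop 4] with n hexp hpow hsize hn s hs hsn hd
  have hn0 : 0 < n := by omega
  have hn4 : (4 : ℝ) ≤ n := by exact_mod_cast hn
  set d : ℝ := s * (n : ℝ) ^ δ / n with hddef
  have hp := coe_projIcc_edge_probability hn0 hδ2
  have hbound := measureReal_not_isWindowRegular_le (d := d) hn0 hs hsn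
    (by rw [hp, hddef]; field_simp) (by simpa using hsize d hd)
  rw [hp, div_mul_cancel₀ _ (by positivity)] at hbound
  calc (randomHypergraph3 n ((n : ℝ) ^ δ * n)).real {H | ¬ IsWindowRegular H s}
      ≤ (3 * n + 1) * Real.exp (-((n : ℝ) ^ δ / 2000 ^ 2)) +
        3 * n * (n * (720000 * n.size / d) ^ (2 * n.size)) := hbound
    _ ≤ (3 * n + 1) * (1 / (n : ℝ) ^ (K + 3)) + 3 * n * (n * (1 / (n : ℝ) ^ (K + 5))) := by
        gcongr
        exact hpow d (by positivity) hd
    _ = (3 * n + 4) / (n : ℝ) ^ 3 * (1 / (n : ℝ) ^ K) := by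
        field_simp
        ring
    _ ≤ 1 / (n : ℝ) ^ K := by
        refine mul_le_of_le_one_left (by positivity) ((div_le_one (by positivity)).2 ?_)
        nlinarith [mul_le_mul hn4 hn4 (by norm_num) (by positivity)]

lemma eventually_clusterScale_le_half {δ : ℝ} (hδ : 0 < δ) : ∀ᶠ n : ℕ in atTop, ∀ η : ℝ,
    η ≤ 1 / 1000 → clusterScale n ((n : ℝ) ^ δ) η ≤ 1 / 2 := by
  filter_upwards [eventually_mul_log_pow_le_rpow (half_pos hδ) 2 1,
    eventually_gt_atTop 0] with n hlog hn η hη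
  refine max_le (by linarith) ?_
  rw [← Real.rpow_mul (Nat.cast_nonneg n), show δ * -(1 / 2) = -(δ / 2) by ring,
    Real.rpow_neg (Nat.cast_nonneg n), inv_mul_le_iff₀ (by positivity)]
  rw [pow_one] at hlog
  linarith

lemma clusterScale_pos {n : ℕ} (hn : 1 < n) (δ η : ℝ) : 0 < clusterScale n ((n : ℝ) ^ δ) η := by
  have : 0 < Real.log n := Real.log_pos (by exact_mod_cast hn)
  exact lt_of_lt_of_le (by positivity) (le_max_right _ _)

lemma log_sq_le_clusterScale_sq_mul {n : ℕ} (hn : 0 < n) (δ η : ℝ) :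
    Real.log n ^ 2 ≤ clusterScale n ((n : ℝ) ^ δ) η ^ 2 * (n : ℝ) ^ δ := by
  have hpos : (0 : ℝ) < (n : ℝ) ^ δ := by positivity
  have : 0 ≤ Real.log n := Real.log_natCast_nonneg n
  have hcancel : (((n : ℝ) ^ δ) ^ (-(1 / 2) : ℝ)) ^ 2 * (n : ℝ) ^ δ = 1 := by
    rw [← Real.rpow_mul_natCast hpos.le, ← Real.rpow_add_one hpos.ne']
    norm_num
  calc Real.log n ^ 2 = (((n : ℝ) ^ δ) ^ (-(1 / 2) : ℝ) * Real.log n) ^ 2 * (n : ℝ) ^ δ := by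
        rw [mul_pow, mul_right_comm, hcancel, one_mul]
    _ ≤ clusterScale n ((n : ℝ) ^ δ) η ^ 2 * (n : ℝ) ^ δ := by
        gcongr
        exact le_max_right _ _

end Asymptotics

section Dense

open Filter

lemma eventually_dense_bound {δ : ℝ} (hδ : 1 < δ) (hδ2 : δ < 2) (K : ℕ) :
    ∀ᶠ n : ℕ in atTop, ∀ η : ℝ, 0 ≤ η → η ≤ 1 / 1000 →
      1 - 1 / (n : ℝ) ^ K ≤ (randomHypergraph3 n ((n : ℝ) ^ δ * n)).real
        {H | (windowCertifier (fun _ _ => 1) (fun _ _ => 1) n H ⌊η * (H.ncard : ℝ)⌋₊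
          ⌊clusterScale n ((n : ℝ) ^ δ) η * n / 2⌋₊ : ℝ) ≤
          Real.exp (5 * (clusterScale n ((n : ℝ) ^ δ) η ^ 2 *
            Real.log (1 / clusterScale n ((n : ℝ) ^ δ) η)) * n)} := by
  have hδ0 : 0 < δ := by linarith
  filter_upwards [eventually_measureReal_not_isWindowRegular_le hδ0 hδ2 K,
    eventually_clusterScale_le_half hδ0, eventually_gt_atTop 1,
    eventually_mul_log_pow_le_rpow (sub_pos.2 hδ) 1 2] with n hregular hhalf hn hpow η hη0 hη
  have hn0 : (n : ℝ) ≠ 0 := by positivity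
  refine one_sub_le_measureReal_windowCertifier hη0 hη (le_max_left _ _)
    (hregular 1 one_pos hn.le ?_) ?_
  · rw [Real.rpow_sub_one hn0] at hpow
    rw [Nat.cast_one, one_mul]
    linarith [sq_nonneg (Real.log n)]
  · have hpos := clusterScale_pos hn δ η
    have hlog : 0 ≤ Real.log (1 / clusterScale n ((n : ℝ) ^ δ) η) :=
      Real.log_nonneg ((one_le_div hpos).2 (by linarith [hhalf η hη]))
    rw [Nat.cast_one]
    exact Real.one_le_exp (by positivity)

end Dense

section Sparse

open Filter

/-- The window length for sparse hypergraphs: about `r ^ 2 / n`, where `r` is the cluster radius. -/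
def windowLength (n r : ℕ) : ℕ := min n ((r + 1) ^ 2 / n + 1)

lemma windowLength_pos {n : ℕ} (hn : 0 < n) (r : ℕ) : 0 < windowLength n r :=
  lt_min hn (Nat.succ_pos _)

lemma windowLength_le (n r : ℕ) : windowLength n r ≤ n := min_le_left _ _

lemma cast_windowLength_le (n r : ℕ) : (windowLength n r : ℝ) ≤ ((r : ℝ) + 1) ^ 2 / n + 1 :=
  calc (windowLength n r : ℝ) ≤ (((r + 1) ^ 2 / n : ℕ) : ℝ) + 1 := by
        exact_mod_cast min_le_right n ((r + 1) ^ 2 / n + 1)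
    _ ≤ ((r : ℝ) + 1) ^ 2 / n + 1 := by
        gcongr
        exact_mod_cast Nat.cast_div_le (α := ℝ) (m := (r + 1) ^ 2) (n := n)

lemma le_cast_windowLength {n : ℕ} (hn : 0 < n) (r : ℕ) :
    min (n : ℝ) (((r : ℝ) + 1) ^ 2 / n) ≤ windowLength n r := by
  rw [windowLength, Nat.cast_min]
  refine min_le_min le_rfl ((div_le_iff₀ (by exact_mod_cast hn)).2 ?_)
  exact_mod_cast (Nat.lt_mul_of_div_lt (Nat.lt_succ_self ((r + 1) ^ 2 / n)) hn).le

lemma log_sq_div_four_le_windowLength {n : ℕ} (hn : 0 < n) {δ θ : ℝ} (hθ : 0 ≤ θ)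
    (hlog : Real.log n ^ 2 ≤ (n : ℝ) ^ δ) (hscale : Real.log n ^ 2 ≤ θ ^ 2 * (n : ℝ) ^ δ) :
    Real.log n ^ 2 / 4 ≤ windowLength n ⌊θ * n / 2⌋₊ * (n : ℝ) ^ δ / n := by
  have hn0 : (0 : ℝ) < n := by exact_mod_cast hn
  have hfloor : θ * n / 2 ≤ ⌊θ * n / 2⌋₊ + 1 := (Nat.lt_floor_add_one _).le
  have hlower : min (n : ℝ) ((θ * n / 2) ^ 2 / n) ≤ windowLength n ⌊θ * n / 2⌋₊ :=
    (min_le_min le_rfl (by gcongr)).trans (le_cast_windowLength hn _)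
  have hmono (x : ℝ) (hx : x ≤ windowLength n ⌊θ * n / 2⌋₊) :
      x * (n : ℝ) ^ δ / n ≤ windowLength n ⌊θ * n / 2⌋₊ * (n : ℝ) ^ δ / n := by gcongr
  rcases min_le_iff.1 hlower with hcase | hcase
  · refine le_trans ?_ (hmono _ hcase)
    rw [mul_div_assoc, mul_div_cancel₀ _ hn0.ne']
    linarith [sq_nonneg (Real.log n)]
  · refine le_trans ?_ (hmono _ hcase)
    have hcancel : (θ * n / 2) ^ 2 / n * (n : ℝ) ^ δ / n = θ ^ 2 * (n : ℝ) ^ δ / 4 := by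
      field_simp
      norm_num
    linarith

lemma cast_windowLength_floor_le {n : ℕ} (hn : 0 < n) {θ : ℝ} (hθn : 2 ≤ θ * n) :
    (windowLength n ⌊θ * n / 2⌋₊ : ℝ) ≤ θ ^ 2 * n + 1 := by
  have : (0 : ℝ) < n := by exact_mod_cast hn
  have hfloor : (⌊θ * n / 2⌋₊ : ℝ) + 1 ≤ θ * n := by
    linarith [Nat.floor_le (by linarith : 0 ≤ θ * n / 2)]
  calc (windowLength n ⌊θ * n / 2⌋₊ : ℝ) ≤ ((⌊θ * n / 2⌋₊ : ℝ) + 1) ^ 2 / n + 1 :=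
        cast_windowLength_le _ _
    _ ≤ (θ * n) ^ 2 / n + 1 := by gcongr
    _ = θ ^ 2 * n + 1 := by field_simp

lemma mul_two_pow_le_exp {n s : ℕ} (hn : 0 < n) {θ : ℝ} (hθ0 : 0 < θ) (hθ : θ ≤ 1 / 2)
    (hlog : 2 ≤ Real.log n) (hscale : Real.log n ^ 2 ≤ θ ^ 2 * n) (hs : s ≤ θ ^ 2 * n + 1) :
    (n : ℝ) * 2 ^ s ≤ Real.exp (5 * (θ ^ 2 * Real.log (1 / θ)) * n) := by
  have hlog_inv : (0.69 : ℝ) ≤ Real.log (1 / θ) := by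
    have hmono : Real.log 2 ≤ Real.log (1 / θ) :=
      Real.log_le_log two_pos ((le_div_iff₀ hθ0).2 (by linarith))
    linarith [Real.log_two_gt_d9]
  have hmain : θ ^ 2 * n * 0.69 ≤ θ ^ 2 * n * Real.log (1 / θ) := by gcongr
  have hs_log : (s : ℝ) * Real.log 2 ≤ s :=
    mul_le_of_le_one_right (Nat.cast_nonneg _) (by linarith [Real.log_two_lt_d9])
  calc (n : ℝ) * 2 ^ s = Real.exp (Real.log n + s * Real.log 2) := by
        rw [Real.exp_add, Real.exp_log (by exact_mod_cast hn), Real.exp_nat_mul,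
          Real.exp_log two_pos]
    _ ≤ Real.exp (5 * (θ ^ 2 * Real.log (1 / θ)) * n) := Real.exp_le_exp.2 (by nlinarith)

lemma eventually_sparse_bound {δ : ℝ} (hδ : 0 < δ) (hδ1 : δ ≤ 1) (K : ℕ) :
    ∀ᶠ n : ℕ in atTop, ∀ η : ℝ, 0 ≤ η → η ≤ 1 / 1000 →
      1 - 1 / (n : ℝ) ^ K ≤ (randomHypergraph3 n ((n : ℝ) ^ δ * n)).real
        {H | (windowCertifier windowLength (fun n s => n * 2 ^ s) n H ⌊η * (H.ncard : ℝ)⌋₊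
          ⌊clusterScale n ((n : ℝ) ^ δ) η * n / 2⌋₊ : ℝ) ≤
          Real.exp (5 * (clusterScale n ((n : ℝ) ^ δ) η ^ 2 *
            Real.log (1 / clusterScale n ((n : ℝ) ^ δ) η)) * n)} := by
  filter_upwards [eventually_measureReal_not_isWindowRegular_le hδ (by linarith) K,
    eventually_clusterScale_le_half hδ, eventually_le_log_natCast 2, eventually_gt_atTop 1,
    eventually_mul_log_pow_le_rpow hδ 1 2] with n hregular hhalf hlog hn hpow η hη0 hη
  have hn0 : 0 < n := by omega
  have hθ := clusterScale_pos hn δ η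
  have hscale := log_sq_le_clusterScale_sq_mul hn0 δ η
  specialize hhalf η hη
  set θ : ℝ := clusterScale n ((n : ℝ) ^ δ) η
  have hnδ : (n : ℝ) ^ δ ≤ n :=
    Real.rpow_le_self_of_one_le (by exact_mod_cast hn.le) hδ1
  have hscale' : Real.log n ^ 2 ≤ θ ^ 2 * n := hscale.trans (by gcongr)
  have hθn : 2 ≤ θ * n := by nlinarith
  refine one_sub_le_measureReal_windowCertifier hη0 hη (le_max_left _ _)
    (hregular _ (windowLength_pos hn0 _) (windowLength_le _ _) ?_) ?_
  · exact log_sq_div_four_le_windowLength hn0 hθ.le (by linarith) hscale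
  · push_cast
    exact mul_two_pow_le_exp hn0 hθ hhalf hlog hscale' (cast_windowLength_floor_le hn0 hθn)

end Sparse

/-! ### Structured programs -/

section Expressions

open RAM

/-- All cells have at most `b` bits. -/
def Bounded (M : Memory) (b : ℕ) : Prop := ∀ a i, M a i < 2 ^ b

/-- The weight of an expression: its values have at most `weight * b` bits when all cells have at
most `b` bits. -/
def weight : Expr → ℕ
  | .const k => Nat.size k + 1
  | .read _ i => weight i + 1
  | .add e f => weight e + weight f
  | .sub e f => weight e + weight f
  | .mul e f => weight e + weight f
  | .div e f => weight e + weight f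

/-- The cost weight of an expression: its evaluation costs at most `costWeight * b` when all cells
have at most `b` bits. -/
def costWeight : Expr → ℕ
  | .const k => Nat.size k + 1
  | .read _ i => costWeight i + weight i + 2
  | .add e f => costWeight e + costWeight f + weight e + weight f + 1
  | .sub e f => costWeight e + costWeight f + weight e + weight f + 1
  | .mul e f => costWeight e + costWeight f + weight e + weight f + 1
  | .div e f => costWeight e + costWeight f + weight e + weight f + 1

lemma weight_pos (e : Expr) : 0 < weight e := by
  induction e <;> simp only [weight] <;> omega

variable {M : Memory} {b : ℕ}

lemma eval_lt_two_pow (hM : Bounded M b) (hb : 1 ≤ b) (e : Expr) :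
    e.eval M < 2 ^ (weight e * b) := by
  have le_weight_mul (e : Expr) : 1 ≤ weight e * b := Nat.mul_pos (weight_pos e) hb
  have two_pow_mono {k l : ℕ} (hkl : k ≤ l) : 2 ^ (k * b) ≤ 2 ^ (l * b) :=
    Nat.pow_le_pow_right two_pos (Nat.mul_le_mul_right b hkl)
  induction e with
  | const k =>
    calc k < 2 ^ k.size := Nat.lt_size_self k
      _ ≤ 2 ^ ((k.size + 1) * b) := Nat.pow_le_pow_right two_pos (by nlinarith)
  | read a i _ =>
    calc M a (i.eval M) < 2 ^ (1 * b) := by simpa using hM a (i.eval M)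
      _ ≤ 2 ^ ((weight i + 1) * b) := two_pow_mono (Nat.le_add_left 1 _)
  | add e f he hf =>
    simp only [Expr.eval, weight, add_mul, pow_add]
    have := Nat.pow_le_pow_right two_pos (le_weight_mul e)
    have := Nat.pow_le_pow_right two_pos (le_weight_mul f)
    nlinarith
  | sub e f he _ =>
    exact (Nat.sub_le _ _).trans_lt (he.trans_le (two_pow_mono (Nat.le_add_right _ _)))
  | mul e f he hf =>
    simp only [Expr.eval, weight, add_mul, pow_add]
    exact Nat.mul_lt_mul'' he hf
  | div e f he _ =>
    exact (Nat.div_le_self _ _).trans_lt (he.trans_le (two_pow_mono (Nat.le_add_right _ _)))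

lemma size_eval_le (hM : Bounded M b) (hb : 1 ≤ b) (e : Expr) :
    (e.eval M).size ≤ weight e * b :=
  Nat.size_le.2 (eval_lt_two_pow hM hb e)

lemma cost_le (hM : Bounded M b) (hb : 1 ≤ b) (e : Expr) : e.cost M ≤ costWeight e * b := by
  have hsize (e : Expr) := size_eval_le hM hb e
  induction e with
  | const k => simp only [Expr.cost, costWeight]; nlinarith
  | read a i ih =>
    have : (M a (i.eval M)).size ≤ b := Nat.size_le.2 (hM _ _)
    have := hsize i
    simp only [Expr.cost, costWeight, add_mul]
    omega
  | add e f he hf | sub e f he hf | mul e f he hf | div e f he hf =>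
    have := hsize e
    have := hsize f
    simp only [Expr.cost, costWeight, add_mul]
    omega

end Expressions

section Codes

open RAM

/-- The memory `M` with the content of cell `i` of bank `a` replaced by `x`. -/
def setCell (M : Memory) (a i x : ℕ) : Memory := Function.update M a (Function.update (M a) i x)

lemma setCell_of_ne {M : Memory} {a a' : ℕ} (h : a' ≠ a) (i x : ℕ) : setCell M a i x a' = M a' := by
  simp [setCell, h]

lemma setCell_same (M : Memory) (a i x j : ℕ) :
    setCell M a i x a j = if j = i then x else M a j := by
  simp [setCell, Function.update_apply]

lemma setCell_setCell (M : Memory) (a i x y : ℕ) :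
    setCell (setCell M a i x) a i y = setCell M a i y := by
  simp [setCell]

lemma Bounded.setCell {M : Memory} {b x : ℕ} (hM : Bounded M b) (hx : x < 2 ^ b) (a i : ℕ) :
    Bounded (setCell M a i x) b := fun a' j => by
  rcases eq_or_ne a' a with rfl | h
  · rw [setCell_same]
    split_ifs
    exacts [hx, hM _ _]
  · rw [setCell_of_ne h]
    exact hM _ _

/-- The content of cell `0` of bank `a`. -/
abbrev cell (a : ℕ) : Expr := .read a (.const 0)

/-- The remainder of the value of `e` modulo the content of cell `0` of bank `3`. -/
def reduced (e : Expr) : Expr := .sub e (.mul (cell 3) (.div e (cell 3)))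

lemma eval_reduced (e : Expr) (M : Memory) : (reduced e).eval M = e.eval M % M 3 0 := by
  rw [Nat.mod_def]
  rfl

/-- Structured programs: assignments modulo the content of cell `0` of bank `3`, and loops whose
counter, in cell `0` of bank `v`, runs through the numbers below the content of cell `0` of
bank `0`. -/
inductive Code : Type
  | assign (a : ℕ) (i e : Expr) : Code
  | seq (p q : Code) : Code
  | ite (g : Expr) (p q : Code) : Code
  | loop (v : ℕ) (p : Code) : Code

/-- Iteration of a step that depends on the index. -/
def iter (f : ℕ → Memory → Memory) : ℕ → Memory → Memory
  | 0, M => M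
  | i + 1, M => f i (iter f i M)

/-- The machine program that runs `q` with the counter `v` equal to every number below the content
of cell `0` of bank `0`. -/
def countingLoop (v : ℕ) (q : Prog) : Prog :=
  .seq (.write v (.const 0) (.const 0)) (.loop (.sub (cell 0) (cell v))
    (.seq q (.write v (.const 0) (.add (cell v) (.const 1)))))

namespace Code

/-- The effect of a structured program. -/
def exec : Code → Memory → Memory
  | assign a i e, M => setCell M a (i.eval M) (e.eval M % M 3 0)
  | seq p q, M => exec q (exec p M)
  | ite g p q, M => if g.eval M = 0 then exec q M else exec p M
  | loop v p, M =>
      setCell (iter (fun i M' => exec p (setCell M' v 0 i)) (M 0 0) M) v 0 (M 0 0)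

/-- The translation to machine programs. -/
def compile : Code → Prog
  | assign a i e => .write a i (reduced e)
  | seq p q => .seq p.compile q.compile
  | ite g p q => .ite g p.compile q.compile
  | loop v p => countingLoop v p.compile

/-- The banks that a program may change. -/
def banks : Code → List ℕ
  | assign a _ _ => [a]
  | seq p q => p.banks ++ q.banks
  | ite _ p q => p.banks ++ q.banks
  | loop v p => v :: p.banks

/-- No loop counter is changed inside its loop. -/
def Disciplined : Code → Prop
  | assign _ _ _ => True
  | seq p q => p.Disciplined ∧ q.Disciplined
  | ite _ p q => p.Disciplined ∧ q.Disciplined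
  | loop v p => v ∉ p.banks ∧ p.Disciplined

lemma exec_of_notMem {p : Code} {a : ℕ} (ha : a ∉ p.banks) (M : Memory) : p.exec M a = M a := by
  induction p generalizing M with
  | assign a' i e =>
    simp only [banks, List.mem_singleton] at ha
    exact setCell_of_ne ha _ _
  | seq p q hp hq =>
    simp only [banks, List.mem_append, not_or] at ha
    rw [exec, hq ha.2, hp ha.1]
  | ite g p q hp hq =>
    simp only [banks, List.mem_append, not_or] at ha
    rw [exec]
    split_ifs
    exacts [hq ha.2 M, hp ha.1 M]
  | loop v p hp =>
    simp only [banks, List.mem_cons, not_or] at ha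
    rw [exec, setCell_of_ne ha.1]
    induction M 0 0 with
    | zero => rfl
    | succ k ih => rw [iter, hp ha.2, setCell_of_ne ha.1, ih]

lemma iter_of_notMem {p : Code} {a v : ℕ} (ha : a ∉ p.banks) (hv : a ≠ v) (k : ℕ) (M : Memory) :
    iter (fun i M' => p.exec (setCell M' v 0 i)) k M a = M a := by
  induction k with
  | zero => rfl
  | succ k ih => rw [iter, exec_of_notMem ha, setCell_of_ne hv, ih]

end Code

end Codes

/-! ### Structured programs run in polynomial time -/

section RunningTime

open RAM Polynomial

/-- All cells of `M` have at most `b` bits, loops run at most `b` times, and the modulus is not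
`0`. -/
structure Admissible (M : Memory) (b : ℕ) : Prop where
  one_le : 1 ≤ b
  bounded : Bounded M b
  bound_le : M 0 0 ≤ b
  modulus_pos : 0 < M 3 0

lemma Admissible.of_eq {M M' : Memory} {b : ℕ} (hM : Admissible M b) (hM' : Bounded M' b)
    (h0 : M' 0 = M 0) (h3 : M' 3 = M 3) : Admissible M' b :=
  ⟨hM.one_le, hM', by rw [h0]; exact hM.bound_le, by rw [h3]; exact hM.modulus_pos⟩

lemma exists_run_write {M : Memory} {b : ℕ} (hM : Bounded M b) (hb : 1 ≤ b) (a : ℕ) (i e : Expr) :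
    ∃ T ≤ (costWeight i + costWeight e + weight i + weight e + 1) * b,
      Run (.write a i e) M (setCell M a (i.eval M) (e.eval M)) T := by
  refine ⟨_, ?_, Run.write M a i e⟩
  have := cost_le hM hb i
  have := cost_le hM hb e
  have := size_eval_le hM hb i
  have := size_eval_le hM hb e
  simp only [add_mul]
  omega

/-- A factor that pays for the guard and the counter of a loop. -/
def loopCost (v : ℕ) : ℕ :=
  costWeight (.sub (cell 0) (cell v)) + costWeight (.add (cell v) (.const 1)) +
    weight (.add (cell v) (.const 1)) + 5

lemma loopCost_mul (v b : ℕ) :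
    loopCost v * b = costWeight (.sub (cell 0) (cell v)) * b +
      costWeight (.add (cell v) (.const 1)) * b + weight (.add (cell v) (.const 1)) * b +
      5 * b := by
  rw [loopCost]
  ring

section CountingLoop

variable {q : Prog} {M : Memory} {S : ℕ → Memory} {v n b c : ℕ}

/-- The memories `S 0, …, S n` are, up to the values of the counter `v`, those at the start of the
rounds of a counting loop around `q` in which every round costs at most `c`. -/
structure IsLoopTrace (q : Prog) (v n b c : ℕ) (S : ℕ → Memory) : Prop where
  one_le : 1 ≤ b
  bounded : ∀ i ≤ n, Bounded (S i) b
  size_eq : ∀ i, S i 0 0 = n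
  counter_eq : ∀ i, S i v 0 = i
  step : ∀ i < n, ∃ M', Bounded M' b ∧ M' v 0 = i ∧ setCell M' v 0 (i + 1) = S (i + 1) ∧
    ∃ T ≤ c, Run q (S i) M' T

lemma IsLoopTrace.exists_run_loop (hS : IsLoopTrace q v n b c S) (j i : ℕ) (hij : i + j = n) :
    ∃ T ≤ j * (c + loopCost v * b) + loopCost v * b,
      Run (.loop (.sub (cell 0) (cell v))
        (.seq q (.write v (.const 0) (.add (cell v) (.const 1))))) (S i) (S n) T := by
  have hguard : (Expr.sub (cell 0) (cell v)).eval (S i) = j := by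
    simp only [Expr.eval, hS.size_eq, hS.counter_eq]
    omega
  have hcost := cost_le (hS.bounded i (by omega)) hS.one_le (.sub (cell 0) (cell v))
  have := hS.one_le
  induction j generalizing i with
  | zero =>
    obtain rfl : i = n := by omega
    refine ⟨_, ?_, Run.loop_done hguard⟩
    rw [loopCost_mul]
    omega
  | succ j ih =>
    obtain ⟨M', hM', hcounter, hnext, R, hR, hround⟩ := hS.step i (by omega)
    obtain ⟨U, hU, hincrement⟩ :=
      exists_run_write hM' hS.one_le v (.const 0) (.add (cell v) (.const 1))
    rw [Expr.eval, Expr.eval, Expr.eval, Expr.eval, Expr.eval, hcounter, hnext] at hincrement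
    obtain ⟨T, hT, hrest⟩ := ih (i + 1) (by omega)
      (by simp only [Expr.eval, hS.size_eq, hS.counter_eq]; omega)
      (cost_le (hS.bounded _ (by omega)) hS.one_le _)
    refine ⟨_, ?_, Run.loop_step (by rw [hguard]; omega) (hround.seq hincrement) hrest⟩
    have : U ≤ costWeight (.add (cell v) (.const 1)) * b +
        weight (.add (cell v) (.const 1)) * b + 3 * b := by
      refine hU.trans_eq ?_
      simp only [costWeight, weight, Nat.size_zero]
      ring
    rw [Nat.succ_mul, loopCost_mul]
    rw [loopCost_mul] at hT
    omega

lemma IsLoopTrace.exists_run_countingLoop (hS : IsLoopTrace q v n b c S) (hM : Bounded M b)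
    (hzero : setCell M v 0 0 = S 0) :
    ∃ T ≤ n * (c + loopCost v * b) + (loopCost v + 5) * b, Run (countingLoop v q) M (S n) T := by
  obtain ⟨R, hR, hinit⟩ := exists_run_write hM hS.one_le v (.const 0) (.const 0)
  rw [Expr.eval, hzero] at hinit
  obtain ⟨T, hT, hloop⟩ := hS.exists_run_loop n 0 (zero_add n)
  refine ⟨R + T, ?_, hinit.seq hloop⟩
  simp only [costWeight, weight, Nat.size_zero, zero_add] at hR
  rw [add_mul (loopCost v) 5]
  omega

end CountingLoop

namespace Code

/-- From every admissible memory, `p` keeps all cells within `b` bits and its translation runs in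
time `Q b`. -/
def RunsWithin (p : Code) (Q : Polynomial ℕ) : Prop :=
  ∀ (M : Memory) (b : ℕ), Admissible M b →
    Bounded (p.exec M) b ∧ ∃ T ≤ Q.eval b, Run p.compile M (p.exec M) T

variable {p q : Code} {P Q : Polynomial ℕ} {M : Memory} {b v : ℕ}

lemma RunsWithin.admissible (hp : p.RunsWithin P) (h0 : 0 ∉ p.banks) (h3 : 3 ∉ p.banks)
    (hM : Admissible M b) : Admissible (p.exec M) b :=
  hM.of_eq (hp M b hM).1 (exec_of_notMem h0 M) (exec_of_notMem h3 M)

lemma runsWithin_assign (a : ℕ) (i e : Expr) :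
    (assign a i e).RunsWithin
      (C (costWeight i + costWeight (reduced e) + weight i + weight (reduced e) + 1) * X) := by
  intro M b hM
  have hvalue : e.eval M % M 3 0 < 2 ^ b := (Nat.mod_lt _ hM.modulus_pos).trans (hM.bounded _ _)
  refine ⟨hM.bounded.setCell hvalue _ _, ?_⟩
  rw [exec, ← eval_reduced, eval_mul, eval_C, eval_X]
  exact exists_run_write hM.bounded hM.one_le a i (reduced e)

lemma RunsWithin.seq (hp : p.RunsWithin P) (hq : q.RunsWithin Q) (h0 : 0 ∉ p.banks)
    (h3 : 3 ∉ p.banks) : (p.seq q).RunsWithin (P + Q) := by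
  intro M b hM
  obtain ⟨_, S, hS, hrun⟩ := hp M b hM
  obtain ⟨hbounded, T, hT, hrun'⟩ := hq _ b (hp.admissible h0 h3 hM)
  exact ⟨hbounded, S + T, by rw [eval_add]; omega, hrun.seq hrun'⟩

lemma RunsWithin.ite (hp : p.RunsWithin P) (hq : q.RunsWithin Q) (g : Expr) :
    (Code.ite g p q).RunsWithin (P + Q + C (costWeight g) * X + 1) := by
  intro M b hM
  obtain ⟨hbounded, S, hS, hrun⟩ := hp M b hM
  obtain ⟨hbounded', T, hT, hrun'⟩ := hq M b hM
  have := cost_le hM.bounded hM.one_le g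
  simp only [eval_add, eval_mul, eval_C, eval_X, eval_one]
  rw [exec]
  split_ifs with hg
  · exact ⟨hbounded', g.cost M + T + 1, by omega, Run.ite_false hg hrun'⟩
  · exact ⟨hbounded, g.cost M + S + 1, by omega, Run.ite_true hg hrun⟩

/-- The memory at the start of round `i` of a loop around `p` with counter `v`. -/
def loopState (v : ℕ) (p : Code) (M : Memory) (i : ℕ) : Memory :=
  setCell (iter (fun i M' => p.exec (setCell M' v 0 i)) i M) v 0 i

lemma loopState_counter (v : ℕ) (p : Code) (M : Memory) (i : ℕ) : loopState v p M i v 0 = i := by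
  simp [loopState, setCell_same]

lemma loopState_of_notMem {a : ℕ} (ha : a ∉ (loop v p).banks) (i : ℕ) :
    loopState v p M i a = M a := by
  simp only [banks, List.mem_cons, not_or] at ha
  rw [loopState, setCell_of_ne ha.1, iter_of_notMem ha.2 ha.1]

lemma RunsWithin.admissible_loopState (hp : p.RunsWithin P) (h0 : 0 ∉ (loop v p).banks)
    (h3 : 3 ∉ (loop v p).banks) (hM : Admissible M b) {i : ℕ} (hi : i ≤ M 0 0) :
    Admissible (loopState v p M i) b := by
  have hsmall {i : ℕ} (hi : i ≤ M 0 0) : i < 2 ^ b :=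
    (hi.trans hM.bound_le).trans_lt Nat.lt_two_pow_self
  refine hM.of_eq ?_ (loopState_of_notMem h0 i) (loopState_of_notMem h3 i)
  induction i with
  | zero => exact hM.bounded.setCell (hsmall hi) v 0
  | succ i ih =>
    have hprev : Admissible (loopState v p M i) b :=
      hM.of_eq (ih (by omega)) (loopState_of_notMem h0 i) (loopState_of_notMem h3 i)
    exact (hp _ b hprev).1.setCell (hsmall hi) v 0

lemma RunsWithin.isLoopTrace (hp : p.RunsWithin P) (hv : v ∉ p.banks)
    (h0 : 0 ∉ (loop v p).banks) (h3 : 3 ∉ (loop v p).banks) (hM : Admissible M b) :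
    IsLoopTrace p.compile v (M 0 0) b (P.eval b) (loopState v p M) where
  one_le := hM.one_le
  bounded i hi := (hp.admissible_loopState h0 h3 hM hi).bounded
  size_eq i := congrFun (loopState_of_notMem h0 i) 0
  counter_eq := loopState_counter v p M
  step i hi := by
    obtain ⟨hbounded, hrun⟩ := hp _ b (hp.admissible_loopState h0 h3 hM hi.le)
    exact ⟨p.exec (loopState v p M i), hbounded,
      by rw [exec_of_notMem hv, loopState_counter], rfl, hrun⟩

lemma RunsWithin.loop (hp : p.RunsWithin P) (hv : v ∉ p.banks) (h0 : 0 ∉ (loop v p).banks)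
    (h3 : 3 ∉ (loop v p).banks) :
    (loop v p).RunsWithin (X * (P + C (loopCost v) * X) + C (loopCost v + 5) * X) := by
  intro M b hM
  obtain ⟨T, hT, hrun⟩ :=
    (hp.isLoopTrace hv h0 h3 hM).exists_run_countingLoop hM.bounded rfl
  refine ⟨(hp.admissible_loopState h0 h3 hM le_rfl).bounded, T, hT.trans ?_, hrun⟩
  simp only [eval_add, eval_mul, eval_C, eval_X]
  gcongr
  exact hM.bound_le

theorem exists_runsWithin (hd : p.Disciplined) (h0 : 0 ∉ p.banks) (h3 : 3 ∉ p.banks) :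
    ∃ P, p.RunsWithin P := by
  induction p with
  | assign a i e => exact ⟨_, runsWithin_assign a i e⟩
  | seq p q hp hq =>
    simp only [banks, List.mem_append, not_or] at h0 h3
    obtain ⟨P, hP⟩ := hp hd.1 h0.1 h3.1
    obtain ⟨Q, hQ⟩ := hq hd.2 h0.2 h3.2
    exact ⟨_, hP.seq hQ h0.1 h3.1⟩
  | ite g p q hp hq =>
    simp only [banks, List.mem_append, not_or] at h0 h3
    obtain ⟨P, hP⟩ := hp hd.1 h0.1 h3.1
    obtain ⟨Q, hQ⟩ := hq hd.2 h0.2 h3.2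
    exact ⟨_, hP.ite hQ g⟩
  | loop v p hp =>
    obtain ⟨P, hP⟩ :=
      hp hd.2 (mt (List.mem_cons_of_mem v) h0) (mt (List.mem_cons_of_mem v) h3)
    exact ⟨_, hP.loop hd.1 h0 h3⟩

end Code

end RunningTime

/-! ### Reasoning about loops -/

section Loops

open RAM Code

/-- The memories `M'` and `M` agree outside the banks in the list `s`. -/
def AgreeOff (s : List ℕ) (M' M : Memory) : Prop := ∀ a ∉ s, M' a = M a

/-- The memory `M` has the number `n` in cell `0` of bank `0` and the modulus `W` in cell `0` of
bank `3`, and all its cells outside these banks are below `W`. -/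
structure Reduced (M : Memory) (n W : ℕ) : Prop where
  size_eq : M 0 0 = n
  modulus_eq : M 3 0 = W
  size_lt : n < W
  cell_lt : ∀ a, a ≠ 0 → a ≠ 3 → ∀ i, M a i < W

/-- Bank `a` holds the matrix `A`, row by row. -/
def Holds {n : ℕ} {R : Type*} [CommRing R] (M : Memory) (a : ℕ) (A : Matrix (Fin n) (Fin n) R) :
    Prop :=
  ∀ j k : Fin n, ((M a (j * n + k) : ℕ) : R) = A j k

variable {n W a v : ℕ} {s t : List ℕ} {M M' M'' : Memory} {p : Code}

lemma AgreeOff.trans (h' : AgreeOff s M'' M') (h : AgreeOff t M' M) (hst : s ⊆ t) :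
    AgreeOff t M'' M := fun a ha => (h' a (mt (@hst a) ha)).trans (h a ha)

lemma AgreeOff.mono (h : AgreeOff s M' M) (hst : s ⊆ t) : AgreeOff t M' M :=
  fun a ha => h a (mt (@hst a) ha)

lemma Code.exec_agreeOff (p : Code) (M : Memory) : AgreeOff p.banks (p.exec M) M :=
  fun _ ha => exec_of_notMem ha M

lemma Reduced.setCell (hM : Reduced M n W) (h0 : 0 ≠ a) (h3 : 3 ≠ a) {x : ℕ} (hx : x < W) (i : ℕ) :
    Reduced (setCell M a i x) n W where
  size_eq := by rw [setCell_of_ne h0, hM.size_eq]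
  modulus_eq := by rw [setCell_of_ne h3, hM.modulus_eq]
  size_lt := hM.size_lt
  cell_lt b hb0 hb3 j := by
    rcases eq_or_ne b a with rfl | hba
    · rw [setCell_same]
      split_ifs
      exacts [hx, hM.cell_lt _ hb0 hb3 _]
    · rw [setCell_of_ne hba]
      exact hM.cell_lt _ hb0 hb3 _

lemma Reduced.loopState_of_exec (hp : ∀ {M}, Reduced M n W → Reduced (p.exec M) n W)
    (hM : Reduced M n W) (h0 : 0 ≠ v) (h3 : 3 ≠ v) {i : ℕ} (hi : i ≤ n) :
    Reduced (loopState v p M i) n W := by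
  have hlt : i < W := hi.trans_lt hM.size_lt
  induction i with
  | zero => exact hM.setCell h0 h3 hlt 0
  | succ i ih => exact (hp (ih (by omega) (by omega))).setCell h0 h3 hlt 0

lemma Reduced.exec (hM : Reduced M n W) (h0 : 0 ∉ p.banks) (h3 : 3 ∉ p.banks) :
    Reduced (p.exec M) n W := by
  induction p generalizing M with
  | assign a i e =>
    simp only [banks, List.mem_singleton] at h0 h3
    refine hM.setCell h0 h3 ?_ _
    rw [hM.modulus_eq]
    exact Nat.mod_lt _ (pos_of_gt hM.size_lt)
  | seq p q hp hq =>
    simp only [banks, List.mem_append, not_or] at h0 h3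
    exact hq (hp hM h0.1 h3.1) h0.2 h3.2
  | ite g p q hp hq =>
    simp only [banks, List.mem_append, not_or] at h0 h3
    rw [Code.exec]
    split_ifs
    exacts [hq hM h0.2 h3.2, hp hM h0.1 h3.1]
  | loop v p hp =>
    simp only [banks, List.mem_cons, not_or] at h0 h3
    exact hM.loopState_of_exec (fun hM => hp hM h0.2 h3.2) h0.1 h3.1 hM.size_eq.le

lemma exec_loop_induction (hM : Reduced M n W) (h0 : 0 ∉ (loop v p).banks)
    (h3 : 3 ∉ (loop v p).banks) (P : ℕ → Memory → Prop)
    (hcounter : ∀ i M' x, P i M' → P i (setCell M' v 0 x)) (hzero : P 0 M)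
    (hstep : ∀ i < n, ∀ M', Reduced M' n W → AgreeOff (loop v p).banks M' M →
      M' v 0 = i → P i M' → P (i + 1) (p.exec M')) : P n ((loop v p).exec M) := by
  simp only [banks, List.mem_cons, not_or] at h0 h3
  have hstate (i : ℕ) (hi : i ≤ n) : P i (loopState v p M i) := by
    induction i with
    | zero => exact hcounter _ _ _ hzero
    | succ i ih =>
      have hred := hM.loopState_of_exec (fun hM => hM.exec h0.2 h3.2) h0.1 h3.1 (i := i) (by omega)
      exact hcounter _ _ _ (hstep i hi _ hred (fun _ ha => loopState_of_notMem ha i)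
        (loopState_counter v p M i) (ih (by omega)))
  have hexec : (loop v p).exec M = loopState v p M n := by
    rw [← hM.size_eq]
    rfl
  exact hexec ▸ hstate n le_rfl

lemma exec_loop_add (hM : Reduced M n W) (h0 : 0 ∉ (loop v p).banks) (h3 : 3 ∉ (loop v p).banks)
    (hav : a ≠ v) {R : Type*} [CommRing R] (val : Fin n → R)
    (hstep : ∀ (i : Fin n) (M' : Memory), Reduced M' n W → AgreeOff (loop v p).banks M' M →
      M' v 0 = i → ((p.exec M' a 0 : ℕ) : R) = (M' a 0 : ℕ) + val i) :
    (((loop v p).exec M a 0 : ℕ) : R) = (M a 0 : ℕ) + ∑ i, val i := by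
  have hpartial := exec_loop_induction hM h0 h3 (fun i M' => ((M' a 0 : ℕ) : R) =
    (M a 0 : ℕ) + ∑ j ∈ Finset.range i, if hj : j < n then val ⟨j, hj⟩ else 0)
    (fun i M' x hM' => by rw [setCell_of_ne hav]; exact hM') (by simp)
    (fun i hi M' hred hagree hvi hP => by
      rw [hstep ⟨i, hi⟩ M' hred hagree hvi, hP, Finset.sum_range_succ, dif_pos hi, add_assoc])
  rw [hpartial, Finset.sum_range]
  simp

lemma exec_loop_flag (hM : Reduced M n W) (h0 : 0 ∉ (loop v p).banks) (h3 : 3 ∉ (loop v p).banks)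
    (hav : a ≠ v) (good : Fin n → Prop)
    (hstep : ∀ (i : Fin n) (M' : Memory), Reduced M' n W → AgreeOff (loop v p).banks M' M →
      M' v 0 = i → (p.exec M' a 0 = 0 ↔ M' a 0 = 0 ∧ good i)) :
    (loop v p).exec M a 0 = 0 ↔ M a 0 = 0 ∧ ∀ i, good i := by
  have hpartial := exec_loop_induction hM h0 h3 (fun i M' => M' a 0 = 0 ↔
    M a 0 = 0 ∧ ∀ j : Fin n, (j : ℕ) < i → good j)
    (fun i M' x hM' => by rw [setCell_of_ne hav]; exact hM') (by simp)
    (fun i hi M' hred hagree hvi hP => by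
      rw [hstep ⟨i, hi⟩ M' hred hagree hvi, hP, and_assoc, and_congr_right_iff]
      refine fun _ => ⟨fun ⟨hlt, heq⟩ j hj => ?_, fun hle =>
        ⟨fun j hj => hle j (hj.trans i.lt_succ_self), hle ⟨i, hi⟩ i.lt_succ_self⟩⟩
      rcases Nat.lt_succ_iff_lt_or_eq.1 hj with hji | hji
      · exact hlt j hji
      · rwa [show j = ⟨i, hi⟩ from Fin.ext hji])
  rw [hpartial]
  simp

lemma index_injective {j k j' k' : ℕ} (hk : k < n) (hk' : k' < n)
    (h : j * n + k = j' * n + k') : j = j' ∧ k = k' := by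
  have hn : 0 < n := by omega
  have hmod := congrArg (· % n) h
  have hdiv := congrArg (· / n) h
  simp only [Nat.mul_add_mod_self_right, Nat.mod_eq_of_lt hk, Nat.mod_eq_of_lt hk'] at hmod
  simp only [add_comm (_ * n), Nat.add_mul_div_right _ _ hn, Nat.div_eq_of_lt hk,
    Nat.div_eq_of_lt hk', zero_add] at hdiv
  exact ⟨hdiv, hmod⟩

lemma holds_exec_loop_loop (hM : Reduced M n W) {u : ℕ} (h0 : 0 ∉ (loop u (loop v p)).banks)
    (h3 : 3 ∉ (loop u (loop v p)).banks) (hu : u ∉ (loop v p).banks) (hau : a ≠ u) (hav : a ≠ v)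
    {R : Type*} [CommRing R] (A : Matrix (Fin n) (Fin n) R)
    (hstep : ∀ (j k : Fin n) (M' : Memory), Reduced M' n W →
      AgreeOff (loop u (loop v p)).banks M' M → M' u 0 = j → M' v 0 = k →
      ∃ x : ℕ, p.exec M' a = Function.update (M' a) (j * n + k) x ∧ (x : R) = A j k) :
    Holds ((loop u (loop v p)).exec M) a A := by
  set filled : ℕ → Memory → Prop := fun m M' => ∀ j k : Fin n, (j * n + k : ℕ) < m →
    ((M' a (j * n + k) : ℕ) : R) = A j k
  have hcounter {c : ℕ} (hac : a ≠ c) (m : ℕ) (M' : Memory) (x : ℕ) (h : filled m M') :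
      filled m (setCell M' c 0 x) := by
    simpa only [filled, setCell_of_ne hac] using h
  have hrows := exec_loop_induction hM h0 h3 (fun i => filled (i * n))
    (fun i => hcounter hau (i * n)) (fun j k hj => absurd hj (by simp))
    (fun i hi M' hred hagree hui hrow => ?_)
  · exact fun j k => hrows j k (by nlinarith [j.2, k.2])
  have hentries := exec_loop_induction hred (mt (List.mem_cons_of_mem u) h0)
    (mt (List.mem_cons_of_mem u) h3) (fun i' => filled (i * n + i'))
    (fun i' => hcounter hav (i * n + i')) hrow
    (fun i' hi' M'' hred' hagree' hvi hentry j k hjk => ?_)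
  · exact fun j k hjk => hentries j k (by rwa [Nat.succ_mul] at hjk)
  obtain ⟨x, hx, hxA⟩ := hstep ⟨i, hi⟩ ⟨i', hi'⟩ M'' hred'
    (hagree'.trans hagree (List.subset_cons_self _ _)) ((congrFun (hagree' u hu) 0).trans hui) hvi
  rw [hx, Function.update_apply]
  split_ifs with hindex
  · obtain ⟨hj, hk⟩ := index_injective k.2 hi' hindex
    rw [hxA, show j = ⟨i, hi⟩ from Fin.ext hj, show k = ⟨i', hi'⟩ from Fin.ext hk]
  · simp only at hindex
    exact hentry j k (by omega)

lemma eq_of_cast_eq {x y : ℕ} (hx : x < W) (hy : y < W) (h : (x : ZMod W) = y) : x = y :=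
  Nat.ModEq.eq_of_lt_of_lt ((ZMod.natCast_eq_natCast_iff x y W).1 h) hx hy

end Loops

/-! ### Matrix arithmetic modulo `W` -/

/- The banks of the programs below. Bank `0` holds the input numbers, bank `1` the adjacency
tensor, bank `2` the output and bank `3` the modulus. The counters are in bank `10` for vertices,
`11` for rows, `12` for columns, `13` for summation, `14` for the start of a window and `15` for
the rounds of a power. The numbers computed are in bank `20` for `|H|`, `21` for the window
length, `22` for the flag of a failed test, `23` for the bound on a moment, `24` for the moment,
`25` for the exponent that is halved, `26` for a degree and `27` for a sum. The banks `30` to `33`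
hold matrices. -/

section MatrixPrograms

open RAM Code
open scoped Matrix

variable {n W a b d : ℕ} {M : Memory} {H : Hypergraph3 n} {t r : ℕ}

lemma exec_assign_cell (hM : Reduced M n W) (a : ℕ) (e : Expr) :
    (assign a (.const 0) e).exec M a 0 = e.eval M % W := by
  rw [exec, Expr.eval, setCell_same, if_pos rfl, hM.modulus_eq]

lemma cast_exec_assign_cell (hM : Reduced M n W) (a : ℕ) (e : Expr) :
    (((assign a (.const 0) e).exec M a 0 : ℕ) : ZMod W) = (e.eval M : ℕ) := by
  rw [exec_assign_cell hM, ZMod.natCast_mod]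

/-- The address of entry `(e, f)` of an `n × n` matrix. -/
def entryIndex (e f : Expr) : Expr := .add (.mul e (cell 0)) f

lemma eval_entryIndex (hM : M 0 0 = n) (e f : Expr) :
    (entryIndex e f).eval M = e.eval M * n + f.eval M := by
  simp [entryIndex, Expr.eval, hM]

/-- The entry of the adjacency tensor at the triple `place c x y z`. -/
def adjacency (c : Fin 3) (x y z : Expr) : Expr :=
  match c with
  | 0 => .read 1 (entryIndex (entryIndex x y) z)
  | 1 => .read 1 (entryIndex (entryIndex y x) z)
  | 2 => .read 1 (entryIndex (entryIndex y z) x)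

lemma inputMemory_edge (H : Hypergraph3 n) (t r : ℕ) (U : Fin 3 → Fin n) :
    inputMemory n H t r 1 (((U 0 : ℕ) * n + (U 1 : ℕ)) * n + (U 2 : ℕ)) = edge H U := by
  have hmem : (∃ V ∈ H, ((U 0 : ℕ) * n + (U 1 : ℕ)) * n + (U 2 : ℕ) =
      ((V 0 : ℕ) * n + (V 1 : ℕ)) * n + (V 2 : ℕ)) ↔ U ∈ H := by
    refine ⟨fun ⟨V, hV, hVU⟩ => ?_, fun hU => ⟨U, hU, rfl⟩⟩
    obtain ⟨hVU, h2⟩ := index_injective (U 2).2 (V 2).2 hVU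
    obtain ⟨h0, h1⟩ := index_injective (U 1).2 (V 1).2 hVU
    have : U = V := funext (Fin.forall_fin_succ.2
      ⟨Fin.ext h0, Fin.forall_fin_two.2 ⟨Fin.ext h1, Fin.ext h2⟩⟩)
    exact this ▸ hV
  classical exact if_congr hmem rfl rfl

lemma eval_adjacency (h0 : M 0 0 = n) (h1 : M 1 = inputMemory n H t r 1) (c : Fin 3)
    {x y z : Expr} {i j k : Fin n} (hx : x.eval M = i) (hy : y.eval M = j) (hz : z.eval M = k) :
    (adjacency c x y z).eval M = edge H (place c i j k) := by
  have := inputMemory_edge H t r (place c i j k)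
  fin_cases c <;> simp only [adjacency, Expr.eval, eval_entryIndex h0, hx, hy, hz, h1] <;>
    exact this

/-- Store the sum of `e`, over the values of the counter in bank `13`, in bank `27`. -/
def sumCode (e : Expr) : Code :=
  seq (assign 27 (.const 0) (.const 0)) (loop 13 (assign 27 (.const 0) (.add (cell 27) e)))

@[simp]
lemma banks_sumCode (e : Expr) : (sumCode e).banks = [27, 13, 27] := rfl

lemma cast_exec_sumCode (hM : Reduced M n W) (e : Expr) (val : Fin n → ZMod W)
    (he : ∀ (l : Fin n) (M' : Memory), Reduced M' n W → AgreeOff [13, 27] M' M →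
      M' 13 0 = l → ((e.eval M' : ℕ) : ZMod W) = val l) :
    (((sumCode e).exec M 27 0 : ℕ) : ZMod W) = ∑ l, val l := by
  have hinit : Reduced ((assign 27 (.const 0) (.const 0)).exec M) n W :=
    hM.exec (by simp [banks]) (by simp [banks])
  rw [sumCode, exec, exec_loop_add hinit (by simp [banks]) (by simp [banks]) (by decide) val,
    cast_exec_assign_cell hM, Expr.eval, Nat.cast_zero, zero_add]
  intro l M' hred hagree hl
  have hagree' : AgreeOff [13, 27] M' M :=
    hagree.trans ((exec_agreeOff _ M).mono (by simp [banks])) (by simp [banks])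
  rw [cast_exec_assign_cell hred, Expr.eval, Nat.cast_add, he l M' hred hagree' hl]
  rfl

/-- Fill the matrix in bank `a` with the values of `e` at the counters in banks `11` and `12`. -/
def fillCode (a : ℕ) (e : Expr) : Code :=
  loop 11 (loop 12 (assign a (entryIndex (cell 11) (cell 12)) e))

@[simp]
lemma banks_fillCode (a : ℕ) (e : Expr) : (fillCode a e).banks = [11, 12, a] := rfl

lemma holds_exec_fillCode (hM : Reduced M n W) (ha : a ∉ [0, 3, 11, 12]) (e : Expr)
    (A : Matrix (Fin n) (Fin n) (ZMod W))
    (he : ∀ (j k : Fin n) (M' : Memory), Reduced M' n W → AgreeOff [11, 12, a] M' M →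
      M' 11 0 = j → M' 12 0 = k → ((e.eval M' : ℕ) : ZMod W) = A j k) :
    Holds ((fillCode a e).exec M) a A := by
  simp only [List.mem_cons, List.not_mem_nil, or_false, not_or] at ha
  refine holds_exec_loop_loop hM (by simp [banks]; omega) (by simp [banks]; omega)
    (by simp [banks]; omega) ha.2.2.1 ha.2.2.2 A fun j k M' hred hagree hj hk => ?_
  refine ⟨e.eval M' % M' 3 0, ?_, ?_⟩
  · simp only [exec, setCell, Function.update_self, eval_entryIndex hred.size_eq, Expr.eval, hj, hk]
  · rw [hred.modulus_eq, ZMod.natCast_mod]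
    exact he j k M' hred hagree hj hk

/-- Fill the matrix in bank `a` with the values of `e'`, which may use the sum of `e` in
bank `27`. -/
def fillSumCode (a : ℕ) (e e' : Expr) : Code :=
  loop 11 (loop 12 (seq (sumCode e) (assign a (entryIndex (cell 11) (cell 12)) e')))

lemma holds_exec_fillSumCode (hM : Reduced M n W) (ha : a ∉ [0, 3, 11, 12, 13, 27]) (e e' : Expr)
    (val : Fin n → Fin n → Fin n → ZMod W) (φ : ZMod W → ZMod W)
    (he : ∀ (j k l : Fin n) (M' : Memory), Reduced M' n W → AgreeOff [11, 12, 13, 27, a] M' M →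
      M' 11 0 = j → M' 12 0 = k → M' 13 0 = l → ((e.eval M' : ℕ) : ZMod W) = val j k l)
    (he' : ∀ M' : Memory, Reduced M' n W → AgreeOff [11, 12, 13, 27, a] M' M →
      ((e'.eval M' : ℕ) : ZMod W) = φ (M' 27 0 : ℕ)) :
    Holds ((fillSumCode a e e').exec M) a (Matrix.of fun j k => φ (∑ l, val j k l)) := by
  simp only [List.mem_cons, List.not_mem_nil, or_false, not_or] at ha
  refine holds_exec_loop_loop hM (by simp [banks]; omega) (by simp [banks]; omega)
    (by simp [banks]; omega) ha.2.2.1 ha.2.2.2.1 _ fun j k M' hred hagree hj hk => ?_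
  have hagree : AgreeOff [11, 12, 13, 27, a] M' M := hagree.mono (by simp [banks])
  set S := (sumCode e).exec M' with hS
  have hagreeS : AgreeOff [27, 13, 27] S M' := exec_agreeOff (sumCode e) M'
  have hredS : Reduced S n W := hred.exec (by simp) (by simp)
  refine ⟨e'.eval S % S 3 0, ?_, ?_⟩
  · simp only [exec, ← hS, setCell, Function.update_self, eval_entryIndex hredS.size_eq, Expr.eval,
      hagreeS 11 (by decide), hagreeS 12 (by decide), hj, hk]
    rw [hagreeS a (by simp; omega)]
  · rw [hredS.modulus_eq, ZMod.natCast_mod, he' S hredS (hagreeS.trans hagree (by simp)),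
      cast_exec_sumCode hred e (val j k) fun l M'' hred' hagree' hl => ?_, Matrix.of_apply]
    exact he j k l M'' hred' (hagree'.trans hagree (by simp)) (by rw [hagree' 11 (by decide), hj])
      (by rw [hagree' 12 (by decide), hk]) hl

/-- Fill bank `d` with the sums of the products of the entries of the rows of the matrix in
bank `a` with the values of `e`. -/
def mulCode (d a : ℕ) (e : Expr) : Code :=
  fillSumCode d (.mul (.read a (entryIndex (cell 11) (cell 13))) e) (cell 27)

@[simp]
lemma banks_mulCode (d a : ℕ) (e : Expr) : (mulCode d a e).banks = [11, 12, 27, 13, 27, d] := rfl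

variable {A B : Matrix (Fin n) (Fin n) (ZMod W)}

lemma holds_exec_mulCode (hM : Reduced M n W) (hd : d ∉ [0, 3, 11, 12, 13, 27])
    (ha : a ∉ [11, 12, 13, 27, d]) (hb : b ∉ [11, 12, 13, 27, d]) (hA : Holds M a A)
    (hB : Holds M b B) :
    Holds ((mulCode d a (.read b (entryIndex (cell 13) (cell 12)))).exec M) d (A * B) := by
  refine holds_exec_fillSumCode hM hd _ _ (fun j k l => A j l * B l k) id
    (fun j k l M' hred hagree hj hk hl => ?_) (fun M' _ _ => rfl)
  simp only [Expr.eval, eval_entryIndex hred.size_eq, hj, hk, hl, hagree a ha, hagree b hb]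
  rw [Nat.cast_mul, hA j l, hB l k]

lemma holds_exec_mulCode_transpose (hM : Reduced M n W) (hd : d ∉ [0, 3, 11, 12, 13, 27])
    (ha : a ∉ [11, 12, 13, 27, d]) (hb : b ∉ [11, 12, 13, 27, d]) (hA : Holds M a A)
    (hB : Holds M b B) :
    Holds ((mulCode d a (.read b (entryIndex (cell 12) (cell 13)))).exec M) d (A * Bᵀ) := by
  refine holds_exec_fillSumCode hM hd _ _ (fun j k l => A j l * B k l) id
    (fun j k l M' hred hagree hj hk hl => ?_) (fun M' _ _ => rfl)
  simp only [Expr.eval, eval_entryIndex hred.size_eq, hj, hk, hl, hagree a ha, hagree b hb]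
  rw [Nat.cast_mul, hA j l, hB k l]

/-- Set the flag in bank `22` unless the value of `g` is zero. -/
def flagCode (g : Expr) : Code :=
  assign 22 (.const 0) (.sub (.const 1) (.sub (.const 1) (.add (cell 22) g)))

lemma exec_flagCode_eq_zero_iff (hM : Reduced M n W) (hn : 0 < n) (g : Expr) :
    (flagCode g).exec M 22 0 = 0 ↔ M 22 0 = 0 ∧ g.eval M = 0 := by
  have hlt := hM.size_lt
  rw [flagCode, exec_assign_cell hM]
  simp only [Expr.eval]
  rw [Nat.mod_eq_of_lt (by omega)]
  omega

end MatrixPrograms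

/-! ### The programs for the window matrices and their moments -/

section MomentPrograms

open RAM Code

variable {n W : ℕ} {M M' : Memory} {H : Hypergraph3 n} {t r s : ℕ} {l : List ℕ}

/-- The memory holds the adjacency tensor of `H` in bank `1`, its number of hyperedges in bank `20`
and the window length `s` in bank `21`. -/
structure Loaded (M : Memory) (W : ℕ) (H : Hypergraph3 n) (t r s : ℕ) : Prop
    extends Reduced M n W where
  tensor_eq : M 1 = inputMemory n H t r 1
  count_eq : M 20 0 = H.ncard
  length_eq : M 21 0 = s

lemma Loaded.of_agreeOff (hM : Loaded M W H t r s) (hred : Reduced M' n W)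
    (hagree : AgreeOff l M' M) (hl : ∀ b ∈ [1, 20, 21], b ∉ l) : Loaded M' W H t r s where
  toReduced := hred
  tensor_eq := by rw [hagree 1 (hl 1 (by decide)), hM.tensor_eq]
  count_eq := by rw [hagree 20 (hl 20 (by decide)), hM.count_eq]
  length_eq := by rw [hagree 21 (hl 21 (by decide)), hM.length_eq]

lemma Loaded.exec (hM : Loaded M W H t r s) {p : Code} (hp : ∀ b ∈ [0, 3, 1, 20, 21], b ∉ p.banks) :
    Loaded (p.exec M) W H t r s :=
  hM.of_agreeOff (hM.toReduced.exec (hp 0 (by decide)) (hp 3 (by decide))) (exec_agreeOff p M)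
    fun b hb => hp b (List.mem_cons_of_mem _ (List.mem_cons_of_mem _ hb))

/-- The number `n ^ 3`. -/
def cubeExpr : Expr := .mul (cell 0) (.mul (cell 0) (cell 0))

/-- The number `s |H|`. -/
def lengthMulCount : Expr := .mul (cell 21) (cell 20)

/-- The summand of the window count: the indicator of `l < s` times the adjacency of the shift by
`l` of the start of the window in bank `14`, for the counter `l` in bank `13`. -/
def windowSummand (c : Fin 3) : Expr :=
  .mul (.sub (.const 1) (.sub (.const 1) (.sub (cell 21) (cell 13))))
    (adjacency c (.sub (.add (cell 14) (cell 13))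
      (.mul (cell 0) (.div (.add (cell 14) (cell 13)) (cell 0)))) (cell 11) (cell 12))

/-- The entry of the centered window matrix, for the window count in bank `27`; the summand
`W s |H|` keeps the truncated subtraction from reaching `0`. -/
def centeredEntry : Expr :=
  .mul (.const 100) (.sub (.add (.mul cubeExpr (cell 27)) (.mul (cell 3) lengthMulCount))
    lengthMulCount)

/-- Store the centered window matrix in bank `30`. -/
def windowCode (c : Fin 3) : Code := fillSumCode 30 (windowSummand c) centeredEntry

@[simp]
lemma banks_windowCode (c : Fin 3) : (windowCode c).banks = [11, 12, 27, 13, 27, 30] := rfl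

lemma windowCount_eq_sum (hs : s ≤ n) (c : Fin 3) (a j k : Fin n) :
    windowCount H c s a j k =
      ∑ l : Fin n, (1 - (1 - (s - l))) * edge H (place c (shift a l) j k) := by
  rw [Fin.sum_univ_eq_sum_range (fun l => (1 - (1 - (s - l))) * edge H (place c (shift a l) j k)),
    windowCount, ← Finset.sum_subset (Finset.range_mono hs)]
  · refine Finset.sum_congr rfl fun l hl => ?_
    rw [show 1 - (1 - (s - l)) = 1 by have := Finset.mem_range.1 hl; omega, one_mul]
  · intro l _ hl
    rw [show 1 - (1 - (s - l)) = 0 by rw [Finset.mem_range] at hl; omega, zero_mul]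

lemma Loaded.eval_windowSummand (hM : Loaded M W H t r s) (c : Fin 3) {a j k l : Fin n}
    (ha : M 14 0 = a) (hj : M 11 0 = j) (hk : M 12 0 = k) (hl : M 13 0 = l) :
    (windowSummand c).eval M = (1 - (1 - (s - l))) * edge H (place c (shift a l) j k) := by
  simp only [windowSummand, Expr.eval]
  rw [eval_adjacency hM.size_eq hM.tensor_eq c (i := shift a l) (y := cell 11) (z := cell 12)
    ?_ hj hk, hM.length_eq, hl]
  simp only [Expr.eval, ha, hl, hM.size_eq]
  exact (Nat.mod_def _ _).symm

lemma Loaded.cast_eval_centeredEntry (hM : Loaded M W H t r s) :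
    (centeredEntry.eval M : ZMod W) = 100 * ((n : ZMod W) ^ 3 * (M 27 0 : ℕ) - s * H.ncard) := by
  have hle : s * H.ncard ≤ n * (n * n) * M 27 0 + W * (s * H.ncard) :=
    le_add_left (Nat.le_mul_of_pos_left _ (pos_of_gt hM.size_lt))
  simp only [centeredEntry, Expr.eval, cubeExpr, lengthMulCount, hM.size_eq, hM.modulus_eq,
    hM.length_eq, hM.count_eq]
  rw [Nat.cast_mul, Nat.cast_sub hle]
  push_cast
  rw [ZMod.natCast_self]
  ring

lemma Loaded.holds_exec_windowCode (hM : Loaded M W H t r s) (hs : s ≤ n) (c : Fin 3) {a : Fin n}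
    (ha : M 14 0 = a) :
    Holds ((windowCode c).exec M) 30 ((centeredMatrix H c s a).map (Int.castRingHom (ZMod W))) := by
  have hfill := holds_exec_fillSumCode hM.toReduced (a := 30) (by decide) (windowSummand c)
    centeredEntry
    (fun j k l => (((1 - (1 - (s - l))) * edge H (place c (shift a l) j k) : ℕ) : ZMod W))
    (fun x => 100 * ((n : ZMod W) ^ 3 * x - s * H.ncard))
    (fun j k l M' hred hagree hj hk hl => by
      rw [(hM.of_agreeOff hred hagree (by decide)).eval_windowSummand c
        (by rw [hagree 14 (by decide), ha]) hj hk hl])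
    (fun M' hred hagree => (hM.of_agreeOff hred hagree (by decide)).cast_eval_centeredEntry)
  intro j k
  rw [windowCode, hfill j k]
  simp only [Matrix.of_apply, Matrix.map_apply, centeredMatrix, windowCount_eq_sum hs, eq_intCast]
  push_cast
  rfl

/-- Multiply the matrix in bank `32` by the matrix in bank `31`. -/
def mulStep : Code :=
  seq (mulCode 33 32 (.read 31 (entryIndex (cell 13) (cell 12))))
    (fillCode 32 (.read 33 (entryIndex (cell 11) (cell 12))))

@[simp]
lemma banks_mulStep : mulStep.banks = [11, 12, 27, 13, 27, 33, 11, 12, 32] := rfl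

lemma holds_exec_mulStep (hM : Reduced M n W) {A Z : Matrix (Fin n) (Fin n) (ZMod W)}
    (hA : Holds M 31 A) (hZ : Holds M 32 Z) : Holds (mulStep.exec M) 32 (Z * A) := by
  have hproduct := holds_exec_mulCode hM (d := 33) (by decide) (by decide) (by decide) hZ hA
  refine holds_exec_fillCode (hM.exec (by simp) (by simp)) (by decide) _ _
    fun j k M' hred hagree hj hk => ?_
  simp only [Expr.eval, eval_entryIndex hred.size_eq, hj, hk, hagree 33 (by decide)]
  exact hproduct j k

/-- The number `(s |H| n) ^ 4`. -/
def scaleFourthPower : Expr :=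
  .mul (.mul (.mul lengthMulCount (cell 0)) (.mul lengthMulCount (cell 0)))
    (.mul (.mul lengthMulCount (cell 0)) (.mul lengthMulCount (cell 0)))

lemma Loaded.eval_scaleFourthPower (hM : Loaded M W H t r s) :
    scaleFourthPower.eval M = (s * H.ncard * n) ^ 4 := by
  simp only [scaleFourthPower, lengthMulCount, Expr.eval, hM.size_eq, hM.length_eq, hM.count_eq]
  ring

/-- Multiply the matrix in bank `32` by the matrix in bank `31` and bank `23` by `(s |H| n) ^ 4`,
and halve bank `25`. -/
def powerStep : Code :=
  seq mulStep (seq (assign 23 (.const 0) (.mul (cell 23) scaleFourthPower))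
    (assign 25 (.const 0) (.div (cell 25) (.const 2))))

/-- One round of the computation of powers, which does nothing once the number in bank `25`
is `0`. -/
def powerRound : Code := .ite (cell 25) powerStep (assign 25 (.const 0) (cell 25))

/-- Raise the matrix in bank `31` to the power `Nat.size n`, in bank `32`; bank `23` receives the
power `4 * Nat.size n` of `s |H| n`. -/
def powerCode : Code :=
  seq (fillCode 32 (.sub (.const 1) (.add (.sub (cell 11) (cell 12)) (.sub (cell 12) (cell 11)))))
    (seq (assign 23 (.const 0) (.const 1)) (seq (assign 25 (.const 0) (cell 0))
      (loop 15 powerRound)))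

@[simp]
lemma banks_powerCode : powerCode.banks =
    [11, 12, 32, 23, 25, 15, 11, 12, 27, 13, 27, 33, 11, 12, 32, 23, 25, 25] := rfl

/-- Bank `32` holds `A ^ e` and bank `23` holds `x ^ (4 * e)`. -/
structure HoldsPowers (M : Memory) (A : Matrix (Fin n) (Fin n) (ZMod W)) (x : ZMod W) (e : ℕ) :
    Prop where
  matrix : Holds M 32 (A ^ e)
  scalar : ((M 23 0 : ℕ) : ZMod W) = x ^ (4 * e)

variable {A : Matrix (Fin n) (Fin n) (ZMod W)} {x : ZMod W} {e i : ℕ}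

lemma HoldsPowers.congr (hM : HoldsPowers M A x e) (h32 : M' 32 = M 32) (h23 : M' 23 = M 23) :
    HoldsPowers M' A x e where
  matrix j k := by rw [h32]; exact hM.matrix j k
  scalar := by rw [h23]; exact hM.scalar

lemma HoldsPowers.exec_powerStep (hpow : HoldsPowers M A (s * H.ncard * n : ℕ) e)
    (hM : Loaded M W H t r s) (hA : Holds M 31 A) :
    HoldsPowers (powerStep.exec M) A (s * H.ncard * n : ℕ) (e + 1) where
  matrix := by
    have hscalars : powerStep.exec M 32 = mulStep.exec M 32 := by
      rw [powerStep, Code.exec, exec_of_notMem (by simp [banks])]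
    intro j k
    rw [hscalars, pow_succ]
    exact holds_exec_mulStep hM.toReduced hA hpow.matrix j k
  scalar := by
    have hstep : Loaded (mulStep.exec M) W H t r s := hM.exec (by simp)
    rw [powerStep, Code.exec, Code.exec, exec_of_notMem (by simp [banks]),
      cast_exec_assign_cell hstep.toReduced, Expr.eval, Expr.eval, hstep.eval_scaleFourthPower,
      exec_of_notMem (by simp), Nat.cast_mul]
    simp only [Expr.eval]
    rw [hpow.scalar, Nat.cast_pow, ← pow_add, mul_add_one]

lemma Loaded.exec_powerStep_counter (hM : Loaded M W H t r s) :
    powerStep.exec M 25 0 = M 25 0 / 2 := by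
  have hstep : Loaded ((assign 23 (.const 0) (.mul (cell 23) scaleFourthPower)).exec
    (mulStep.exec M)) W H t r s := (hM.exec (by simp)).exec (by simp [banks])
  rw [powerStep, Code.exec, Code.exec, exec_assign_cell hstep.toReduced]
  simp only [Expr.eval]
  rw [exec_of_notMem (by simp [banks]), exec_of_notMem (by simp)]
  exact Nat.mod_eq_of_lt
    ((Nat.div_le_self _ _).trans_lt (hM.cell_lt 25 (by decide) (by decide) 0))

lemma div_two_pow_eq_zero_iff (n i : ℕ) : n / 2 ^ i = 0 ↔ n.size ≤ i := by
  rw [Nat.div_eq_zero_iff, Nat.size_le]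
  simp

lemma size_le_self (n : ℕ) : n.size ≤ n := Nat.size_le.2 Nat.lt_two_pow_self

lemma HoldsPowers.exec_powerRound
    (hpow : HoldsPowers M A (s * H.ncard * n : ℕ) (min i n.size)) (hM : Loaded M W H t r s)
    (hA : Holds M 31 A) (hcounter : M 25 0 = n / 2 ^ i) :
    HoldsPowers (powerRound.exec M) A (s * H.ncard * n : ℕ) (min (i + 1) n.size) ∧
      powerRound.exec M 25 0 = n / 2 ^ (i + 1) := by
  have hnext : n / 2 ^ (i + 1) = n / 2 ^ i / 2 := by rw [Nat.div_div_eq_div_mul, pow_succ]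
  by_cases hsize : n.size ≤ i
  · have hzero : M 25 0 = 0 := by rwa [hcounter, div_two_pow_eq_zero_iff]
    rw [powerRound, Code.exec, if_pos (show (cell 25).eval M = 0 from hzero),
      exec_assign_cell hM.toReduced]
    rw [min_eq_right hsize] at hpow
    rw [min_eq_right (by omega), Expr.eval, Expr.eval, hzero, Nat.zero_mod, hnext, ← hcounter,
      hzero]
    exact ⟨hpow.congr (exec_of_notMem (by simp [banks]) M) (exec_of_notMem (by simp [banks]) M),
      rfl⟩
  · have hne : M 25 0 ≠ 0 := by rwa [hcounter, ne_eq, div_two_pow_eq_zero_iff]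
    rw [powerRound, Code.exec, if_neg (show (cell 25).eval M ≠ 0 from hne),
      hM.exec_powerStep_counter, hnext, hcounter]
    rw [min_eq_left (by omega)] at hpow
    rw [min_eq_left (by omega)]
    exact ⟨hpow.exec_powerStep hM hA, rfl⟩

lemma holdsPowers_exec_loop_powerRound (hM : Loaded M W H t r s) (hA : Holds M 31 A)
    (hpow : HoldsPowers M A (s * H.ncard * n : ℕ) 0) (hcounter : M 25 0 = n) :
    HoldsPowers ((loop 15 powerRound).exec M) A (s * H.ncard * n : ℕ) n.size := by
  have hbanks : (loop 15 powerRound).banks =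
    [15, 11, 12, 27, 13, 27, 33, 11, 12, 32, 23, 25, 25] := rfl
  have hinv := exec_loop_induction hM.toReduced (v := 15) (p := powerRound)
    (by rw [hbanks]; decide) (by rw [hbanks]; decide)
    (fun i M' => HoldsPowers M' A (s * H.ncard * n : ℕ) (min i n.size) ∧ M' 25 0 = n / 2 ^ i)
    (fun i M' x hM' => ⟨hM'.1.congr (setCell_of_ne (by decide) _ _) (setCell_of_ne (by decide) _ _),
      by rw [setCell_of_ne (by decide)]; exact hM'.2⟩)
    ⟨by rwa [Nat.zero_min], by rw [pow_zero, Nat.div_one, hcounter]⟩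
    (fun i _ M' hred hagree _ hM' => by
      rw [hbanks] at hagree
      exact hM'.1.exec_powerRound (hM.of_agreeOff hred hagree (by decide))
        (fun j k => by rw [hagree 31 (by decide)]; exact hA j k) hM'.2)
  rw [min_eq_right (size_le_self n)] at hinv
  exact hinv.1

lemma holds_exec_fillCode_one (hM : Reduced M n W) :
    Holds ((fillCode 32 (.sub (.const 1)
      (.add (.sub (cell 11) (cell 12)) (.sub (cell 12) (cell 11))))).exec M) 32
      (1 : Matrix (Fin n) (Fin n) (ZMod W)) := by
  refine holds_exec_fillCode hM (by decide) _ _ fun j k M' _ _ hj hk => ?_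
  simp only [Expr.eval, hj, hk, Matrix.one_apply, Fin.ext_iff]
  split_ifs with hjk
  · simp [hjk]
  · rw [show 1 - ((j : ℕ) - k + (k - j)) = 0 by omega, Nat.cast_zero]

lemma Loaded.holdsPowers_exec_powerCode (hM : Loaded M W H t r s) (hA : Holds M 31 A) :
    HoldsPowers (powerCode.exec M) A (s * H.ncard * n : ℕ) n.size := by
  have hone := holds_exec_fillCode_one hM.toReduced
  set M₁ := (fillCode 32 _).exec M
  set M₂ := (assign 23 (.const 0) (.const 1)).exec M₁
  set M₃ := (assign 25 (.const 0) (cell 0)).exec M₂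
  have hM₁ : Loaded M₁ W H t r s := hM.exec (by simp)
  have hM₂ : Loaded M₂ W H t r s := hM₁.exec (by simp [banks])
  have hagree₁ : AgreeOff [11, 12, 32] M₁ M := exec_agreeOff (fillCode 32 _) M
  have hagree₂ : AgreeOff [23] M₂ M₁ := exec_agreeOff (assign 23 (.const 0) (.const 1)) M₁
  have hagree₃ : AgreeOff [25] M₃ M₂ := exec_agreeOff (assign 25 (.const 0) (cell 0)) M₂
  change HoldsPowers ((loop 15 powerRound).exec M₃) A _ _
  refine holdsPowers_exec_loop_powerRound (hM₂.exec (by simp [banks])) (fun j k => ?_)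
    ⟨fun j k => ?_, ?_⟩ ?_
  · rw [hagree₃ 31 (by decide), hagree₂ 31 (by decide), hagree₁ 31 (by decide)]
    exact hA j k
  · rw [hagree₃ 32 (by decide), hagree₂ 32 (by decide), pow_zero]
    exact hone j k
  · rw [hagree₃ 23 (by decide), cast_exec_assign_cell hM₁.toReduced]
    simp [Expr.eval]
  · refine (exec_assign_cell hM₂.toReduced 25 (cell 0)).trans ?_
    rw [Expr.eval, Expr.eval, hM₂.size_eq]
    exact Nat.mod_eq_of_lt hM.size_lt

/-- Store the sum of the squared entries of the matrix in bank `32` in bank `24`. -/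
def frobeniusCode : Code :=
  seq (assign 24 (.const 0) (.const 0)) (loop 11 (loop 12 (assign 24 (.const 0)
    (.add (cell 24) (.mul (.read 32 (entryIndex (cell 11) (cell 12)))
      (.read 32 (entryIndex (cell 11) (cell 12))))))))

@[simp]
lemma banks_frobeniusCode : frobeniusCode.banks = [24, 11, 12, 24] := rfl

lemma cast_exec_frobeniusCode (hM : Reduced M n W) (hA : Holds M 32 A) :
    ((frobeniusCode.exec M 24 0 : ℕ) : ZMod W) = ∑ j, ∑ k, A j k ^ 2 := by
  set M₁ := (assign 24 (.const 0) (.const 0)).exec M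
  have hred₁ : Reduced M₁ n W := hM.exec (by simp [banks]) (by simp [banks])
  have hagree₁ : AgreeOff [24] M₁ M := exec_agreeOff (assign 24 (.const 0) (.const 0)) M
  rw [frobeniusCode, exec, exec_loop_add hred₁ (by simp [banks]) (by simp [banks]) (by decide)
    fun j => ∑ k, A j k ^ 2, cast_exec_assign_cell hM, Expr.eval, Nat.cast_zero, zero_add]
  intro j M' hred hagree hj
  refine exec_loop_add hred (by simp [banks]) (by simp [banks]) (by decide) _
    fun k M'' hred' hagree' hk => ?_
  rw [cast_exec_assign_cell hred', Expr.eval, Nat.cast_add]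
  simp only [Expr.eval, eval_entryIndex hred'.size_eq, hk, hagree' 11 (by simp [banks]), hj,
    hagree' 32 (by simp [banks]), hagree 32 (by simp [banks]), hagree₁ 32 (by simp)]
  rw [Nat.cast_mul, hA j k, sq]

end MomentPrograms

/-! ### Bounds for the numbers computed -/

section Bounds

variable {ι R : Type*} [Fintype ι] [DecidableEq ι] [CommRing R] [LinearOrder R]
  [IsStrictOrderedRing R]

omit [DecidableEq ι] in
lemma abs_matrix_mul_apply_le {A B : Matrix ι ι R} {x y : R} (hx : 0 ≤ x)
    (hA : ∀ i j, |A i j| ≤ x) (hB : ∀ i j, |B i j| ≤ y) (i j : ι) :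
    |(A * B) i j| ≤ Fintype.card ι * (x * y) := by
  calc |(A * B) i j| ≤ ∑ k, |A i k * B k j| := Finset.abs_sum_le_sum_abs _ _
    _ ≤ ∑ _k : ι, x * y := Finset.sum_le_sum fun k _ => by
        rw [abs_mul]
        exact mul_le_mul (hA i k) (hB k j) (abs_nonneg _) hx
    _ = Fintype.card ι * (x * y) := by simp

lemma abs_matrix_pow_apply_le {A : Matrix ι ι R} {x : R} (hx : 0 ≤ x)
    (hA : ∀ i j, |A i j| ≤ x) (k : ℕ) (i j : ι) :
    |(A ^ k) i j| ≤ (Fintype.card ι * x) ^ k := by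
  induction k generalizing i j with
  | zero =>
    rw [pow_zero, pow_zero, Matrix.one_apply]
    split_ifs <;> simp
  | succ k ih =>
    rw [pow_succ]
    refine (abs_matrix_mul_apply_le (by positivity) ih hA i j).trans_eq ?_
    ring

lemma gramMoment_le_of_abs_le {A : Matrix ι ι R} {x : R} (hx : 0 ≤ x)
    (hA : ∀ i j, |A i j| ≤ x) (k : ℕ) :
    gramMoment A k ≤ Fintype.card ι ^ 2 * ((Fintype.card ι * x) ^ 2) ^ (2 * k) := by
  have hgram := abs_matrix_mul_apply_le (B := A.transpose) hx hA fun i j => hA j i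
  calc gramMoment A k ≤ ∑ _i : ι, ∑ _j : ι, ((Fintype.card ι * x) ^ 2) ^ (2 * k) := by
        refine Finset.sum_le_sum fun i _ => Finset.sum_le_sum fun j _ => ?_
        rw [← sq_abs, pow_mul', mul_pow, sq (x : R), sq (Fintype.card ι : R), mul_assoc]
        gcongr
        exact abs_matrix_pow_apply_le (by positivity) hgram k i j
    _ = Fintype.card ι ^ 2 * ((Fintype.card ι * x) ^ 2) ^ (2 * k) := by
        simp [sq, mul_assoc]

variable {n s : ℕ} {H : Hypergraph3 n}

lemma edge_le_one (H : Hypergraph3 n) (U : Fin 3 → Fin n) : edge H U ≤ 1 := by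
  unfold edge
  split_ifs <;> simp

lemma ncard_le_pow_three (H : Hypergraph3 n) : H.ncard ≤ n ^ 3 := by
  rw [← sum_edge]
  exact (Finset.sum_le_sum fun U _ => edge_le_one H U).trans_eq (by simp)

lemma degree_le_sq (H : Hypergraph3 n) (c : Fin 3) (v : Fin n) : degree H c v ≤ n ^ 2 :=
  (Finset.sum_le_sum fun _ _ => Finset.sum_le_sum fun _ _ => edge_le_one H _).trans_eq
    (by simp [sq])

lemma windowCount_le (H : Hypergraph3 n) (c : Fin 3) (s : ℕ) (a j k : Fin n) :
    windowCount H c s a j k ≤ s :=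
  (Finset.sum_le_sum fun _ _ => edge_le_one H _).trans_eq (by simp)

lemma abs_centeredMatrix_le (hs : s ≤ n) (c : Fin 3) (a j k : Fin n) :
    |centeredMatrix H c s a j k| ≤ 100 * (n : ℤ) ^ 4 := by
  have hcount : n ^ 3 * windowCount H c s a j k ≤ n ^ 4 := by
    rw [pow_succ n 3]
    gcongr
    exact (windowCount_le H c s a j k).trans hs
  have hmean : s * H.ncard ≤ n ^ 4 := by
    rw [pow_succ' n 3]
    gcongr
    exact ncard_le_pow_three H
  rw [centeredMatrix, Matrix.of_apply, abs_mul, abs_of_pos (by norm_num : (0 : ℤ) < 100)]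
  zify at hcount hmean
  gcongr
  exact abs_sub_le_of_nonneg_of_le (by positivity) hcount (by positivity) hmean

/-- The modulus of the arithmetic of the programs: it exceeds all the numbers that they compare. -/
def modulus (n : ℕ) : ℕ := 2 ^ (50 * n ^ 2 + 1)

lemma gramMoment_centeredMatrix_lt_modulus (hs : s ≤ n) (c : Fin 3) (a : Fin n) :
    gramMoment (centeredMatrix H c s a) n.size < modulus n := by
  have hsize_pos : 0 < n.size := Nat.size_pos.2 (Fin.pos a)
  have hn : (n : ℤ) ≤ 2 ^ n.size := by exact_mod_cast (Nat.lt_size_self n).le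
  have hentry : ((n : ℤ) * (100 * n ^ 4)) ^ 2 ≤ 2 ^ (14 + 10 * n.size) :=
    calc ((n : ℤ) * (100 * n ^ 4)) ^ 2 = 10000 * (n : ℤ) ^ 10 := by ring
      _ ≤ 2 ^ 14 * (2 ^ n.size) ^ 10 := by
          gcongr
          norm_num
      _ = 2 ^ (14 + 10 * n.size) := by rw [pow_add, mul_comm 10, pow_mul]
  calc gramMoment (centeredMatrix H c s a) n.size
      ≤ (n : ℤ) ^ 2 * ((n * (100 * n ^ 4)) ^ 2) ^ (2 * n.size) := by
        simpa using gramMoment_le_of_abs_le (by positivity) (abs_centeredMatrix_le hs c a) n.size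
    _ ≤ (2 ^ n.size) ^ 2 * (2 ^ (14 + 10 * n.size)) ^ (2 * n.size) := by gcongr
    _ = 2 ^ (n.size * 2 + (14 + 10 * n.size) * (2 * n.size)) := by
        rw [← pow_mul, ← pow_mul, ← pow_add]
    _ < modulus n := by
        rw [modulus, Nat.cast_pow]
        refine pow_lt_pow_right₀ (by norm_num) ?_
        nlinarith [size_le_self n]

lemma length_mul_pow_lt_modulus (hn : 0 < n) (hs : s ≤ n) :
    (s * H.ncard * n) ^ (4 * n.size) < modulus n := by
  have : 0 < n.size := Nat.size_pos.2 hn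
  calc (s * H.ncard * n) ^ (4 * n.size) ≤ (n * n ^ 3 * n) ^ (4 * n.size) := by
        gcongr
        exact ncard_le_pow_three H
    _ = (n ^ 5) ^ (4 * n.size) := by ring_nf
    _ ≤ ((2 ^ n.size) ^ 5) ^ (4 * n.size) := by
        gcongr
        exact (Nat.lt_size_self n).le
    _ = 2 ^ (n.size * 5 * (4 * n.size)) := by rw [← pow_mul, ← pow_mul, mul_assoc]
    _ < modulus n :=
        Nat.pow_lt_pow_right (by norm_num) (by nlinarith [size_le_self n])

lemma pow_three_lt_modulus (n : ℕ) : n ^ 3 < modulus n :=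
  calc n ^ 3 ≤ (2 ^ n) ^ 3 := by
        gcongr
        exact Nat.lt_two_pow_self.le
    _ = 2 ^ (n * 3) := by rw [← pow_mul]
    _ < modulus n := Nat.pow_lt_pow_right (by norm_num) (by nlinarith)

end Bounds

/-! ### The tests of window regularity -/

section RegularityTests

open RAM Code

variable {n W a : ℕ} {M : Memory} {H : Hypergraph3 n} {t r s : ℕ}

/-- Store the moment of the centered window matrix in bank `24` and the bound for it in
bank `23`. -/
def gramMomentCode (c : Fin 3) : Code :=
  seq (windowCode c) (seq (mulCode 31 30 (.read 30 (entryIndex (cell 12) (cell 13))))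
    (seq powerCode frobeniusCode))

@[simp]
lemma banks_gramMomentCode (c : Fin 3) : (gramMomentCode c).banks =
    [11, 12, 27, 13, 27, 30, 11, 12, 27, 13, 27, 31, 11, 12, 32, 23, 25, 15, 11, 12, 27, 13, 27, 33,
      11, 12, 32, 23, 25, 25, 24, 11, 12, 24] := rfl

lemma Loaded.cast_exec_gramMomentCode (hM : Loaded M W H t r s) (hs : s ≤ n) (c : Fin 3)
    {a : Fin n} (ha : M 14 0 = a) :
    (((gramMomentCode c).exec M 24 0 : ℕ) : ZMod W) =
        (gramMoment (centeredMatrix H c s a) n.size : ℤ) ∧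
      (((gramMomentCode c).exec M 23 0 : ℕ) : ZMod W) =
        ((s * H.ncard * n) ^ (4 * n.size) : ℕ) := by
  have hwindow := hM.holds_exec_windowCode hs c ha
  have hM₁ : Loaded ((windowCode c).exec M) W H t r s := hM.exec (by simp)
  have hgram := holds_exec_mulCode_transpose hM₁.toReduced (d := 31) (by decide) (by decide)
    (by decide) hwindow hwindow
  have hM₂ := hM₁.exec (p := mulCode 31 30 (.read 30 (entryIndex (cell 12) (cell 13)))) (by simp)
  have hpowers := hM₂.holdsPowers_exec_powerCode hgram
  have hM₃ := hM₂.exec (p := powerCode) (by simp)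
  refine ⟨(cast_exec_frobeniusCode hM₃.toReduced hpowers.matrix).trans ?_, ?_⟩
  · exact (map_gramMoment (Int.castRingHom (ZMod W)) _ _).symm
  · rw [gramMomentCode, Code.exec, Code.exec, Code.exec, exec_of_notMem (by simp), hpowers.scalar,
      Nat.cast_pow]

/-- Test the moment condition for the window that starts at the counter in bank `14`. -/
def momentCode (c : Fin 3) : Code :=
  seq (gramMomentCode c) (flagCode (.sub (cell 24) (cell 23)))

@[simp]
lemma banks_momentCode (c : Fin 3) :
    (momentCode c).banks = (gramMomentCode c).banks ++ [22] := rfl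

lemma Loaded.exec_momentCode_eq_zero_iff (hM : Loaded M (modulus n) H t r s) (hs : s ≤ n)
    (c : Fin 3) {a : Fin n} (ha : M 14 0 = a) :
    (momentCode c).exec M 22 0 = 0 ↔ M 22 0 = 0 ∧
      gramMoment (centeredMatrix H c s a) n.size ≤
        ((s * H.ncard * n : ℕ) : ℤ) ^ (4 * n.size) := by
  have hn : 0 < n := Fin.pos a
  have hM' : Loaded ((gramMomentCode c).exec M) (modulus n) H t r s := hM.exec (by simp)
  obtain ⟨hmoment, hbound⟩ := hM.cast_exec_gramMomentCode hs c ha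
  have hlt := gramMoment_centeredMatrix_lt_modulus (H := H) hs c a
  lift gramMoment (centeredMatrix H c s a) n.size to ℕ using
    Finset.sum_nonneg fun _ _ => Finset.sum_nonneg fun _ _ => sq_nonneg _ with moment
  have h24 : (gramMomentCode c).exec M 24 0 = moment :=
    eq_of_cast_eq (hM'.cell_lt 24 (by decide) (by decide) 0) (by exact_mod_cast hlt)
      (by rw [hmoment, Int.cast_natCast])
  have h23 : (gramMomentCode c).exec M 23 0 = (s * H.ncard * n) ^ (4 * n.size) :=
    eq_of_cast_eq (hM'.cell_lt 23 (by decide) (by decide) 0) (length_mul_pow_lt_modulus hn hs)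
      hbound
  rw [momentCode, Code.exec, exec_flagCode_eq_zero_iff hM'.toReduced hn, exec_of_notMem (by simp)]
  simp only [Expr.eval, h24, h23]
  rw [Nat.sub_eq_zero_iff_le]
  norm_cast

/-- Add the degree of the vertex that is the counter in bank `10` to bank `a`. -/
def addDegreeCode (a : ℕ) (c : Fin 3) : Code :=
  loop 11 (loop 12 (assign a (.const 0)
    (.add (cell a) (adjacency c (cell 10) (cell 11) (cell 12)))))

@[simp]
lemma banks_addDegreeCode (a : ℕ) (c : Fin 3) : (addDegreeCode a c).banks = [11, 12, a] := rfl

lemma cast_exec_addDegreeCode (hM : Reduced M n W) (htensor : M 1 = inputMemory n H t r 1)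
    (ha : a ∉ [0, 1, 3, 10, 11, 12]) (c : Fin 3) {v : Fin n} (hv : M 10 0 = v) :
    (((addDegreeCode a c).exec M a 0 : ℕ) : ZMod W) = (M a 0 : ℕ) + (degree H c v : ℕ) := by
  simp only [List.mem_cons, List.not_mem_nil, or_false, not_or, ← ne_eq] at ha
  obtain ⟨ha0, ha1, ha3, ha10, ha11, ha12⟩ := ha
  rw [degree, Nat.cast_sum]
  simp only [Nat.cast_sum]
  refine exec_loop_add hM (by simp [banks, ha0.symm]) (by simp [banks, ha3.symm]) ha11 _
    fun j M' hred hagree hj => ?_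
  refine exec_loop_add hred (by simp [banks, ha0.symm]) (by simp [banks, ha3.symm]) ha12 _
    fun k M'' hred' hagree' hk => ?_
  have hagree'' : AgreeOff [11, 12, a] M'' M := hagree'.trans hagree (by simp [banks])
  rw [cast_exec_assign_cell hred', Expr.eval, Nat.cast_add,
    eval_adjacency hred'.size_eq (by rw [hagree'' 1 (by simp [ha1.symm]), htensor]) c
      (x := cell 10) (y := cell 11) (z := cell 12) (i := v) (j := j) ?_ ?_ hk]
  · rfl
  · exact (congrFun (hagree'' 10 (by simp [ha10.symm])) 0).trans hv
  · exact (congrFun (hagree' 11 (by simp [banks, ha11.symm])) 0).trans hj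

/-- Test the degree of the vertex that is the counter in bank `10`. -/
def degreeCode (c : Fin 3) : Code :=
  seq (assign 26 (.const 0) (.const 0)) (seq (addDegreeCode 26 c)
    (flagCode (.sub (.mul (.const 99) (cell 20)) (.mul (.mul (.const 100) (cell 0)) (cell 26)))))

lemma Loaded.exec_degreeCode_eq_zero_iff (hM : Loaded M (modulus n) H t r s) (c : Fin 3)
    {v : Fin n} (hv : M 10 0 = v) :
    (degreeCode c).exec M 22 0 = 0 ↔ M 22 0 = 0 ∧ 99 * H.ncard ≤ 100 * n * degree H c v := by
  have hn : 0 < n := Fin.pos v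
  set M₁ := (assign 26 (.const 0) (.const 0)).exec M with hM₁_eq
  set M₂ := (addDegreeCode 26 c).exec M₁ with hM₂_eq
  have hM₁ : Loaded M₁ (modulus n) H t r s := hM.exec (by simp [banks])
  have hM₂ : Loaded M₂ (modulus n) H t r s := hM₁.exec (by simp)
  have hagree₁ : AgreeOff [26] M₁ M := exec_agreeOff (assign 26 (.const 0) (.const 0)) M
  have hagree₂ : AgreeOff [11, 12, 26] M₂ M₁ := exec_agreeOff (addDegreeCode 26 c) M₁
  have hdegree : M₂ 26 0 = degree H c v := by
    refine eq_of_cast_eq (hM₂.cell_lt 26 (by decide) (by decide) 0) ?_ ?_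
    · exact (degree_le_sq H c v).trans_lt
        ((Nat.pow_le_pow_right hn (by norm_num)).trans_lt (pow_three_lt_modulus n))
    · rw [hM₂_eq, cast_exec_addDegreeCode hM₁.toReduced hM₁.tensor_eq (by decide) c
        (by rw [hagree₁ 10 (by decide), hv]), hM₁_eq, cast_exec_assign_cell hM.toReduced,
        Expr.eval, Nat.cast_zero, zero_add]
  change (flagCode _).exec M₂ 22 0 = 0 ↔ _
  rw [exec_flagCode_eq_zero_iff hM₂.toReduced hn, hagree₂ 22 (by decide), hagree₁ 22 (by decide)]
  simp only [Expr.eval, hdegree, hM₂.count_eq, hM₂.size_eq]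
  rw [Nat.sub_eq_zero_iff_le]

/-- All the tests for the position `c`. -/
def positionCode (c : Fin 3) : Code :=
  seq (loop 10 (degreeCode c)) (loop 14 (momentCode c))

lemma banks_loop_degreeCode (c : Fin 3) :
    (loop 10 (degreeCode c)).banks = [10, 26, 11, 12, 26, 22] := rfl

lemma banks_loop_momentCode (c : Fin 3) :
    (loop 14 (momentCode c)).banks = 14 :: (momentCode c).banks := rfl

@[simp]
lemma banks_positionCode (c : Fin 3) : (positionCode c).banks =
    [10, 26, 11, 12, 26, 22] ++ 14 :: (momentCode c).banks := rfl

lemma isWindowRegularAt_iff {c : Fin 3} : IsWindowRegularAt H c s ↔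
    (∀ v, 99 * H.ncard ≤ 100 * n * degree H c v) ∧
      ∀ a, gramMoment (centeredMatrix H c s a) n.size ≤
        ((s * H.ncard * n : ℕ) : ℤ) ^ (4 * n.size) :=
  ⟨fun h => ⟨h.degree_ge, h.moment_le⟩, fun h => ⟨h.1, h.2⟩⟩

lemma Loaded.exec_positionCode_eq_zero_iff (hM : Loaded M (modulus n) H t r s) (hs : s ≤ n)
    (c : Fin 3) :
    (positionCode c).exec M 22 0 = 0 ↔ M 22 0 = 0 ∧ IsWindowRegularAt H c s := by
  have hM₁ : Loaded ((loop 10 (degreeCode c)).exec M) (modulus n) H t r s :=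
    hM.exec (by simp [banks_loop_degreeCode])
  rw [positionCode, Code.exec, isWindowRegularAt_iff, ← and_assoc,
    exec_loop_flag hM₁.toReduced (by simp [banks_loop_momentCode])
      (by simp [banks_loop_momentCode]) (by decide) _ fun a M' hred hagree ha =>
        (hM₁.of_agreeOff hred hagree (by simp [banks_loop_momentCode])).exec_momentCode_eq_zero_iff
          hs c ha,
    exec_loop_flag hM.toReduced (by simp [banks_loop_degreeCode])
      (by simp [banks_loop_degreeCode]) (by decide) _ fun v M' hred hagree hv =>
        (hM.of_agreeOff hred hagree (by simp [banks_loop_degreeCode])).exec_degreeCode_eq_zero_iff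
          c hv]

/-- Store the number of hyperedges in bank `20`. -/
def countCode : Code :=
  seq (assign 20 (.const 0) (.const 0)) (loop 10 (addDegreeCode 20 0))

@[simp]
lemma banks_countCode : countCode.banks = [20, 10, 11, 12, 20] := rfl

lemma exec_countCode (hM : Reduced M n (modulus n)) (htensor : M 1 = inputMemory n H t r 1) :
    countCode.exec M 20 0 = H.ncard := by
  have hcount : Reduced (countCode.exec M) n (modulus n) := hM.exec (by simp) (by simp)
  have hinit : Reduced ((assign 20 (.const 0) (.const 0)).exec M) n (modulus n) :=
    hM.exec (by simp [banks]) (by simp [banks])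
  refine eq_of_cast_eq (hcount.cell_lt 20 (by decide) (by decide) 0)
    ((ncard_le_pow_three H).trans_lt (pow_three_lt_modulus n)) ?_
  rw [countCode, exec, exec_loop_add hinit (by simp [banks]) (by simp [banks]) (by decide)
    fun v => ((degree H 0 v : ℕ) : ZMod (modulus n)), cast_exec_assign_cell hM, Expr.eval,
    Nat.cast_zero, zero_add, ← Nat.cast_sum, sum_degree]
  intro v M' hred hagree hv
  refine cast_exec_addDegreeCode (t := t) (r := r) hred ?_ (by decide) 0 hv
  rw [hagree 1 (by simp [banks]), exec_of_notMem (by simp [banks]), htensor]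

end RegularityTests

section Output

open RAM Code

variable {n W : ℕ} {M : Memory} {H : Hypergraph3 n} {t r s : ℕ}

/-- Store `2 ^ n` in bank `2`. -/
def trivialCode : Code :=
  seq (assign 2 (.const 0) (.const 1)) (loop 10 (assign 2 (.const 0) (.mul (.const 2) (cell 2))))

lemma exec_trivialCode (hM : Reduced M n W) (hW : 2 ^ n < W) :
    trivialCode.exec M 2 0 = 2 ^ n := by
  have hinit : Reduced ((assign 2 (.const 0) (.const 1)).exec M) n W :=
    hM.exec (by simp [banks]) (by simp [banks])
  rw [trivialCode, exec]
  refine exec_loop_induction hinit (by simp [banks]) (by simp [banks])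
    (fun i M' => M' 2 0 = 2 ^ i)
    (fun i M' x hM' => by rw [setCell_of_ne (by decide)]; exact hM') ?_
    fun i hi M' hred _ _ hpow => ?_
  · rw [exec_assign_cell hM, Expr.eval, Nat.mod_eq_of_lt (Nat.one_le_two_pow.trans_lt hW), pow_zero]
  · rw [exec_assign_cell hred]
    simp only [Expr.eval, hpow]
    rw [← pow_succ', Nat.mod_eq_of_lt ((Nat.pow_le_pow_right two_pos hi).trans_lt hW)]

/-- Store `n * 2 ^ s` in bank `2`. -/
def sparseCode : Code :=
  seq (assign 2 (.const 0) (cell 0)) (loop 10 (assign 2 (.const 0) (.add (cell 2)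
    (.mul (cell 2) (.sub (.const 1) (.sub (.const 1) (.sub (cell 21) (cell 10))))))))

-- The factor `1 - (1 - (s - i))` is the indicator of `i < s`: only the first `s` rounds double.
lemma mul_two_pow_min_succ (n i s : ℕ) :
    n * 2 ^ min i s + n * 2 ^ min i s * (1 - (1 - (s - i))) = n * 2 ^ min (i + 1) s := by
  rcases lt_or_ge i s with his | hsi
  · rw [show 1 - (1 - (s - i)) = 1 by omega, min_eq_left his.le, min_eq_left his]
    ring
  · rw [show 1 - (1 - (s - i)) = 0 by omega, min_eq_right hsi, min_eq_right (by omega), mul_zero,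
      add_zero]

lemma Loaded.exec_sparseCode (hM : Loaded M W H t r s) (hs : s ≤ n) (hW : n * 2 ^ n < W) :
    sparseCode.exec M 2 0 = n * 2 ^ s := by
  have hinit : Loaded ((assign 2 (.const 0) (cell 0)).exec M) W H t r s :=
    hM.exec (by simp [banks])
  have hloop := exec_loop_induction hinit.toReduced (v := 10) (p := assign 2 (.const 0) (.add
    (cell 2) (.mul (cell 2) (.sub (.const 1) (.sub (.const 1) (.sub (cell 21) (cell 10)))))))
    (by simp [banks]) (by simp [banks])
    (fun i M' => M' 2 0 = n * 2 ^ min i s)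
    (fun i M' x hM' => by rw [setCell_of_ne (by decide)]; exact hM') ?_
    fun i _ M' hred hagree hi hpow => ?_
  · rwa [min_eq_right hs] at hloop
  · rw [exec_assign_cell hM.toReduced, Nat.zero_min, pow_zero, mul_one]
    exact (congrArg (· % W) hM.size_eq).trans (Nat.mod_eq_of_lt hM.size_lt)
  · have hlength : M' 21 0 = s := by rw [hagree 21 (by simp [banks]), hinit.length_eq]
    have hlt : n * 2 ^ min (i + 1) s < W := (Nat.mul_le_mul_left _
      (Nat.pow_le_pow_right two_pos ((min_le_right _ _).trans hs))).trans_lt hW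
    rw [exec_assign_cell hred]
    simp only [Expr.eval, hpow, hlength, hi]
    rw [mul_two_pow_min_succ, Nat.mod_eq_of_lt hlt]

/-- Store the number of hyperedges and the value of `σ`, the window length, and reset the flag. -/
def prepareCode (σ : Expr) : Code :=
  seq countCode (seq (assign 21 (.const 0) σ) (assign 22 (.const 0) (.const 0)))

@[simp]
lemma banks_prepareCode (σ : Expr) :
    (prepareCode σ).banks = [20, 10, 11, 12, 20, 21, 22] := rfl

lemma loaded_exec_prepareCode (hM : Reduced M n (modulus n))
    (htensor : M 1 = inputMemory n H t r 1) (hs : s ≤ n) {σ : Expr}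
    (hσ : ∀ M' : Memory, M' 0 = M 0 → σ.eval M' = s) :
    Loaded ((prepareCode σ).exec M) (modulus n) H t r s := by
  have hcount : Reduced (countCode.exec M) n (modulus n) := hM.exec (by simp) (by simp)
  refine ⟨hM.exec (by simp) (by simp), by rw [exec_of_notMem (by simp), htensor], ?_, ?_⟩
  · rw [prepareCode, exec, exec_of_notMem (by simp [banks]), exec_countCode hM htensor]
  · rw [prepareCode, exec, exec, exec_of_notMem (by simp [banks]), exec_assign_cell hcount,
      hσ _ (exec_of_notMem (by simp) M), Nat.mod_eq_of_lt (hs.trans_lt hM.size_lt)]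

lemma exec_prepareCode_flag (σ : Expr) (M : Memory) : (prepareCode σ).exec M 22 0 = 0 := by
  simp [prepareCode, exec, Expr.eval, setCell_same]

/-- The tests for all three positions. -/
def testCode : Code := seq (positionCode 0) (seq (positionCode 1) (positionCode 2))

@[simp]
lemma banks_testCode : testCode.banks =
    (positionCode 0).banks ++ ((positionCode 1).banks ++ (positionCode 2).banks) := rfl

lemma Loaded.exec_testCode_eq_zero_iff (hM : Loaded M (modulus n) H t r s) (hs : s ≤ n) :
    testCode.exec M 22 0 = 0 ↔ M 22 0 = 0 ∧ ∀ c, IsWindowRegularAt H c s := by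
  have hM₁ := hM.exec (p := positionCode 0) (by simp)
  have hM₂ := hM₁.exec (p := positionCode 1) (by simp)
  rw [testCode, Code.exec, Code.exec, hM₂.exec_positionCode_eq_zero_iff hs,
    hM₁.exec_positionCode_eq_zero_iff hs, hM.exec_positionCode_eq_zero_iff hs, and_assoc, and_assoc]
  simp [Fin.forall_fin_succ]

/-- An expression that vanishes exactly when the hypergraph has passed all tests and the input
numbers are in the range that the certificate covers. -/
def failure : Expr :=
  .add (cell 22) (.add (.sub (.const 1) (cell 21)) (.add (.sub (.const 1) (cell 20))
    (.add (.sub (.mul (.const 1000) (.read 0 (.const 1))) (cell 20))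
      (.sub (.add (.const 1) (.mul (.read 0 (.const 1)) (cell 0)))
        (.mul (.add (.read 0 (.const 2)) (.const 1)) (cell 20))))))

lemma Loaded.eval_failure_eq_zero_iff (hM : Loaded M W H t r s)
    (hinput : M 0 = inputMemory n H t r 0)
    (hflag : M 22 0 = 0 ↔ ∀ c, IsWindowRegularAt H c s) :
    failure.eval M = 0 ↔
      IsWindowRegular H s ∧ 1000 * t ≤ H.ncard ∧ t * n < (r + 1) * H.ncard := by
  have ht : M 0 1 = t := congrFun hinput 1
  have hr : M 0 2 = r := congrFun hinput 2
  have hregular : IsWindowRegular H s ↔ 0 < s ∧ 0 < H.ncard ∧ M 22 0 = 0 := by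
    rw [hflag]
    exact ⟨fun h => ⟨h.window_pos, h.ncard_pos, h.regularAt⟩, fun h => ⟨h.1, h.2.1, h.2.2⟩⟩
  rw [hregular]
  simp only [failure, Expr.eval, hM.size_eq, ht, hr, hM.count_eq, hM.length_eq]
  omega

/-- The certification program for the window length `σ`, with output computed by `out`. -/
def certifyCode (σ : Expr) (out : Code) : Code :=
  seq (prepareCode σ) (seq testCode (ite failure trivialCode out))

lemma isWindowRegular_congr {s' : ℕ} (h : 0 < n → s = s') :
    IsWindowRegular H s ↔ IsWindowRegular H s' :=
  ⟨fun hH => h hH.pos ▸ hH, fun hH => (h hH.pos).symm ▸ hH⟩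

lemma exec_certifyCode (hM : Reduced M n (modulus n)) (hinput : M 0 = inputMemory n H t r 0)
    (htensor : M 1 = inputMemory n H t r 1) (hs : s ≤ n) {σ N : ℕ → ℕ → ℕ}
    (hσ : 0 < n → s = σ n r) {length : Expr} {out : Code}
    (hlength : ∀ M' : Memory, M' 0 = M 0 → length.eval M' = s)
    (hout : ∀ M' : Memory, Loaded M' (modulus n) H t r s → out.exec M' 2 0 = N n s) :
    (certifyCode length out).exec M 2 0 = windowCertifier σ N n H t r := by
  set M₁ := (prepareCode length).exec M with hM₁_eq
  set M₂ := testCode.exec M₁ with hM₂_eq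
  have hM₁ : Loaded M₁ (modulus n) H t r s := loaded_exec_prepareCode hM htensor hs hlength
  have hM₂ : Loaded M₂ (modulus n) H t r s := hM₁.exec (by simp)
  have hinput₂ : M₂ 0 = inputMemory n H t r 0 := by
    rw [hM₂_eq, exec_of_notMem (by simp), hM₁_eq, exec_of_notMem (by simp), hinput]
  have hflag : M₂ 22 0 = 0 ↔ ∀ c, IsWindowRegularAt H c s := by
    rw [hM₂_eq, hM₁.exec_testCode_eq_zero_iff hs, and_iff_right (exec_prepareCode_flag _ M)]
  have hfailure := hM₂.eval_failure_eq_zero_iff hinput₂ hflag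
  change (ite failure trivialCode out).exec M₂ 2 0 = _
  rw [exec, windowCertifier, ← isWindowRegular_congr hσ]
  by_cases hpassed : IsWindowRegular H s ∧ 1000 * t ≤ H.ncard ∧ t * n < (r + 1) * H.ncard
  · rw [if_pos (hfailure.2 hpassed), if_pos hpassed, hout _ hM₂, hσ hpassed.1.pos]
  · rw [if_neg (mt hfailure.1 hpassed), if_neg hpassed]
    exact exec_trivialCode hM₂.toReduced
      (Nat.pow_lt_pow_right (by norm_num) (by nlinarith))

end Output

/-! ### Polynomial time -/

section Modulus

open RAM

variable {M : Memory} {d k f b : ℕ} {e : Expr}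

lemma setCell_comm (M : Memory) {a a' : ℕ} (h : a ≠ a') (i x i' x' : ℕ) :
    setCell (setCell M a i x) a' i' x' = setCell (setCell M a' i' x') a i x := by
  unfold setCell
  rw [Function.update_of_ne h.symm, Function.update_of_ne h, Function.update_comm h]

/-- Store `k * e ^ n` in bank `d`, with the counter in bank `5`. -/
def powerLoop (d k : ℕ) (e : Expr) : Prog :=
  .seq (.write d (.const 0) (.const k)) (countingLoop 5 (.write d (.const 0) (.mul (cell d) e)))

/-- The memory after `i` rounds of `powerLoop d k e`, started in `M`, when `e` has value `f`. -/
def powerState (M : Memory) (d k f i : ℕ) : Memory := setCell (setCell M d 0 (k * f ^ i)) 5 0 i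

lemma isLoopTrace_powerState (hd0 : d ≠ 0) (hd5 : d ≠ 5) (hM : Bounded M b) (hb : 1 ≤ b)
    (hn : M 0 0 ≤ b) (hf : 0 < f) (hlt : k * f ^ M 0 0 < 2 ^ b)
    (he : ∀ i, e.eval (powerState M d k f i) = f) :
    IsLoopTrace (.write d (.const 0) (.mul (cell d) e)) 5 (M 0 0) b
      ((costWeight (.const 0) + costWeight (.mul (cell d) e) + weight (.const 0) +
        weight (.mul (cell d) e) + 1) * b) (powerState M d k f) := by
  have hpow (i : ℕ) (hi : i ≤ M 0 0) : k * f ^ i < 2 ^ b :=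
    (Nat.mul_le_mul_left _ (Nat.pow_le_pow_right hf hi)).trans_lt hlt
  have hbounded (i : ℕ) (hi : i ≤ M 0 0) : Bounded (powerState M d k f i) b :=
    (hM.setCell (hpow i hi) d 0).setCell ((hi.trans hn).trans_lt Nat.lt_two_pow_self) 5 0
  have hcounter (i : ℕ) : powerState M d k f i 5 0 = i := by
    rw [powerState, setCell_same, if_pos rfl]
  refine ⟨hb, hbounded, fun i => ?_, hcounter, fun i hi =>
    ⟨setCell (powerState M d k f i) d 0 (k * f ^ (i + 1)), ?_, ?_, ?_, ?_⟩⟩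
  · rw [powerState, setCell_of_ne (by decide), setCell_of_ne hd0.symm]
  · exact (hbounded i hi.le).setCell (hpow (i + 1) hi) d 0
  · rw [setCell_of_ne hd5.symm, hcounter]
  · rw [powerState, setCell_comm _ hd5.symm, setCell_setCell, setCell_setCell, powerState]
  · have hvalue : (Expr.mul (cell d) e).eval (powerState M d k f i) = k * f ^ (i + 1) := by
      rw [Expr.eval, he, Expr.eval, Expr.eval, powerState, setCell_of_ne hd5, setCell_same,
        if_pos rfl, pow_succ, mul_assoc]
    rw [← hvalue]
    exact exists_run_write (hbounded i hi.le) hb d (.const 0) _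

lemma exists_run_powerLoop (hd0 : d ≠ 0) (hd5 : d ≠ 5) (k : ℕ) (e : Expr) :
    ∃ Q : Polynomial ℕ, ∀ (M : Memory) (b f : ℕ), Bounded M b → 1 ≤ b → M 0 0 ≤ b → 0 < f →
      k * f ^ M 0 0 < 2 ^ b → (∀ i, e.eval (powerState M d k f i) = f) →
        ∃ T ≤ Q.eval b, Run (powerLoop d k e) M (powerState M d k f (M 0 0)) T := by
  refine ⟨.C (costWeight (.const 0) + costWeight (.const k) + weight (.const 0) +
      weight (.const k) + 1) * .X + (.X * (.C (costWeight (.const 0) +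
      costWeight (.mul (cell d) e) + weight (.const 0) + weight (.mul (cell d) e) + 1) * .X +
      .C (loopCost 5) * .X) + .C (loopCost 5 + 5) * .X),
    fun M b f hM hb hn hf hlt he => ?_⟩
  have hk : k < 2 ^ b := (Nat.le_mul_of_pos_right k (Nat.pow_pos hf)).trans_lt hlt
  obtain ⟨R, hR, hinit⟩ := exists_run_write hM hb d (.const 0) (.const k)
  have htrace := isLoopTrace_powerState hd0 hd5 hM hb hn hf hlt he
  obtain ⟨T, hT, hloop⟩ := htrace.exists_run_countingLoop (hM.setCell hk d 0)
    (by rw [powerState, pow_zero, mul_one])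
  refine ⟨R + T, (add_le_add hR hT).trans ?_, hinit.seq hloop⟩
  simp only [Polynomial.eval_add, Polynomial.eval_mul, Polynomial.eval_C, Polynomial.eval_X]
  gcongr

/-- Store `modulus n` in bank `3`. -/
def modulusProg : Prog := .seq (powerLoop 4 1 (.const (2 ^ 50))) (powerLoop 3 2 (cell 4))

/-- The memory after the computation of the modulus, which leaves auxiliary values in the banks `4`
and `5`. -/
noncomputable def initialMemory (n : ℕ) (H : Hypergraph3 n) (t r : ℕ) : Memory :=
  setCell (setCell (setCell (inputMemory n H t r) 3 0 (modulus n)) 4 0 (2 ^ (50 * n))) 5 0 n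

variable (n : ℕ) (H : Hypergraph3 n) (t r : ℕ)

lemma powerState_powerState_inputMemory :
    powerState (powerState (inputMemory n H t r) 4 1 (2 ^ 50) n) 3 2 (2 ^ (50 * n)) n =
      initialMemory n H t r := by
  have hmodulus : 2 * (2 ^ (50 * n)) ^ n = modulus n := by
    rw [modulus, ← pow_mul, ← pow_succ']
    ring_nf
  rw [powerState, powerState, hmodulus, setCell_comm _ (show 5 ≠ 3 by decide), setCell_setCell,
    setCell_comm _ (show 4 ≠ 3 by decide), one_mul, ← pow_mul, initialMemory]

lemma exists_run_modulusProg :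
    ∃ Q : Polynomial ℕ, ∀ (n : ℕ) (H : Hypergraph3 n) (t r b : ℕ),
      Bounded (inputMemory n H t r) b → 50 * n ^ 2 + n + 2 ≤ b →
        ∃ T ≤ Q.eval b, Run modulusProg (inputMemory n H t r) (initialMemory n H t r) T := by
  obtain ⟨Q₁, hQ₁⟩ := exists_run_powerLoop (d := 4) (by decide) (by decide) 1 (.const (2 ^ 50))
  obtain ⟨Q₂, hQ₂⟩ := exists_run_powerLoop (d := 3) (by decide) (by decide) 2 (cell 4)
  refine ⟨Q₁ + Q₂, fun n H t r b hM hb => ?_⟩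
  have hfirst : 1 * (2 ^ 50) ^ n < 2 ^ b := by
    rw [one_mul, ← pow_mul]
    exact Nat.pow_lt_pow_right one_lt_two (by nlinarith [Nat.le_self_pow two_ne_zero n])
  have hsecond : 2 * (2 ^ (50 * n)) ^ n < 2 ^ b := by
    rw [← pow_mul, ← pow_succ']
    exact Nat.pow_lt_pow_right one_lt_two (by nlinarith)
  obtain ⟨T₁, hT₁, hrun₁⟩ := hQ₁ (inputMemory n H t r) b (2 ^ 50) hM (by omega)
    (show n ≤ b by omega) (by norm_num) hfirst fun _ => rfl
  set M₁ := powerState (inputMemory n H t r) 4 1 (2 ^ 50) n with hM₁_eq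
  have hM₁ : Bounded M₁ b :=
    (hM.setCell hfirst 4 0).setCell (Nat.lt_two_pow_self.trans_le (Nat.pow_le_pow_right two_pos
      (by omega))) 5 0
  obtain ⟨T₂, hT₂, hrun₂⟩ := hQ₂ M₁ b (2 ^ (50 * n)) hM₁ (by omega)
    (show n ≤ b by omega) (by positivity) hsecond fun i => by
      rw [Expr.eval, Expr.eval, powerState, setCell_of_ne (by decide), setCell_of_ne (by decide),
        hM₁_eq, powerState, setCell_of_ne (by decide), setCell_same, if_pos rfl, one_mul, ← pow_mul]
  rw [← powerState_powerState_inputMemory]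
  exact ⟨T₁ + T₂, by rw [Polynomial.eval_add]; omega, hrun₁.seq hrun₂⟩

variable {n} in
lemma inputMemory_lt_two {a : ℕ} (ha : a ≠ 0) (i : ℕ) : inputMemory n H t r a i < 2 := by
  unfold inputMemory
  split
  any_goals contradiction
  · split_ifs <;> norm_num
  · norm_num

variable {n} in
lemma bounded_inputMemory : Bounded (inputMemory n H t r) (n + t.size + r.size + 1) := by
  intro a i
  have two_pow_mono {x : ℕ} (hx : x ≤ n + t.size + r.size + 1) :
      2 ^ x ≤ 2 ^ (n + t.size + r.size + 1) := Nat.pow_le_pow_right two_pos hx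
  have htwo : 2 ≤ 2 ^ (n + t.size + r.size + 1) := two_pow_mono (x := 1) (by omega)
  rcases eq_or_ne a 0 with rfl | ha
  · match i with
    | 0 => exact (Nat.lt_two_pow_self (n := n)).trans_le (two_pow_mono (by omega))
    | 1 => exact (Nat.lt_size_self t).trans_le (two_pow_mono (by omega))
    | 2 => exact (Nat.lt_size_self r).trans_le (two_pow_mono (by omega))
    | _ + 3 => exact two_pos.trans_le htwo
  · exact (inputMemory_lt_two H t r ha i).trans_le htwo

variable {n} in
lemma initialMemory_of_notMem {a : ℕ} (ha : a ∉ [3, 4, 5]) :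
    initialMemory n H t r a = inputMemory n H t r a := by
  simp only [List.mem_cons, List.not_mem_nil, or_false, not_or] at ha
  rw [initialMemory, setCell_of_ne ha.2.2, setCell_of_ne ha.2.1, setCell_of_ne ha.1]

lemma reduced_initialMemory : Reduced (initialMemory n H t r) n (modulus n) := by
  have hn : n < modulus n := (Nat.le_self_pow (by norm_num) n).trans_lt (pow_three_lt_modulus n)
  have hpow : 2 ^ (50 * n) < modulus n :=
    Nat.pow_lt_pow_right one_lt_two (by nlinarith [Nat.le_self_pow two_ne_zero n])
  have htwo : 2 ≤ modulus n := Nat.le_self_pow (by omega) 2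
  have hinput : Reduced (setCell (inputMemory n H t r) 3 0 (modulus n)) n (modulus n) := by
    refine ⟨by rw [setCell_of_ne (by decide)]; rfl, by rw [setCell_same, if_pos rfl], hn,
      fun a h0 h3 i => ?_⟩
    rw [setCell_of_ne h3]
    exact (inputMemory_lt_two H t r h0 i).trans_le htwo
  exact (hinput.setCell (by decide) (by decide) hpow 0).setCell (by decide) (by decide) hn 0

lemma bounded_initialMemory {b : ℕ} (hM : Bounded (inputMemory n H t r) b)
    (hb : 50 * n ^ 2 + n + 2 ≤ b) : Bounded (initialMemory n H t r) b := by
  have two_pow_lt {x : ℕ} (hx : x < b) : 2 ^ x < 2 ^ b := Nat.pow_lt_pow_right one_lt_two hx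
  refine ((hM.setCell (two_pow_lt (by omega)) 3 0).setCell (two_pow_lt ?_) 4 0).setCell
    (Nat.lt_two_pow_self.trans (two_pow_lt (by omega))) 5 0
  nlinarith [Nat.le_self_pow two_ne_zero n]

theorem isPolyTime_of_exec {p : Code} (hd : p.Disciplined) (h0 : 0 ∉ p.banks) (h3 : 3 ∉ p.banks)
    {𝒜 : Certifier} (h𝒜 : ∀ (n : ℕ) (H : Hypergraph3 n) (t r : ℕ),
      p.exec (initialMemory n H t r) 2 0 = 𝒜 n H t r) : 𝒜.IsPolyTime := by
  obtain ⟨Q, hQ⟩ := exists_run_modulusProg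
  obtain ⟨P, hP⟩ := Code.exists_runsWithin hd h0 h3
  refine ⟨.seq modulusProg p.compile, (Q + P).comp (.C 50 * .X ^ 2 + .X + .C 2),
    fun n H t r => ?_⟩
  set x := n + t.size + r.size
  set b := 50 * x ^ 2 + x + 2 with hb_eq
  have hnx : n ≤ x := by omega
  have hnb : 50 * n ^ 2 + n + 2 ≤ b := by
    rw [hb_eq]
    gcongr
  have hinput : Bounded (inputMemory n H t r) b := fun a i =>
    (bounded_inputMemory H t r a i).trans_le (Nat.pow_le_pow_right two_pos (by omega))
  have hinitial := bounded_initialMemory n H t r hinput hnb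
  have hred := reduced_initialMemory n H t r
  obtain ⟨S, hS, hmodulus⟩ := hQ n H t r b hinput hnb
  obtain ⟨-, T, hT, hrun⟩ := hP (initialMemory n H t r) b
    ⟨by omega, hinitial, by rw [hred.size_eq]; omega, by rw [hred.modulus_eq, modulus]; positivity⟩
  refine ⟨_, S + T, hmodulus.seq hrun, h𝒜 n H t r, ?_⟩
  simp only [Polynomial.eval_comp, Polynomial.eval_add, Polynomial.eval_mul, Polynomial.eval_C,
    Polynomial.eval_X, Polynomial.eval_pow, ← hb_eq]
  omega

end Modulus

section PolynomialTime

open RAM Code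

lemma disciplined_certifyCode (length : Expr) {out : Code} (hout : out.Disciplined) :
    (certifyCode length out).Disciplined := by
  simp [certifyCode, prepareCode, testCode, countCode, addDegreeCode, positionCode, degreeCode,
    momentCode, gramMomentCode, windowCode, mulCode, fillSumCode, sumCode, powerCode, powerRound,
    powerStep, mulStep, frobeniusCode, flagCode, trivialCode, fillCode, Disciplined, banks, hout]

lemma notMem_banks_certifyCode (length : Expr) {out : Code} {a : ℕ} (ha : a = 0 ∨ a = 3)
    (hout : a ∉ out.banks) : a ∉ (certifyCode length out).banks := by
  have hbanks : (certifyCode length out).banks = (prepareCode length).banks ++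
      (testCode.banks ++ (trivialCode.banks ++ out.banks)) := rfl
  rw [hbanks]
  simp only [List.mem_append, not_or]
  refine ⟨?_, ?_, ?_, hout⟩ <;> rcases ha with rfl | rfl <;> simp [trivialCode, banks]

/-- The expression for `windowLength n r`. -/
def windowLengthExpr : Expr :=
  .sub (cell 0) (.sub (cell 0) (.add (.div (.mul (.add (.read 0 (.const 2)) (.const 1))
    (.add (.read 0 (.const 2)) (.const 1))) (cell 0)) (.const 1)))

lemma isPolyTime_windowCertifier_sparse :
    (windowCertifier windowLength fun n s => n * 2 ^ s).IsPolyTime := by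
  refine isPolyTime_of_exec (p := certifyCode windowLengthExpr sparseCode)
    (disciplined_certifyCode _ (by simp [sparseCode, Disciplined, banks]))
    (notMem_banks_certifyCode _ (by simp) (by simp [sparseCode, banks]))
    (notMem_banks_certifyCode _ (by simp) (by simp [sparseCode, banks])) fun n H t r => ?_
  have hinput := initialMemory_of_notMem H t r (a := 0) (by decide)
  have htensor := initialMemory_of_notMem H t r (a := 1) (by decide)
  have hvalue : n * 2 ^ n < modulus n :=
    calc n * 2 ^ n ≤ 2 ^ n * 2 ^ n := Nat.mul_le_mul_right _ Nat.lt_two_pow_self.le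
      _ = 2 ^ (n + n) := (pow_add _ _ _).symm
      _ < modulus n := Nat.pow_lt_pow_right one_lt_two (by nlinarith)
  refine exec_certifyCode (reduced_initialMemory n H t r) hinput htensor (windowLength_le _ _)
    (fun _ => rfl) (fun M' hM' => ?_) fun M' hM' => hM'.exec_sparseCode (windowLength_le _ _) hvalue
  simp only [windowLengthExpr, Expr.eval, hM', hinput, inputMemory, windowLength, ← sq]
  generalize (r + 1) ^ 2 / n = y
  omega

lemma isPolyTime_windowCertifier_dense :
    (windowCertifier (fun _ _ => 1) fun _ _ => 1).IsPolyTime := by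
  refine isPolyTime_of_exec (p := certifyCode (.sub (.const 1) (.sub (.const 1) (cell 0)))
      (assign 2 (.const 0) (.const 1)))
    (disciplined_certifyCode _ trivial)
    (notMem_banks_certifyCode _ (by simp) (by simp [banks]))
    (notMem_banks_certifyCode _ (by simp) (by simp [banks])) fun n H t r => ?_
  have hinput := initialMemory_of_notMem H t r (a := 0) (by decide)
  have htensor := initialMemory_of_notMem H t r (a := 1) (by decide)
  refine exec_certifyCode (s := 1 - (1 - n)) (reduced_initialMemory n H t r) hinput htensor
    (by omega) (fun hn => by omega) (fun M' hM' => ?_) fun M' hM' => ?_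
  · simp only [Expr.eval, hM', hinput, inputMemory]
  · rw [exec_assign_cell hM'.toReduced, Expr.eval]
    exact Nat.mod_eq_of_lt (Nat.one_lt_two_pow (by omega))

end PolynomialTime

end ThreeXOR

theorem mainTheorem5 :
    ∃ η₀ : ℝ, 0 < η₀ ∧ ∃ C : ℝ, 0 < C ∧ ∀ δ : ℝ, 0 < δ → δ < 2 →
      ∃ 𝒜 : Certifier, 𝒜.IsPolyTime ∧ 𝒜.IsSound ∧
        ∀ K : ℕ, ∀ᶠ n : ℕ in Filter.atTop, ∀ η : ℝ, 0 ≤ η → η ≤ η₀ →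
          let Δ : ℝ := (n : ℝ) ^ δ
          let θ : ℝ := clusterScale n Δ η
          1 - 1 / (n : ℝ) ^ K ≤
            (randomHypergraph3 n (Δ * n)).real
              {H | (𝒜 n H ⌊η * (H.ncard : ℝ)⌋₊ ⌊θ * n / 2⌋₊ : ℝ) ≤
                Real.exp (C * (θ ^ 2 * Real.log (1 / θ)) * n)} := by
  refine ⟨1 / 1000, by norm_num, 5, by norm_num, fun δ hδ hδ2 => ?_⟩
  rcases le_or_gt δ 1 with h | h
  · exact ⟨_, ThreeXOR.isPolyTime_windowCertifier_sparse, ThreeXOR.isSound_windowCertifier_sparse _,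
      fun K => ThreeXOR.eventually_sparse_bound hδ h K⟩
  · exact ⟨_, ThreeXOR.isPolyTime_windowCertifier_dense, ThreeXOR.isSound_windowCertifier_dense,
      fun K => ThreeXOR.eventually_dense_bound h hδ2 K⟩
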